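/- Let $F>0$ (the Froude number), $\nu,\nu'>0$, $\nu_0=\min(\nu,\nu')$, and on $\mathbb{R}^3$ put $\Delta_F=\partial_1^2+\partial_2^2+F^2\partial_3^2$ and $\Gamma=\Delta\Delta_F^{-1}(\nu\partial_1^2+\nu\partial_2^2+\nu'F^2\partial_3^2)$. For a vector field $U=(v,\theta):\mathbb{R}^3\to\mathbb{R}^3\times\mathbb{R}$ let $\Omega(U)=\partial_1v^2-\partial_2v^1-F\partial_3\theta$ and $\mathcal{Q}(U)=(-\partial_2,\partial_1,0,-F\partial_3)\Delta_F^{-1}\Omega(U)$; $U$ is called quasi-geostrophic if $U=\mathcal{Q}(U)$. The 3D quasi-geostrophic system is $$\partial_tU+\mathcal{Q}(v\cdot\nabla U)-\Gamma U=0,\qquad U=\mathcal{Q}(U),\qquad U_{|t=0}=U_0. \tag{QG}$$ For $s\in\mathbb{R}$ let $\dot E^s=\mathcal{C}(\mathbb{R}_+;\dot H^s)\cap L^\infty(\mathbb{R}_+;\dot H^s)\cap L^2(\mathbb{R}_+;\dot H^{s+1})$. Let $\delta>0$ and let $U_0\in H^{\frac12+\delta}(\mathbb{R}^3)$ be a quasi-geostrophic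 vector field. Then (QG) has a unique global solution $U$ in $\dot E^0\cap\dot E^{\frac12+\delta}$. Moreover, if $\delta\le\frac12$, then for all $t\ge0$ $$\|U\|_{L^\infty([0,t];H^{\frac12+\delta})}^2+\nu_0\int_0^t\|\nabla U(\tau)\|_{H^{\frac12+\delta}}^2\,d\tau\le C\,\|U_0\|_{H^{\frac12+\delta}}^2\max\bigl(1,\|U_0\|_{H^{\frac12+\delta}}^{1/\delta}\bigr),$$ where the constant $C>0$ depends only on $\delta$, $\nu_0$ and the fixed parameter $F$. -/

import Mathlib

open MeasureTheory Set Filter Topology FourierTransform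
open scoped ENNReal

noncomputable section

namespace QuasiGeo

/-- Physical space `ℝ³`; also used for frequencies. -/
abbrev E3 := EuclideanSpace ℝ (Fin 3)

/-- Values `(v¹, v², v³, θ)` of a real field. -/
abbrev R4 := EuclideanSpace ℝ (Fin 4)

/-- Complexified values, used for Fourier transforms and test fields. -/
abbrev C4 := EuclideanSpace ℂ (Fin 4)

/-- Real fields `U = (v, θ) ∈ L²(ℝ³; ℝ⁴)`. -/
abbrev Field := Lp (α := E3) R4 2 volume

/-- The inclusion `ℝ⁴ → ℂ⁴`. -/
def ofRealCLM : R4 →L[ℝ] C4 :=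
  LinearMap.toContinuousLinearMap
    { toFun := fun x => WithLp.toLp 2 (fun i => (x i : ℂ))
      map_add' := by intro x y; ext i; simp
      map_smul' := by intro c x; ext i; simp }

/-- The Fourier transform `Û` of a field, with the convention
`Û(ξ) = ∫ exp(-2πi x·ξ) U(x) dx` (extended to `L²` by Plancherel). -/
def fhat (f : Field) : Lp (α := E3) C4 2 volume :=
  𝓕 (ofRealCLM.compLp f)

/-! ### Norms -/

/-- `(∫ w(ξ) |f̂(ξ)|² dξ)^{1/2} ∈ [0, ∞]`. -/
def weightedNorm (w : E3 → ℝ) (f : Field) : ℝ≥0∞ :=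
  (∫⁻ ξ : E3, ENNReal.ofReal (w ξ) * ‖fhat f ξ‖ₑ ^ 2) ^ (1 / 2 : ℝ)

/-- The modulus of the angular frequency `2πξ`, i.e. the symbol of `|D|`. -/
def absD (ξ : E3) : ℝ := 2 * Real.pi * ‖ξ‖

/-- The homogeneous norm `‖f‖_{Ḣ^s}`. -/
def homNorm (s : ℝ) (f : Field) : ℝ≥0∞ :=
  weightedNorm (fun ξ => absD ξ ^ (2 * s)) f

/-- The inhomogeneous norm `‖f‖_{H^s}`. -/
def sobNorm (s : ℝ) (f : Field) : ℝ≥0∞ :=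
  weightedNorm (fun ξ => (1 + absD ξ ^ 2) ^ s) f

/-- The norm `‖∇f‖_{H^s}`. -/
def gradSobNorm (s : ℝ) (f : Field) : ℝ≥0∞ :=
  weightedNorm (fun ξ => absD ξ ^ 2 * (1 + absD ξ ^ 2) ^ s) f

/-- Membership of an `L²`-valued curve on `ℝ₊` in `Ė^s = C(ℝ₊; Ḣ^s) ∩ L²(ℝ₊; Ḣ^{s+1})`, with finite
norm `sup_t ‖U(t)‖_{Ḣ^s}² + ν₀ ∫ ‖U(t)‖_{Ḣ^{s+1}}² dt` (finiteness does not depend on `ν₀ > 0`).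
Values of `U` at negative times play no role. -/
structure MemE (s : ℝ) (U : ℝ → Field) : Prop where
  continuous : ∀ t ∈ Ici (0 : ℝ),
    Tendsto (fun τ => homNorm s (U τ - U t)) (𝓝[Ici 0] t) (𝓝 0)
  sup_lt_top : (⨆ t ∈ Ici (0 : ℝ), homNorm s (U t)) < ∞
  integral_lt_top : (∫⁻ t in Ici (0 : ℝ), homNorm (s + 1) (U t) ^ 2) < ∞

/-! ### Fourier multipliers -/

/-- The symbol of `∂_j`. -/
def dSym (j : Fin 3) (ξ : E3) : ℂ := 2 * Real.pi * Complex.I * (ξ j : ℂ)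

/-- The symbol of the Laplacian `Δ = ∂₁² + ∂₂² + ∂₃²`. -/
def lapSym (ξ : E3) : ℂ := dSym 0 ξ ^ 2 + dSym 1 ξ ^ 2 + dSym 2 ξ ^ 2

/-- The symbol of `Δ_F = ∂₁² + ∂₂² + F² ∂₃²`. -/
def lapFSym (F : ℝ) (ξ : E3) : ℂ := dSym 0 ξ ^ 2 + dSym 1 ξ ^ 2 + (F : ℂ) ^ 2 * dSym 2 ξ ^ 2

/-- The symbol of the diffusion `Γ = Δ Δ_F⁻¹ (ν ∂₁² + ν ∂₂² + ν' F² ∂₃²)`. -/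
def gammaSym (ν ν' F : ℝ) (ξ : E3) : ℂ :=
  lapSym ξ * (lapFSym F ξ)⁻¹ *
    ((ν : ℂ) * dSym 0 ξ ^ 2 + (ν : ℂ) * dSym 1 ξ ^ 2 + (ν' : ℂ) * (F : ℂ) ^ 2 * dSym 2 ξ ^ 2)

/-- The potential vorticity `Ω(U) = ∂₁ v² - ∂₂ v¹ - F ∂₃ θ` on the Fourier side. -/
def omegaSym (F : ℝ) (ξ : E3) (u : C4) : ℂ :=
  dSym 0 ξ * u 1 - dSym 1 ξ * u 0 - (F : ℂ) * dSym 2 ξ * u 3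

/-- The projector `𝒬(U) = (-∂₂, ∂₁, 0, -F ∂₃) Δ_F⁻¹ Ω(U)` on the Fourier side. -/
def qSym (F : ℝ) (ξ : E3) (u : C4) : C4 :=
  ((lapFSym F ξ)⁻¹ * omegaSym F ξ u) •
    WithLp.toLp 2 ![-dSym 1 ξ, dSym 0 ξ, 0, -((F : ℂ) * dSym 2 ξ)]

/-- `U` is quasi-geostrophic: `U = 𝒬(U)`. -/
def IsQG (F : ℝ) (f : Field) : Prop :=
  ∀ᵐ ξ : E3, fhat f ξ = qSym F ξ (fhat f ξ)

/-- `𝒬 φ` for a test field `φ`. -/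
def qTest (F : ℝ) (φ : SchwartzMap E3 C4) : E3 → C4 :=
  𝓕⁻ (fun ξ : E3 => qSym F ξ (𝓕 φ ξ))

/-- `Γ φ` for a test field `φ`. -/
def gammaTest (ν ν' F : ℝ) (φ : SchwartzMap E3 C4) : E3 → C4 :=
  𝓕⁻ (fun ξ : E3 => gammaSym ν ν' F ξ • 𝓕 φ ξ)

/-! ### The quasi-geostrophic system -/

/-- The pairing `∫ U·φ dx` (bilinear, without conjugation). -/
def pair (f : Field) (φ : E3 → C4) : ℂ :=
  ∫ x : E3, ∑ k : Fin 4, (f x k : ℂ) * φ x k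

/-- `∫ ∑_j v^j U·∂_j φ dx`, which is `-⟨v·∇U, φ⟩ = -⟨div (v ⊗ U), φ⟩` when `div v = 0`. -/
def convPair (f : Field) (φ : E3 → C4) : ℂ :=
  ∫ x : E3, ∑ j : Fin 3, ∑ k : Fin 4,
    (f x j.castSucc : ℂ) * (f x k : ℂ) * fderiv ℝ φ x (EuclideanSpace.single j 1) k

/-- `U` solves, in the sense of distributions, the system
`∂_t U + 𝒬(v·∇U) - Γ U = 0`, `U = 𝒬(U)`, `U(0) = U₀` on `ℝ₊ × ℝ³`.
The symbols of `𝒬` and `Γ` are symmetric and even in `ξ`, so that both operators are equal to their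
transposes for `pair` and can be moved to the test field. (For `U ∈ C(ℝ₊; L²)` the integrand
in time is continuous.) -/
structure IsSolution (ν ν' F : ℝ) (U₀ : Field) (U : ℝ → Field) : Prop where
  initial : U 0 = U₀
  isQG : ∀ t, 0 ≤ t → IsQG F (U t)
  equation : ∀ φ : SchwartzMap E3 C4, ∀ t, 0 ≤ t →
    pair (U t) φ = pair U₀ φ +
      ∫ τ in (0 : ℝ)..t, (pair (U τ) (gammaTest ν ν' F φ) + convPair (U τ) (qTest F φ))

end QuasiGeo

end

/-! On the Fourier side, `𝒬` is at each frequency the orthogonal projection onto the line spanned by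
the unit vector `evec`, so a quasi-geostrophic field is one Hermitian scalar function `a` in L²
(`toScal`, `exists_toScal_eq`), with the same Sobolev norms. The system becomes `a' = g a - B(a,
a)`. Here `g ≤ -ν₀|D|²` is the symbol of `Γ` (`diffSym_gammaR`) and `B` is a convolution whose
kernel is bounded by `|D|` at the output frequency (`abs_kern_le`). A forcing of size `|D| f` is
absorbed by the diffusion at the cost of `‖f‖²/ν₀` (`two_mul_inner_mulOp_le`), and by Young's
inequality a product costs the L¹ norm of `a` times a weighted L² norm. All a priori bounds thus
reduce to controlling the time integral of `‖a‖²` in L¹.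

Global existence rests on two conservation laws: `B` is orthogonal to `a` and to `|ρ|² a`
(`inner_bilOp_self`, `inner_mulOp_rho_bilOp_self`). Both follow from writing the kernel as a totally
antisymmetric factor times a quadratic polynomial in the norms of `ρ` (`kern_eq_antiKern`). Energy
plus potential enstrophy is equivalent to the H¹ norm, hence H¹ data are controlled for all time
with no loss.

For data above H¹ (`δ > 1/2`), the enstrophy dissipation bounds the L¹ norm in time and Grönwall
propagates H^s. For `δ ≤ 1/2`, with `Y = max(1, ‖U₀‖²)`, take a frequency scale `R` with `R^(2δ)`
proportional to `Y`. The subcritical estimate `exists_sq_oneNorm_le_scale` keeps the H^s norm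
comparable to the data during a time of order `R⁻²`. Within that time some instant `t₀` has H¹ norm
squared at most a multiple of `R ‖U₀‖²`, and from `t₀` on the conservation laws take over. As `R` is
a multiple of `Y^(1/(2δ))`, this is exactly the stated growth.

Solutions are limits of the systems truncated to `|D| < N`, which are ordinary differential
equations in a Hilbert space. The truncated solutions are Cauchy in L², uniformly on bounded times
(`exists_norm_sub_sq_le`). Continuity in H^s comes from propagating the high-frequency tails
(`IsScalarSol.qf_tailW_le`), uniqueness from a Grönwall lemma with an integrable kernel
(`IsScalarSol.unique`). Finally the scalar equation is shown equivalent to the distributional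
formulation by Parseval (`isSolution_of_isScalarSol`, `IsSolution.isScalarSol`). -/

noncomputable section

namespace QuasiGeo

/-! ### Ordinary differential equations and Grönwall inequalities -/

/-- Global existence for a locally Lipschitz dissipative vector field on a Hilbert space. -/
theorem exists_solution_of_inner_nonpos {E : Type*} [NormedAddCommGroup E]
    [InnerProductSpace ℝ E] [CompleteSpace E] (f : E → E)
    (hf : ∀ M : ℝ, ∃ L : NNReal, LipschitzOnWith L f (Metric.closedBall 0 M))
    (hdiss : ∀ u, inner ℝ u (f u) ≤ 0) (u₀ : E) (T : ℝ) (hT : 0 ≤ T) :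
    ∃ u : ℝ → E, u 0 = u₀ ∧ ∀ t ∈ Icc 0 T, HasDerivWithinAt u (f (u t)) (Icc 0 T) t := by
  set M := ‖u₀‖ with hM
  have hM0 : 0 ≤ M := norm_nonneg _
  obtain ⟨L, hL⟩ := hf (M + 1)
  set B : ℝ := ‖f 0‖ + L * (M + 1) with hB
  have hB0 : 0 ≤ B := by positivity
  have hbound : ∀ x, ‖x‖ ≤ M + 1 → ‖f x‖ ≤ B := by
    intro x hx
    have h1 := hL.dist_le_mul x (by simpa using hx) 0 (by simpa using by linarith)
    rw [dist_eq_norm, dist_zero_right] at h1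
    calc ‖f x‖ = ‖f 0 + (f x - f 0)‖ := by congr 1; abel
      _ ≤ ‖f 0‖ + ‖f x - f 0‖ := norm_add_le _ _
      _ ≤ ‖f 0‖ + L * ‖x‖ := by gcongr
      _ ≤ B := by rw [hB]; gcongr
  -- A Lipschitz cutoff equal to 1 on the ball of radius `‖u₀‖` and to 0 outside radius `‖u₀‖ + 1`.
  -- It makes `θ • f` bounded and globally Lipschitz, so Picard–Lindelöf applies on all of `[0, T]`
  -- at once.
  set θ : E → ℝ := fun x => max 0 (min 1 (M + 1 - ‖x‖)) with hθ
  have hθ0 : ∀ x, 0 ≤ θ x := fun x => le_max_left _ _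
  have hθ1 : ∀ x, θ x ≤ 1 := fun x => max_le zero_le_one (min_le_left _ _)
  have hθout : ∀ x, M + 1 < ‖x‖ → θ x = 0 := by
    intro x hx
    exact max_eq_left ((min_le_right _ _).trans (by linarith))
  have hθin : ∀ x, ‖x‖ ≤ M → θ x = 1 := by
    intro x hx
    rw [hθ]; simp only
    rw [min_eq_left (by linarith), max_eq_right zero_le_one]
  have hθlip : ∀ x y, |θ x - θ y| ≤ ‖x - y‖ := by
    intro x y
    have h1 := abs_max_sub_max_le_max 0 (min 1 (M + 1 - ‖x‖)) 0 (min 1 (M + 1 - ‖y‖))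
    have h2 := abs_min_sub_min_le_max 1 (M + 1 - ‖x‖) 1 (M + 1 - ‖y‖)
    simp only [sub_self, abs_zero] at h1 h2
    have h3 : |M + 1 - ‖x‖ - (M + 1 - ‖y‖)| ≤ ‖x - y‖ := by
      have := abs_norm_sub_norm_le y x
      rw [norm_sub_rev] at this
      convert this using 2; ring
    rw [max_eq_right (a := (0 : ℝ)) (abs_nonneg (_ - _))] at h1 h2
    exact h1.trans (h2.trans h3)
  set g : E → E := fun x => θ x • f x with hg
  have hgb : ∀ x, ‖g x‖ ≤ B := by
    intro x
    by_cases hx : ‖x‖ ≤ M + 1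
    · rw [hg]; simp only [norm_smul, Real.norm_eq_abs, abs_of_nonneg (hθ0 x)]
      calc θ x * ‖f x‖ ≤ 1 * B := by gcongr; exacts [hθ1 x, hbound x hx]
        _ = B := one_mul _
    · rw [hg]; simp only [hθout x (not_le.mp hx), zero_smul, norm_zero]; exact hB0
  have hkey : ∀ x y, ‖x‖ ≤ M + 1 → ‖g x - g y‖ ≤ (B + L) * ‖x - y‖ := by
    intro x y hx
    have h0 : ‖θ x • f x - θ y • f x‖ ≤ B * ‖x - y‖ := by
      rw [← sub_smul, norm_smul, mul_comm, Real.norm_eq_abs]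
      gcongr
      exacts [hbound x hx, hθlip x y]
    by_cases hy : ‖y‖ ≤ M + 1
    · have h1 : ‖θ y • f x - θ y • f y‖ ≤ L * ‖x - y‖ := by
        rw [← smul_sub, norm_smul, Real.norm_eq_abs, abs_of_nonneg (hθ0 y)]
        have := hL.dist_le_mul x (by simpa using hx) y (by simpa using hy)
        rw [dist_eq_norm, dist_eq_norm] at this
        calc θ y * ‖f x - f y‖ ≤ 1 * (L * ‖x - y‖) := by gcongr; exact hθ1 y
          _ = _ := one_mul _
      calc ‖g x - g y‖ = ‖(θ x • f x - θ y • f x) + (θ y • f x - θ y • f y)‖ := by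
            rw [hg]; congr 1; abel
        _ ≤ B * ‖x - y‖ + L * ‖x - y‖ := (norm_add_le _ _).trans (add_le_add h0 h1)
        _ = _ := by ring
    · have : g x - g y = θ x • f x - θ y • f x := by
        simp [hg, hθout y (not_le.mp hy)]
      rw [this]
      refine h0.trans ?_
      gcongr
      linarith [L.2]
  have hglip : LipschitzWith (Real.toNNReal (B + L)) g := by
    refine LipschitzWith.of_dist_le_mul fun x y => ?_
    rw [dist_eq_norm, dist_eq_norm, Real.coe_toNNReal _ (by positivity)]
    by_cases hx : ‖x‖ ≤ M + 1
    · exact hkey x y hx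
    by_cases hy : ‖y‖ ≤ M + 1
    · rw [norm_sub_rev, norm_sub_rev x y]; exact hkey y x hy
    · simp only [hg, hθout x (not_le.mp hx), hθout y (not_le.mp hy), zero_smul, sub_self, norm_zero]
      positivity
  have hPL : IsPicardLindelof (fun _ => g) (⟨0, le_rfl, hT⟩ : Icc (0 : ℝ) T) u₀
      (Real.toNNReal (B * T)) 0 (Real.toNNReal B) (Real.toNNReal (B + L)) := by
    refine IsPicardLindelof.of_time_independent ?_ hglip.lipschitzOnWith ?_
    · intro x _
      rw [Real.coe_toNNReal _ hB0]; exact hgb x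
    · rw [Real.coe_toNNReal _ hB0, Real.coe_toNNReal _ (by positivity)]
      simp [hT]
  obtain ⟨u, hu0, hu⟩ := hPL.exists_eq_forall_mem_Icc_hasDerivWithinAt₀
  have hu0' : u 0 = u₀ := hu0
  refine ⟨u, hu0', ?_⟩
  -- Since `θ ≥ 0`, the cut-off field is still dissipative. The norm cannot grow, so the solution
  -- never leaves the region where `θ = 1`.
  have hanti : AntitoneOn (fun t => ‖u t‖ ^ 2) (Icc 0 T) := by
    refine antitoneOn_of_hasDerivWithinAt_nonpos (convex_Icc 0 T)
      (f' := fun t => 2 * inner ℝ (u t) (g (u t))) ?_ ?_ ?_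
    · exact ContinuousOn.pow (ContinuousOn.norm fun t ht => (hu t ht).continuousWithinAt) 2
    · intro t ht
      exact ((hu t (interior_subset ht)).mono interior_subset).norm_sq
    · intro t ht
      have := hdiss (u t)
      simp only [hg, inner_smul_right]
      nlinarith [hθ0 (u t)]
  intro t ht
  have h1 : ‖u t‖ ≤ M := by
    have := hanti ⟨le_rfl, hT⟩ ht ht.1
    simp only [hu0'] at this
    exact (sq_le_sq₀ (norm_nonneg _) hM0).1 this
  have h2 := hu t ht
  simp only [hg, hθin _ h1, one_smul] at h2
  exact h2

theorem hasDerivAt_integral_of_continuousOn {z : ℝ → ℝ} {a b t : ℝ}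
    (hz : ContinuousOn z (Icc a b)) (ht : t ∈ Ioo a b) :
    HasDerivAt (fun t => ∫ τ in a..t, z τ) (z t) t := by
  refine intervalIntegral.integral_hasDerivAt_right ?_ ?_ ?_
  · exact (hz.mono (Icc_subset_Icc_right ht.2.le)).intervalIntegrable_of_Icc ht.1.le
  · exact ContinuousOn.stronglyMeasurableAtFilter isOpen_Ioo (hz.mono Ioo_subset_Icc_self) t ht
  · exact hz.continuousAt (Icc_mem_nhds ht.1 ht.2)

/-- Grönwall's inequality with a dissipative term. -/
theorem gronwall_add_integral_le {y y' z k : ℝ → ℝ} {a b : ℝ}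
    (hy : ∀ t ∈ Icc a b, HasDerivWithinAt y (y' t) (Icc a b) t)
    (hz : ContinuousOn z (Icc a b)) (hk : ContinuousOn k (Icc a b))
    (hz0 : ∀ t ∈ Icc a b, 0 ≤ z t) (hk0 : ∀ t ∈ Icc a b, 0 ≤ k t)
    (h : ∀ t ∈ Icc a b, y' t + z t ≤ k t * y t) {t : ℝ} (ht : t ∈ Icc a b) :
    y t + ∫ τ in a..t, z τ ≤ y a * Real.exp (∫ τ in a..t, k τ) := by
  have hab : a ≤ b := ht.1.trans ht.2
  set Z := fun t => ∫ τ in a..t, z τ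
  set K := fun t => ∫ τ in a..t, k τ
  have hcont : ∀ {f : ℝ → ℝ}, ContinuousOn f (Icc a b) →
      ContinuousOn (fun t => ∫ τ in a..t, f τ) (Icc a b) := by
    intro f hf
    have := intervalIntegral.continuousOn_primitive_interval (μ := volume)
      (f := f) (a := a) (b := b) (by rw [uIcc_of_le hab]; exact hf.integrableOn_Icc)
    rwa [uIcc_of_le hab] at this
  -- The accumulated dissipation `Z` is put inside the Grönwall quantity; this is harmless because
  -- `k * y ≤ k * (y + Z)`.
  have hanti : AntitoneOn (fun t => (y t + Z t) * Real.exp (-K t)) (Icc a b) := by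
    refine antitoneOn_of_hasDerivWithinAt_nonpos (convex_Icc a b)
      (f' := fun t => (y' t + z t) * Real.exp (-K t) +
        (y t + Z t) * (Real.exp (-K t) * (-k t))) ?_ ?_ ?_
    · have hyc : ContinuousOn y (Icc a b) := fun t ht => (hy t ht).continuousWithinAt
      exact (hyc.add (hcont hz)).mul
        (Real.continuous_exp.comp_continuousOn (hcont hk).neg)
    · intro t ht
      have h1 := (hy t (interior_subset ht)).mono (interior_subset (s := Icc a b))
      rw [interior_Icc] at ht
      have h2 := (hasDerivAt_integral_of_continuousOn hz ht).hasDerivWithinAt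
        (s := interior (Icc a b))
      have h3 := (hasDerivAt_integral_of_continuousOn hk ht).hasDerivWithinAt
        (s := interior (Icc a b))
      exact (h1.add h2).mul h3.neg.exp
    · intro t ht
      have ht' := interior_subset ht
      have h1 := h t ht'
      have h2 : 0 ≤ Z t := intervalIntegral.integral_nonneg ht'.1
        fun u hu => hz0 u ⟨hu.1, hu.2.trans ht'.2⟩
      have h3 := Real.exp_pos (-K t)
      have h4 : (y' t + z t) - (y t + Z t) * k t ≤ 0 := by nlinarith [hk0 t ht']
      nlinarith
  have h1 := hanti ⟨le_rfl, hab⟩ ht ht.1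
  simp only [Z, K, intervalIntegral.integral_same, neg_zero, Real.exp_zero, mul_one,
    add_zero] at h1
  have h2 := Real.exp_pos (K t)
  calc y t + Z t = (y t + Z t) * Real.exp (-K t) * Real.exp (K t) := by
        rw [mul_assoc, ← Real.exp_add]; simp
    _ ≤ _ := by gcongr

/-- A Grönwall lemma with an integrable kernel. -/
theorem eq_zero_of_le_lintegral_mul {D k : ℝ → ℝ≥0∞} {T : ℝ} {M : ℝ≥0∞} (hM : M ≠ ∞)
    (hDM : ∀ t ∈ Icc 0 T, D t ≤ M) (hk : ∫⁻ τ in Icc 0 T, k τ ≠ ∞)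
    (h : ∀ t ∈ Icc 0 T, D t ≤ ∫⁻ τ in Icc 0 t, k τ * D τ) : ∀ t ∈ Icc 0 T, D t = 0 := by
  -- Absolute continuity of the integral gives a length `r` such that `k` has mass below 1/2 on
  -- every interval of length `r`. The vanishing of `D` then propagates by steps of length `r`.
  obtain ⟨δ, hδ0, hδ⟩ := exists_pos_setLIntegral_lt_of_measure_lt hk
    (ε := 1 / 2) (by simp)
  obtain ⟨r, hr0, hrδ⟩ : ∃ r : ℝ, 0 < r ∧ ENNReal.ofReal r < δ := by
    rcases eq_or_ne δ ∞ with rfl | hne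
    · exact ⟨1, one_pos, by simp⟩
    · refine ⟨δ.toReal / 2, half_pos (ENNReal.toReal_pos hδ0.ne' hne), ?_⟩
      rw [ENNReal.ofReal_lt_iff_lt_toReal (by positivity) hne]
      exact half_lt_self (ENNReal.toReal_pos hδ0.ne' hne)
  have hstep : ∀ n : ℕ, ∀ t ∈ Icc 0 T, t ≤ n * r → D t = 0 := by
    intro n
    induction n with
    | zero =>
      intro t ht htn
      have : t = 0 := le_antisymm (by simpa using htn) ht.1
      subst this
      have := h 0 ht
      simpa using this
    | succ n ih =>
      set S := {t ∈ Icc 0 T | t ≤ (n + 1 : ℕ) * r} with hS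
      set m := ⨆ t ∈ S, D t with hm
      have hmM : m ≤ M := iSup₂_le fun t ht => hDM t ht.1
      have hle : ∀ t ∈ S, D t ≤ 1 / 2 * m := by
        intro t ht
        refine (h t ht.1).trans ?_
        have hIcc : ∀ τ ∈ Icc 0 t, k τ * D τ ≤ (Icc (n * r) t).indicator k τ * m := by
          intro τ hτ
          by_cases hτn : τ ≤ n * r
          · rw [ih τ ⟨hτ.1, hτ.2.trans ht.1.2⟩ hτn]; simp
          · rw [indicator_of_mem (show τ ∈ Icc (n * r) t from ⟨(not_le.mp hτn).le, hτ.2⟩)]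
            gcongr
            exact le_iSup₂ (f := fun t (_ : t ∈ S) => D t) τ
              ⟨⟨hτ.1, hτ.2.trans ht.1.2⟩, hτ.2.trans ht.2⟩
        have hmt : m ≠ ∞ := ne_top_of_le_ne_top hM hmM
        calc ∫⁻ τ in Icc 0 t, k τ * D τ
            ≤ ∫⁻ τ in Icc 0 t, (Icc (n * r) t).indicator k τ * m :=
              setLIntegral_mono' measurableSet_Icc hIcc
          _ = (∫⁻ τ in Icc 0 t, (Icc (n * r) t).indicator k τ) * m :=
              lintegral_mul_const' _ _ hmt
          _ ≤ (∫⁻ τ in Icc 0 T, (Icc (n * r) t).indicator k τ) * m := by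
              gcongr; exact ht.1.2
          _ = (∫⁻ τ in Icc (n * r) t, k τ ∂(volume.restrict (Icc 0 T))) * m := by
              rw [lintegral_indicator measurableSet_Icc]
          _ ≤ 1 / 2 * m := by
              gcongr
              refine (hδ _ ?_).le
              refine (Measure.restrict_apply_le _ _).trans_lt ?_
              rw [Real.volume_Icc]
              refine lt_of_le_of_lt (ENNReal.ofReal_le_ofReal ?_) hrδ
              have := ht.2
              push_cast at this
              linarith
      -- A finite supremum with `m ≤ m / 2` is zero; this is where the a priori bound `M` matters.
      have hm0 : m = 0 := by
        have h1 : m ≤ 1 / 2 * m := iSup₂_le hle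
        by_contra hne
        have h2 : 1 / 2 * m < 1 * m := by
          refine ENNReal.mul_lt_mul_left hne (ne_top_of_le_ne_top hM hmM) ?_
          simp
        rw [one_mul] at h2
        exact absurd h1 (not_le.mpr h2)
      intro t ht htn
      have := hle t ⟨ht, htn⟩
      rw [hm0] at this
      simpa using this
  intro t ht
  obtain ⟨n, hn⟩ := exists_nat_ge (t / r)
  exact hstep n t ht ((div_le_iff₀ hr0).1 hn)

end QuasiGeo
end

noncomputable section

namespace QuasiGeo

/-! ### Convolution estimates for nonnegative functions -/

theorem sq_lintegral_mul_le {α : Type*} [MeasurableSpace α] {μ : Measure α} {f g : α → ℝ≥0∞}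
    (hf : AEMeasurable f μ) (hg : AEMeasurable g μ) :
    (∫⁻ x, f x * g x ∂μ) ^ 2 ≤ (∫⁻ x, f x ^ 2 ∂μ) * ∫⁻ x, g x ^ 2 ∂μ := by
  have h := ENNReal.lintegral_mul_le_Lp_mul_Lq μ Real.HolderConjugate.two_two hf hg
  have h2 := pow_le_pow_left' h 2
  simp only [Pi.mul_apply] at h2
  refine h2.trans (le_of_eq ?_)
  rw [mul_pow, ← ENNReal.rpow_natCast, ← ENNReal.rpow_natCast, ← ENNReal.rpow_mul,
    ← ENNReal.rpow_mul]
  norm_num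

/-- Convolution of functions with values in `[0, ∞]`. -/
def lconv (f g : E3 → ℝ≥0∞) (ξ : E3) : ℝ≥0∞ := ∫⁻ η, f (ξ - η) * g η

theorem lconv_comm (f g : E3 → ℝ≥0∞) : lconv f g = lconv g f := by
  ext ξ
  rw [lconv, lconv, ← lintegral_sub_left_eq_self (fun η => f (ξ - η) * g η) ξ]
  simp [mul_comm]

theorem measurable_lconv {f g : E3 → ℝ≥0∞} (hf : Measurable f) (hg : Measurable g) :
    Measurable (lconv f g) := by
  refine Measurable.lintegral_prod_right' (f := fun p : E3 × E3 => f (p.1 - p.2) * g p.2) ?_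
  fun_prop

theorem sq_lconv_le {f g : E3 → ℝ≥0∞} (hf : Measurable f) (hg : Measurable g) (ξ : E3) :
    lconv f g ξ ^ 2 ≤ (∫⁻ η, f η ^ 2) * ∫⁻ η, g η ^ 2 := by
  refine (sq_lintegral_mul_le (by fun_prop) hg.aemeasurable).trans (le_of_eq ?_)
  rw [lintegral_sub_left_eq_self (fun η => f η ^ 2) ξ]

/-- Young's inequality `L¹ * L² ⊆ L²`. -/
theorem lintegral_sq_lconv_le {f g : E3 → ℝ≥0∞} (hf : Measurable f) (hg : Measurable g) :
    ∫⁻ ξ, lconv f g ξ ^ 2 ≤ (∫⁻ η, f η) ^ 2 * ∫⁻ η, g η ^ 2 := by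
  -- Cauchy–Schwarz with one factor `f` split as `f^(1/2) · f^(1/2)`; integrating in `ξ` and
  -- exchanging the integrals then finishes.
  have hpt : ∀ ξ, lconv f g ξ ^ 2 ≤ (∫⁻ η, f η) * ∫⁻ η, f (ξ - η) * g η ^ 2 := by
    intro ξ
    have h := sq_lintegral_mul_le (μ := (volume : Measure E3)) (f := fun η => f (ξ - η) ^ (1 / 2 : ℝ))
      (g := fun η => f (ξ - η) ^ (1 / 2 : ℝ) * g η) (by fun_prop) (by fun_prop)
    have hsq : ∀ x : ℝ≥0∞, (x ^ (1 / 2 : ℝ)) ^ 2 = x := by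
      intro x
      rw [← ENNReal.rpow_natCast, ← ENNReal.rpow_mul]; norm_num
    simp only [← mul_assoc, ← sq, mul_pow, hsq] at h
    rwa [lintegral_sub_left_eq_self (fun η => f η) ξ] at h
  calc ∫⁻ ξ, lconv f g ξ ^ 2 ≤ ∫⁻ ξ, (∫⁻ η, f η) * ∫⁻ η, f (ξ - η) * g η ^ 2 := lintegral_mono hpt
    _ = (∫⁻ η, f η) * ∫⁻ ξ, ∫⁻ η, f (ξ - η) * g η ^ 2 := by
        refine lintegral_const_mul _ ?_
        refine Measurable.lintegral_prod_right' (f := fun p : E3 × E3 => f (p.1 - p.2) * g p.2 ^ 2) ?_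
        fun_prop
    _ = (∫⁻ η, f η) * ∫⁻ η, ∫⁻ ξ, f (ξ - η) * g η ^ 2 := by
        rw [lintegral_lintegral_swap]
        refine Measurable.aemeasurable ?_
        simp only [Function.uncurry_def]
        fun_prop
    _ = (∫⁻ η, f η) * ∫⁻ η, (∫⁻ ξ, f ξ) * g η ^ 2 := by
        congr 1
        refine lintegral_congr fun η => ?_
        rw [lintegral_mul_const _ (by fun_prop), lintegral_sub_right_eq_self (fun ξ => f ξ) η]
    _ = _ := by
        rw [lintegral_const_mul _ (by fun_prop), ← mul_assoc, sq]

/-- Tame product estimate for a weight `w` with `w(ξ) ≤ c (w'(ξ - η) + w'(η))`. -/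
theorem lintegral_weight_sq_lconv_le {f g w w' : E3 → ℝ≥0∞} {c : ℝ≥0∞}
    (hf : Measurable f) (hg : Measurable g) (hw' : Measurable w')
    (h : ∀ ξ η, w ξ ≤ c * (w' (ξ - η) + w' η)) :
    ∫⁻ ξ, w ξ * lconv f g ξ ^ 2 ≤
      2 * c * ((∫⁻ η, g η) ^ 2 * (∫⁻ η, w' η * f η ^ 2) +
        (∫⁻ η, f η) ^ 2 * ∫⁻ η, w' η * g η ^ 2) := by
  set W := fun ξ => w' ξ ^ (1 / 2 : ℝ) with hWdef
  have hW : Measurable W := by fun_prop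
  have hsq : ∀ x : ℝ≥0∞, (x ^ (1 / 2 : ℝ)) ^ 2 = x := by
    intro x
    rw [← ENNReal.rpow_natCast, ← ENNReal.rpow_mul]; norm_num
  have hsum : ∀ a b : ℝ≥0∞, (a + b) ^ 2 ≤ 2 * (a ^ 2 + b ^ 2) := by
    intro a b
    have := ENNReal.rpow_add_le_mul_rpow_add_rpow a b (p := 2) (by norm_num)
    norm_num at this
    exact this
  have hpt : ∀ ξ, w ξ * lconv f g ξ ^ 2 ≤
      c * (2 * (lconv (fun η => W η * f η) g ξ ^ 2 + lconv f (fun η => W η * g η) ξ ^ 2)) := by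
    intro ξ
    -- The square root of the weight is subadditive up to `c^(1/2)`, so it can be distributed over
    -- the two factors of the convolution. The other factor is then measured in L¹ by Young's
    -- inequality.
    have h1 : w ξ ^ (1 / 2 : ℝ) * lconv f g ξ ≤
        c ^ (1 / 2 : ℝ) * (lconv (fun η => W η * f η) g ξ + lconv f (fun η => W η * g η) ξ) := by
      unfold lconv
      rw [← lintegral_add_left (by fun_prop), ← lintegral_const_mul _ (by fun_prop),
        ← lintegral_const_mul _ (by fun_prop)]
      refine lintegral_mono fun η => ?_
      have h2 : w ξ ^ (1 / 2 : ℝ) ≤ c ^ (1 / 2 : ℝ) * (W (ξ - η) + W η) := by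
        calc w ξ ^ (1 / 2 : ℝ) ≤ (c * (w' (ξ - η) + w' η)) ^ (1 / 2 : ℝ) :=
              ENNReal.rpow_le_rpow (h ξ η) (by norm_num)
          _ = c ^ (1 / 2 : ℝ) * (w' (ξ - η) + w' η) ^ (1 / 2 : ℝ) :=
              ENNReal.mul_rpow_of_nonneg _ _ (by norm_num)
          _ ≤ _ := by
              gcongr
              exact ENNReal.rpow_add_le_add_rpow _ _ (by norm_num) (by norm_num)
      calc w ξ ^ (1 / 2 : ℝ) * (f (ξ - η) * g η)
          ≤ c ^ (1 / 2 : ℝ) * (W (ξ - η) + W η) * (f (ξ - η) * g η) := by gcongr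
        _ = _ := by ring
    have h3 := pow_le_pow_left' h1 2
    rw [mul_pow, mul_pow, hsq, hsq] at h3
    exact h3.trans (by gcongr; exact hsum _ _)
  have hWf : ∀ f : E3 → ℝ≥0∞, ∫⁻ η, (W η * f η) ^ 2 = ∫⁻ η, w' η * f η ^ 2 := by
    intro f
    refine lintegral_congr fun η => ?_
    rw [mul_pow, hWdef]; simp only [hsq]
  have hmWf : Measurable fun η => W η * f η := by fun_prop
  have hmWg : Measurable fun η => W η * g η := by fun_prop
  have hm1 := measurable_lconv hmWf hg
  have hm2 := measurable_lconv hf hmWg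
  calc ∫⁻ ξ, w ξ * lconv f g ξ ^ 2
      ≤ ∫⁻ ξ, c * (2 * (lconv (fun η => W η * f η) g ξ ^ 2 +
          lconv f (fun η => W η * g η) ξ ^ 2)) := lintegral_mono hpt
    _ = 2 * c * ((∫⁻ ξ, lconv (fun η => W η * f η) g ξ ^ 2) +
          ∫⁻ ξ, lconv f (fun η => W η * g η) ξ ^ 2) := by
        rw [lintegral_const_mul _ (by fun_prop), lintegral_const_mul _ (by fun_prop),
          lintegral_add_left (by fun_prop)]
        ring
    _ ≤ _ := by
        gcongr
        · rw [lconv_comm, ← hWf f]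
          exact lintegral_sq_lconv_le hg hmWf
        · rw [← hWf g]
          exact lintegral_sq_lconv_le hf hmWg

/-- The Cauchy–Schwarz inequality with a weight. -/
theorem sq_lintegral_le_mul_lintegral_weight {f w : E3 → ℝ≥0∞} (hf : Measurable f)
    (hw : Measurable w) (h0 : ∀ᵐ ξ, w ξ ≠ 0) (ht : ∀ᵐ ξ, w ξ ≠ ∞) :
    (∫⁻ ξ, f ξ) ^ 2 ≤ (∫⁻ ξ, (w ξ)⁻¹) * ∫⁻ ξ, w ξ * f ξ ^ 2 := by
  have hsq : ∀ x : ℝ≥0∞, (x ^ (1 / 2 : ℝ)) ^ 2 = x := by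
    intro x
    rw [← ENNReal.rpow_natCast, ← ENNReal.rpow_mul]; norm_num
  have h := sq_lintegral_mul_le (μ := (volume : Measure E3))
    (f := fun ξ => (w ξ)⁻¹ ^ (1 / 2 : ℝ)) (g := fun ξ => w ξ ^ (1 / 2 : ℝ) * f ξ)
    (by fun_prop) (by fun_prop)
  simp only [mul_pow, hsq] at h
  refine le_trans (le_of_eq ?_) h
  congr 1
  refine lintegral_congr_ae ?_
  filter_upwards [h0, ht] with ξ h1 h2
  rw [← mul_assoc, ← ENNReal.mul_rpow_of_nonneg _ _ (by norm_num), ENNReal.inv_mul_cancel h1 h2]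
  simp

/-! ### Weights -/

theorem absD_nonneg (ξ : E3) : 0 ≤ absD ξ := by unfold absD; positivity

theorem continuous_absD : Continuous absD := by unfold absD; fun_prop

theorem measurable_absD : Measurable absD := continuous_absD.measurable

attribute [fun_prop] continuous_absD measurable_absD

theorem absD_neg (ξ : E3) : absD (-ξ) = absD ξ := by simp [absD]

theorem absD_add_le (ξ η : E3) : absD (ξ + η) ≤ absD ξ + absD η := by
  unfold absD
  rw [← mul_add]
  gcongr
  exact norm_add_le _ _

theorem absD_le_sub_add (ξ η : E3) : absD ξ ≤ absD (ξ - η) + absD η := by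
  simpa using absD_add_le (ξ - η) η

theorem absD_pos {ξ : E3} (h : ξ ≠ 0) : 0 < absD ξ := by
  have := norm_pos_iff.2 h
  unfold absD; positivity

/-- The weight `(1 + |D|²)^s`. -/
def sobW (s : ℝ) (ξ : E3) : ℝ := (1 + absD ξ ^ 2) ^ s

theorem sobW_pos (s : ℝ) (ξ : E3) : 0 < sobW s ξ := by unfold sobW; positivity

@[fun_prop]
theorem measurable_sobW (s : ℝ) : Measurable (sobW s) := by unfold sobW; fun_prop

/-- The high-frequency part of the weight `(1 + |D|²)^s`. -/
def tailW (s R : ℝ) : E3 → ℝ := {ξ | R ≤ absD ξ}.indicator (sobW s)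

theorem measurableSet_le_absD (R : ℝ) : MeasurableSet {ξ : E3 | R ≤ absD ξ} :=
  measurableSet_le measurable_const measurable_absD

@[fun_prop]
theorem measurable_tailW (s R : ℝ) : Measurable (tailW s R) :=
  (measurable_sobW s).indicator (measurableSet_le_absD R)

theorem tailW_nonneg (s R : ℝ) (ξ : E3) : 0 ≤ tailW s R ξ :=
  indicator_nonneg (fun ξ _ => (sobW_pos s ξ).le) ξ

theorem tailW_zero (s : ℝ) : tailW s 0 = sobW s := by
  ext ξ
  simp [tailW, absD_nonneg]

theorem tailW_le_sobW (s R : ℝ) (ξ : E3) : tailW s R ξ ≤ sobW s ξ :=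
  indicator_le_self' (fun _ _ => (sobW_pos s _).le) ξ

/-- Of the two frequencies `ξ - η` and `η`, one has at least half the modulus of `ξ`. Comparing with
it costs `4^s` in the weight and halves the threshold `R`, so high output frequencies require a high
input frequency. -/
theorem tailW_le_add {s : ℝ} (hs : 0 ≤ s) (R : ℝ) (ξ η : E3) :
    tailW s R ξ ≤ 4 ^ s * (tailW s (R / 2) (ξ - η) + tailW s (R / 2) η) := by
  have key : ∀ ζ : E3, absD ξ ≤ 2 * absD ζ → tailW s R ξ ≤ 4 ^ s * tailW s (R / 2) ζ := by
    intro ζ hζ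
    by_cases hξ : R ≤ absD ξ
    · have h1 : R / 2 ≤ absD ζ := by linarith
      rw [tailW, indicator_of_mem (show ξ ∈ {ξ | R ≤ absD ξ} from hξ), tailW,
        indicator_of_mem (show ζ ∈ {ξ | R / 2 ≤ absD ξ} from h1), sobW, sobW,
        ← Real.mul_rpow (by norm_num) (by positivity)]
      refine Real.rpow_le_rpow (by positivity) ?_ hs
      nlinarith [absD_nonneg ξ, absD_nonneg ζ]
    · rw [tailW, indicator_of_notMem (show ξ ∉ {ξ | R ≤ absD ξ} from hξ)]
      have := tailW_nonneg s (R / 2) ζ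
      positivity
  have h1 := absD_le_sub_add ξ η
  have h4 : (0 : ℝ) < 4 ^ s := by positivity
  rcases le_total (absD (ξ - η)) (absD η) with h | h
  · refine (key η (by linarith)).trans ?_
    gcongr
    linarith [tailW_nonneg s (R / 2) (ξ - η)]
  · refine (key (ξ - η) (by linarith)).trans ?_
    gcongr
    linarith [tailW_nonneg s (R / 2) η]

theorem ofReal_tailW_le_add {s : ℝ} (hs : 0 ≤ s) (R : ℝ) (ξ η : E3) :
    ENNReal.ofReal (tailW s R ξ) ≤ ENNReal.ofReal (4 ^ s) *
      (ENNReal.ofReal (tailW s (R / 2) (ξ - η)) + ENNReal.ofReal (tailW s (R / 2) η)) := by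
  rw [← ENNReal.ofReal_add (tailW_nonneg _ _ _) (tailW_nonneg _ _ _),
    ← ENNReal.ofReal_mul (by positivity)]
  exact ENNReal.ofReal_le_ofReal (tailW_le_add hs R ξ η)

/-- Quadratic form `∫ w |a|²`. -/
def qf (w : E3 → ℝ) (a : E3 → ℂ) : ℝ≥0∞ := ∫⁻ ξ, ENNReal.ofReal (w ξ) * ‖a ξ‖ₑ ^ 2

theorem qf_mono {w w' : E3 → ℝ} (h : ∀ ξ, w ξ ≤ w' ξ) (a : E3 → ℂ) : qf w a ≤ qf w' a :=
  lintegral_mono fun ξ => by gcongr; exact h ξ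

/-- The `L¹` norm. -/
def oneNorm (a : E3 → ℂ) : ℝ≥0∞ := ∫⁻ ξ, ‖a ξ‖ₑ

/-- Cauchy–Schwarz against the weight `(1 + |D|²)^(-(s+1))`, integrable on ℝ³ because `2(s + 1) >
3`. This is the embedding of H^(s+1) into functions with integrable Fourier transform. -/
theorem exists_sq_oneNorm_le_qf_sobW {s : ℝ} (hs : 1 / 2 < s) :
    ∃ C : ℝ, 0 < C ∧ ∀ a : E3 → ℂ, Measurable a →
      oneNorm a ^ 2 ≤ ENNReal.ofReal C * qf (sobW (s + 1)) a := by
  have hint : Integrable (fun ξ : E3 => (1 + ‖ξ‖ ^ 2) ^ (-(2 * (s + 1)) / 2)) :=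
    integrable_rpow_neg_one_add_norm_sq (by simp; linarith)
  have hfin : ∫⁻ ξ : E3, (ENNReal.ofReal (sobW (s + 1) ξ))⁻¹ < ∞ := by
    refine lt_of_le_of_lt (lintegral_mono fun ξ => ?_) hint.lintegral_lt_top
    rw [← ENNReal.ofReal_inv_of_pos (sobW_pos _ _)]
    refine ENNReal.ofReal_le_ofReal ?_
    rw [show -(2 * (s + 1)) / 2 = -(s + 1) by ring, Real.rpow_neg (by positivity), sobW]
    have h1 : ‖ξ‖ ^ 2 ≤ absD ξ ^ 2 := by
      have : 1 ≤ 2 * Real.pi := by linarith [Real.pi_gt_three]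
      unfold absD
      gcongr
      nlinarith [norm_nonneg ξ]
    gcongr
  refine ⟨(∫⁻ ξ : E3, (ENNReal.ofReal (sobW (s + 1) ξ))⁻¹).toReal + 1, by positivity, ?_⟩
  intro a ha
  refine (sq_lintegral_le_mul_lintegral_weight (w := fun ξ => ENNReal.ofReal (sobW (s + 1) ξ))
    (by fun_prop) (by fun_prop) ?_ ?_).trans ?_
  · exact Eventually.of_forall fun ξ => by simpa using sobW_pos _ _
  · exact Eventually.of_forall fun ξ => ENNReal.ofReal_ne_top
  · unfold qf
    gcongr
    rw [ENNReal.le_ofReal_iff_toReal_le hfin.ne (by positivity)]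
    linarith

/-- In polar coordinates the integrand is at most `r^(2-p)` near 0 and `r^(-p)` at infinity, whence
`p < 3` and `p > 1`. With `p = 1 + 2δ` this is the range `0 < δ < 1`. -/
theorem integrable_inv_rpow_mul_one_add_sq {p : ℝ} (hp1 : 1 < p) (hp3 : p < 3) :
    Integrable (fun ξ : E3 => (‖ξ‖ ^ p * (1 + ‖ξ‖ ^ 2))⁻¹) := by
  rw [integrable_fun_norm_addHaar (volume : Measure E3) (f := fun r : ℝ => (r ^ p * (1 + r ^ 2))⁻¹)]
  have hfr : Module.finrank ℝ E3 - 1 = 2 := by simp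
  rw [hfr]
  rw [← Ioc_union_Ioi_eq_Ioi (zero_le_one' ℝ), integrableOn_union]
  have hmeas : Measurable fun y : ℝ => y ^ 2 • (y ^ p * (1 + y ^ 2))⁻¹ := by fun_prop
  have hpos : ∀ y : ℝ, 0 < y → 0 < y ^ p * (1 + y ^ 2) := fun y hy => by positivity
  constructor
  · have h : IntegrableOn (fun y : ℝ => y ^ (2 - p)) (Ioc 0 1) :=
      (intervalIntegrable_iff_integrableOn_Ioc_of_le zero_le_one).1
        (intervalIntegral.intervalIntegrable_rpow' (by linarith))
    refine h.mono' hmeas.aestronglyMeasurable ?_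
    refine (ae_restrict_iff' measurableSet_Ioc).2 (Eventually.of_forall fun y hy => ?_)
    rw [smul_eq_mul, Real.norm_of_nonneg (by have := hpos y hy.1; positivity),
      Real.rpow_sub hy.1, Real.rpow_ofNat, ← div_eq_mul_inv]
    have := Real.rpow_pos_of_pos hy.1 p
    exact div_le_div_of_nonneg_left (sq_nonneg y) this
      (by nlinarith [mul_nonneg this.le (sq_nonneg y)])
  · have h : IntegrableOn (fun y : ℝ => y ^ (-p)) (Ioi 1) :=
      integrableOn_Ioi_rpow_of_lt (by linarith) one_pos
    refine h.mono' hmeas.aestronglyMeasurable ?_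
    refine (ae_restrict_iff' measurableSet_Ioi).2 (Eventually.of_forall fun y hy => ?_)
    have hy0 : (0 : ℝ) < y := zero_lt_one.trans hy
    rw [smul_eq_mul, Real.norm_of_nonneg (by have := hpos y hy0; positivity),
      Real.rpow_neg hy0.le, mul_inv, ← mul_assoc, mul_comm (y ^ 2), mul_assoc]
    have h0 := Real.rpow_pos_of_pos hy0 p
    refine mul_le_of_le_one_right (by positivity) ?_
    rw [← div_eq_mul_inv, div_le_one (by positivity)]
    linarith

/-- A scale-invariant bound of the `L¹` norm by two quadratic forms. -/
theorem exists_sq_oneNorm_le_scale {δ : ℝ} (hδ0 : 0 < δ) (hδ1 : δ < 1) :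
    ∃ C : ℝ, 0 < C ∧ ∀ R : ℝ, 0 < R → ∀ a : E3 → ℂ, Measurable a →
      oneNorm a ^ 2 ≤ ENNReal.ofReal C *
        qf (fun ξ => R ^ (-(2 * δ)) * (absD ξ ^ (1 + 2 * δ) * (R ^ 2 + absD ξ ^ 2))) a := by
  set g : ℝ → E3 → ℝ := fun R ξ =>
    R ^ (-(2 * δ)) * (absD ξ ^ (1 + 2 * δ) * (R ^ 2 + absD ξ ^ 2)) with hg
  set κ : ℝ := ∫ ζ : E3, (‖ζ‖ ^ (1 + 2 * δ) * (1 + ‖ζ‖ ^ 2))⁻¹ with hκ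
  have hint := integrable_inv_rpow_mul_one_add_sq (p := 1 + 2 * δ) (by linarith) (by linarith)
  have hκ0 : 0 ≤ κ := integral_nonneg fun ζ => by positivity
  have hgpos : ∀ R, 0 < R → ∀ ξ, ξ ≠ 0 → 0 < g R ξ := by
    intro R hR ξ hξ
    have := absD_pos hξ
    rw [hg]; positivity
  -- Substituting `|D| = R|ζ|` pulls out exactly `R³`, which the Jacobian cancels. This is why the
  -- factor `R^(-2δ)` is in the weight and why the constant does not depend on `R`.
  have hscale : ∀ R : ℝ, 0 < R → ∀ ξ : E3, (g R ξ)⁻¹ =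
      (R ^ 3)⁻¹ * ((fun ζ : E3 => (‖ζ‖ ^ (1 + 2 * δ) * (1 + ‖ζ‖ ^ 2))⁻¹) ((2 * Real.pi / R) • ξ)) := by
    intro R hR ξ
    have h1 : ‖(2 * Real.pi / R) • ξ‖ = absD ξ / R := by
      rw [norm_smul, Real.norm_of_nonneg (by positivity), absD]; ring
    simp only [h1]
    rw [← mul_inv, hg]
    simp only
    congr 1
    rw [Real.div_rpow (absD_nonneg _) hR.le, Real.rpow_neg hR.le, Real.rpow_add hR,
      Real.rpow_one]
    have := Real.rpow_pos_of_pos hR (2 * δ)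
    field_simp
  refine ⟨κ + 1, by positivity, fun R hR a ha => ?_⟩
  have hgm : Measurable (g R) := by rw [hg]; fun_prop
  have hinv : ∫⁻ ξ, (ENNReal.ofReal (g R ξ))⁻¹ ≤ ENNReal.ofReal (κ + 1) := by
    have h1 : ∫⁻ ξ, (ENNReal.ofReal (g R ξ))⁻¹ = ∫⁻ ξ, ENNReal.ofReal ((g R ξ)⁻¹) := by
      refine lintegral_congr_ae ?_
      filter_upwards [compl_mem_ae_iff.2 (measure_singleton (0 : E3))] with ξ hξ
      rw [ENNReal.ofReal_inv_of_pos (hgpos R hR ξ hξ)]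
    rw [h1]
    have hc : (2 * Real.pi / R) ≠ 0 := by positivity
    have h2 : Integrable (fun ξ => (g R ξ)⁻¹) := by
      simp_rw [hscale R hR]
      exact (hint.comp_smul hc).const_mul _
    rw [← ofReal_integral_eq_lintegral_ofReal h2 (Eventually.of_forall fun ξ => by
      rw [hg]; have := absD_nonneg ξ; positivity)]
    refine ENNReal.ofReal_le_ofReal ?_
    simp_rw [hscale R hR]
    rw [integral_const_mul, Measure.integral_comp_smul volume
      (fun ζ : E3 => (‖ζ‖ ^ (1 + 2 * δ) * (1 + ‖ζ‖ ^ 2))⁻¹), ← hκ]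
    have hfr : Module.finrank ℝ E3 = 3 := by simp
    rw [hfr, smul_eq_mul, abs_of_nonneg (by positivity)]
    have hp : (1 : ℝ) ≤ (2 * Real.pi) ^ 3 := one_le_pow₀ (by linarith [Real.pi_gt_three])
    calc (R ^ 3)⁻¹ * (((2 * Real.pi / R) ^ 3)⁻¹ * κ) = ((2 * Real.pi) ^ 3)⁻¹ * κ := by
          field_simp
      _ ≤ 1 * κ := by gcongr; exact inv_le_one_of_one_le₀ hp
      _ ≤ κ + 1 := by linarith
  refine (sq_lintegral_le_mul_lintegral_weight (w := fun ξ => ENNReal.ofReal (g R ξ))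
    (by fun_prop) (by fun_prop) ?_ ?_).trans ?_
  · filter_upwards [compl_mem_ae_iff.2 (measure_singleton (0 : E3))] with ξ hξ
    simpa using hgpos R hR ξ hξ
  · exact Eventually.of_forall fun ξ => ENNReal.ofReal_ne_top
  · unfold qf
    gcongr

end QuasiGeo
end

noncomputable section

namespace QuasiGeo

/-! ### Multiplication operators and energies -/

/-- Scalar square-integrable functions of the frequency. -/
abbrev H := Lp (α := E3) ℂ 2 volume

theorem measurable_coe (a : H) : Measurable a := (Lp.stronglyMeasurable a).measurable

/-- Bounded measurable real symbols. -/
def BSym (m : E3 → ℝ) : Prop := Measurable m ∧ ∃ C, ∀ ξ, |m ξ| ≤ C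

theorem BSym.memLp_mul {m : E3 → ℝ} (hm : BSym m) (a : H) :
    MemLp (fun ξ => (m ξ : ℂ) * a ξ) 2 volume := by
  obtain ⟨hmeas, C, hC⟩ := hm
  refine (Lp.memLp a).of_le_mul (c := C) ?_ ?_
  · exact ((Complex.measurable_ofReal.comp hmeas).mul (measurable_coe a)).aestronglyMeasurable
  · refine Eventually.of_forall fun ξ => ?_
    rw [norm_mul, Complex.norm_real]
    gcongr
    exact hC ξ

/-- Multiplication by a bounded symbol. -/
def mulOp (m : E3 → ℝ) (hm : BSym m) : H →L[ℝ] H :=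
  LinearMap.mkContinuous
    { toFun := fun a => (hm.memLp_mul a).toLp _
      map_add' := by
        intro a b
        ext1
        filter_upwards [(hm.memLp_mul (a + b)).coeFn_toLp, (hm.memLp_mul a).coeFn_toLp,
          (hm.memLp_mul b).coeFn_toLp, Lp.coeFn_add a b,
          Lp.coeFn_add ((hm.memLp_mul a).toLp _) ((hm.memLp_mul b).toLp _)] with ξ h1 h2 h3 h4 h5
        rw [h1, h5, Pi.add_apply, h2, h3, h4, Pi.add_apply, mul_add]
      map_smul' := by
        intro c a
        ext1
        filter_upwards [(hm.memLp_mul (c • a)).coeFn_toLp, (hm.memLp_mul a).coeFn_toLp,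
          Lp.coeFn_smul c a, Lp.coeFn_smul c ((hm.memLp_mul a).toLp _)] with ξ h1 h2 h3 h4
        rw [h1, RingHom.id_apply, h4, Pi.smul_apply, h2, h3, Pi.smul_apply, mul_smul_comm] }
    (max hm.2.choose 0) (by
      intro a
      have hC := hm.2.choose_spec
      refine Lp.norm_le_mul_norm_of_ae_le_mul ?_
      simp only [LinearMap.coe_mk, AddHom.coe_mk]
      filter_upwards [(hm.memLp_mul a).coeFn_toLp] with ξ h1
      rw [h1, norm_mul, Complex.norm_real]
      gcongr
      exact (hC ξ).trans (le_max_left _ _))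

theorem mulOp_coe (m : E3 → ℝ) (hm : BSym m) (a : H) :
    mulOp m hm a =ᵐ[volume] fun ξ => (m ξ : ℂ) * a ξ := (hm.memLp_mul a).coeFn_toLp

theorem inner_eq_integral_re (a b : H) :
    inner ℝ a b = ∫ ξ, ((starRingEnd ℂ) (a ξ) * b ξ).re := by
  rw [L2.inner_def]
  refine integral_congr_ae (Eventually.of_forall fun ξ => ?_)
  simp only [Complex.inner, mul_comm]

theorem integrable_re_conj_mul (a b : H) :
    Integrable fun ξ => ((starRingEnd ℂ) (a ξ) * b ξ).re := by
  have := L2.integrable_inner (𝕜 := ℝ) a b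
  simpa only [Complex.inner, mul_comm] using this

theorem inner_mulOp_eq (m : E3 → ℝ) (hm : BSym m) (a b : H) :
    inner ℝ (mulOp m hm a) b = ∫ ξ, m ξ * ((starRingEnd ℂ) (a ξ) * b ξ).re := by
  rw [inner_eq_integral_re]
  refine integral_congr_ae ?_
  filter_upwards [mulOp_coe m hm a] with ξ hξ
  rw [hξ, map_mul, Complex.conj_ofReal, mul_assoc, Complex.re_ofReal_mul]

theorem integrable_mul_re_conj_mul {m : E3 → ℝ} (hm : BSym m) (a b : H) :
    Integrable fun ξ => m ξ * ((starRingEnd ℂ) (a ξ) * b ξ).re := by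
  refine (integrable_re_conj_mul (mulOp m hm a) b).congr ?_
  filter_upwards [mulOp_coe m hm a] with ξ hξ
  rw [hξ, map_mul, Complex.conj_ofReal, mul_assoc, Complex.re_ofReal_mul]

theorem inner_mulOp_left (m : E3 → ℝ) (hm : BSym m) (a b : H) :
    inner ℝ (mulOp m hm a) b = inner ℝ a (mulOp m hm b) := by
  rw [real_inner_comm _ a, inner_mulOp_eq, inner_mulOp_eq]
  refine integral_congr_ae (Eventually.of_forall fun ξ => ?_)
  simp only [Complex.mul_re, Complex.conj_re, Complex.conj_im]
  ring

/-- The real value of the quadratic form `∫ w |a|²`. -/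
def rq (w : E3 → ℝ) (a : E3 → ℂ) : ℝ := (qf w a).toReal

theorem rq_nonneg (w : E3 → ℝ) (a : E3 → ℂ) : 0 ≤ rq w a := ENNReal.toReal_nonneg

theorem qf_const (c : ℝ) (hc : 0 ≤ c) (a : H) :
    qf (fun _ => c) a = ENNReal.ofReal (c * ‖a‖ ^ 2) := by
  have h : ‖a‖ₑ ^ 2 = ∫⁻ ξ, ‖a ξ‖ₑ ^ 2 := by
    rw [Lp.enorm_def, eLpNorm_eq_lintegral_rpow_enorm_toReal (by norm_num) (by norm_num),
      ← ENNReal.rpow_natCast, ← ENNReal.rpow_mul]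
    norm_num
  unfold qf
  rw [lintegral_const_mul _ (by have := measurable_coe a; fun_prop), ← h, ENNReal.ofReal_mul hc,
    ENNReal.ofReal_pow (norm_nonneg _), ofReal_norm]

theorem qf_one (a : H) : qf (fun _ => 1) a = ENNReal.ofReal (‖a‖ ^ 2) := by
  rw [qf_const 1 zero_le_one, one_mul]

theorem qf_lt_top {w : E3 → ℝ} (hw : BSym w) (a : H) : qf w a < ∞ := by
  obtain ⟨C, hC⟩ := hw.2
  have h1 : ∀ ξ, w ξ ≤ max C 0 := fun ξ => (le_abs_self _).trans ((hC ξ).trans (le_max_left _ _))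
  refine (qf_mono h1 a).trans_lt ?_
  rw [qf_const _ (le_max_right _ _)]
  exact ENNReal.ofReal_lt_top

theorem ofReal_rq {w : E3 → ℝ} (hw : BSym w) (a : H) : ENNReal.ofReal (rq w a) = qf w a :=
  ENNReal.ofReal_toReal (qf_lt_top hw a).ne

theorem rq_one (a : H) : rq (fun _ => 1) a = ‖a‖ ^ 2 := by
  rw [rq, qf_one, ENNReal.toReal_ofReal (by positivity)]

theorem rq_eq_integral {w : E3 → ℝ} (hwm : Measurable w) (hw0 : ∀ ξ, 0 ≤ w ξ) (a : H) :
    rq w a = ∫ ξ, w ξ * ‖a ξ‖ ^ 2 := by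
  have := measurable_coe a
  rw [integral_eq_lintegral_of_nonneg_ae
    (Eventually.of_forall fun ξ => by have := hw0 ξ; positivity)
    (by fun_prop)]
  rw [rq, qf]
  congr 1
  refine lintegral_congr fun ξ => ?_
  rw [ENNReal.ofReal_mul (hw0 ξ), ENNReal.ofReal_pow (norm_nonneg _), ofReal_norm]

theorem integrable_mul_norm_sq {w : E3 → ℝ} (hw : BSym w) (a : H) :
    Integrable fun ξ => w ξ * ‖a ξ‖ ^ 2 := by
  refine (integrable_mul_re_conj_mul hw a a).congr (Eventually.of_forall fun ξ => ?_)
  simp only [Complex.conj_mul', ← Complex.ofReal_pow, Complex.ofReal_re]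

theorem rq_eq_inner {w : E3 → ℝ} (hw : BSym w) (hw0 : ∀ ξ, 0 ≤ w ξ) (a : H) :
    rq w a = inner ℝ (mulOp w hw a) a := by
  rw [rq_eq_integral hw.1 hw0, inner_mulOp_eq]
  refine integral_congr_ae (Eventually.of_forall fun ξ => ?_)
  simp only [Complex.conj_mul', ← Complex.ofReal_pow, Complex.ofReal_re]

/-- The weight is bounded, so the form is a continuous quadratic form; symmetry of `mulOp` merges
the two terms of the product rule. -/
theorem hasDerivWithinAt_rq {w : E3 → ℝ} (hw : BSym w) (hw0 : ∀ ξ, 0 ≤ w ξ) {c : ℝ → H} {c' : H}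
    {S : Set ℝ} {t : ℝ} (hc : HasDerivWithinAt c c' S t) :
    HasDerivWithinAt (fun t => rq w (c t)) (2 * inner ℝ (mulOp w hw (c t)) c') S t := by
  simp_rw [rq_eq_inner hw hw0]
  have h1 := ((mulOp w hw).hasFDerivAt.comp_hasDerivWithinAt t hc).inner ℝ hc
  refine h1.congr_deriv ?_
  rw [two_mul]
  congr 1
  rw [inner_mulOp_left, real_inner_comm]

theorem continuousOn_rq {w : E3 → ℝ} (hw : BSym w) (hw0 : ∀ ξ, 0 ≤ w ξ) {c : ℝ → H}
    {S : Set ℝ} (hc : ContinuousOn c S) : ContinuousOn (fun t => rq w (c t)) S := by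
  simp_rw [rq_eq_inner hw hw0]
  exact ((mulOp w hw).continuous.comp_continuousOn hc).inner hc

theorem continuous_rq {w : E3 → ℝ} (hw : BSym w) (hw0 : ∀ ξ, 0 ≤ w ξ) :
    Continuous fun a : H => rq w a := by
  simp_rw [rq_eq_inner hw hw0]
  exact (mulOp w hw).continuous.inner continuous_id

/-- The basic energy inequality: a forcing bounded by `|D| f` is absorbed by the diffusion. -/
theorem two_mul_inner_mulOp_le {w g : E3 → ℝ} {ν₀ Φ : ℝ} (hν₀ : 0 < ν₀) (hw : BSym w)
    (hw0 : ∀ ξ, 0 ≤ w ξ) (hwD : BSym fun ξ => w ξ * absD ξ ^ 2)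
    (hg : ∀ ξ, g ξ ≤ -(ν₀ * absD ξ ^ 2)) {a v : H} {G : E3 → ℂ} {f : E3 → ℝ≥0∞}
    (hf : Measurable f) (hv : ∀ᵐ ξ, w ξ ≠ 0 → v ξ = g ξ * a ξ + G ξ)
    (hG : ∀ᵐ ξ, w ξ ≠ 0 → ‖G ξ‖ₑ ≤ ENNReal.ofReal (absD ξ) * f ξ) (hΦ : 0 ≤ Φ)
    (hfΦ : ∫⁻ ξ, ENNReal.ofReal (w ξ) * f ξ ^ 2 ≤ ENNReal.ofReal Φ) :
    2 * inner ℝ (mulOp w hw a) v ≤ -(ν₀ * rq (fun ξ => w ξ * absD ξ ^ 2) a) + Φ / ν₀ := by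
  have hwm := hw.1
  have hfin : ∀ᵐ ξ, ENNReal.ofReal (w ξ) * f ξ ^ 2 < ∞ :=
    ae_lt_top (by fun_prop) (ne_top_of_le_ne_top ENNReal.ofReal_ne_top hfΦ)
  have hh : ∀ ξ, ENNReal.ofReal (w ξ * (f ξ).toReal ^ 2) ≤ ENNReal.ofReal (w ξ) * f ξ ^ 2 := by
    intro ξ
    rw [ENNReal.ofReal_mul (hw0 ξ), ENNReal.ofReal_pow ENNReal.toReal_nonneg]
    gcongr
    exact ENNReal.ofReal_toReal_le
  have hh0 : ∀ ξ, 0 ≤ w ξ * (f ξ).toReal ^ 2 := fun ξ => by have := hw0 ξ; positivity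
  have hint : Integrable fun ξ => w ξ * (f ξ).toReal ^ 2 := by
    refine ⟨by fun_prop, ?_⟩
    rw [hasFiniteIntegral_iff_ofReal (Eventually.of_forall hh0)]
    exact ((lintegral_mono hh).trans hfΦ).trans_lt ENNReal.ofReal_lt_top
  have hintle : ∫ ξ, w ξ * (f ξ).toReal ^ 2 ≤ Φ := by
    rw [integral_eq_lintegral_of_nonneg_ae (Eventually.of_forall hh0) (by fun_prop)]
    exact ENNReal.toReal_le_of_le_ofReal hΦ ((lintegral_mono hh).trans hfΦ)
  have hwD0 : ∀ ξ, 0 ≤ w ξ * absD ξ ^ 2 := fun ξ => by have := hw0 ξ; positivity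
  have hI1 := (integrable_mul_norm_sq hwD a).const_mul ν₀
  have hI2 := hint.div_const ν₀
  calc 2 * inner ℝ (mulOp w hw a) v
      = ∫ ξ, 2 * (w ξ * ((starRingEnd ℂ) (a ξ) * v ξ).re) := by
        rw [inner_mulOp_eq, integral_const_mul]
    _ ≤ ∫ ξ, (-(ν₀ * (w ξ * absD ξ ^ 2 * ‖a ξ‖ ^ 2)) + w ξ * (f ξ).toReal ^ 2 / ν₀) := by
        refine integral_mono_ae ((integrable_mul_re_conj_mul hw a v).const_mul 2)
          (hI1.neg.add hI2) ?_
        filter_upwards [hv, hG, hfin] with ξ hv hG hfin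
        by_cases hw1 : w ξ = 0
        · simp [hw1]
        have hwpos : 0 < w ξ := lt_of_le_of_ne (hw0 ξ) (Ne.symm hw1)
        specialize hv hw1
        specialize hG hw1
        have hfne : f ξ ≠ ∞ := by
          intro h
          rw [h] at hfin
          simp [hwpos] at hfin
        have hGn : ‖G ξ‖ ≤ absD ξ * (f ξ).toReal := by
          have h1 := ENNReal.toReal_mono (ENNReal.mul_ne_top ENNReal.ofReal_ne_top hfne) hG
          rwa [toReal_enorm, ENNReal.toReal_mul, ENNReal.toReal_ofReal (absD_nonneg ξ)] at h1
        have hre : ((starRingEnd ℂ) (a ξ) * v ξ).re ≤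
            -(ν₀ * absD ξ ^ 2) * ‖a ξ‖ ^ 2 + ‖a ξ‖ * (absD ξ * (f ξ).toReal) := by
          have e1 : (starRingEnd ℂ) (a ξ) * v ξ =
              ((g ξ * ‖a ξ‖ ^ 2 : ℝ) : ℂ) + (starRingEnd ℂ) (a ξ) * G ξ := by
            rw [hv, mul_add]
            congr 1
            rw [mul_left_comm, Complex.conj_mul']
            push_cast; ring
          rw [e1, Complex.add_re, Complex.ofReal_re]
          refine add_le_add (mul_le_mul_of_nonneg_right (hg ξ) (by positivity)) ?_
          refine (Complex.re_le_norm _).trans ?_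
          rw [norm_mul, RCLike.norm_conj]
          gcongr
        set x := absD ξ * ‖a ξ‖
        set h := (f ξ).toReal
        -- Young's inequality spends half of the available dissipation `2 ν₀ x²` on the forcing; the
        -- other half survives in the conclusion.
        have hy : 2 * (x * h) ≤ ν₀ * x ^ 2 + h ^ 2 / ν₀ := by
          have h3 : 0 ≤ (ν₀ * x - h) ^ 2 / ν₀ := by positivity
          have h4 : (ν₀ * x - h) ^ 2 / ν₀ = ν₀ * x ^ 2 + h ^ 2 / ν₀ - 2 * (x * h) := by
            field_simp; ring
          linarith
        have h5 : 2 * ((starRingEnd ℂ) (a ξ) * v ξ).re ≤ -(ν₀ * x ^ 2) + h ^ 2 / ν₀ := by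
          have : -(ν₀ * absD ξ ^ 2) * ‖a ξ‖ ^ 2 + ‖a ξ‖ * (absD ξ * h) = -(ν₀ * x ^ 2) + x * h := by
            simp only [x]; ring
          linarith
        calc 2 * (w ξ * ((starRingEnd ℂ) (a ξ) * v ξ).re)
            = w ξ * (2 * ((starRingEnd ℂ) (a ξ) * v ξ).re) := by ring
          _ ≤ w ξ * (-(ν₀ * x ^ 2) + h ^ 2 / ν₀) := by gcongr
          _ = _ := by simp only [x]; ring
    _ = -(ν₀ * rq (fun ξ => w ξ * absD ξ ^ 2) a) + (∫ ξ, w ξ * (f ξ).toReal ^ 2) / ν₀ := by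
        rw [integral_add (f := fun ξ => -(ν₀ * (w ξ * absD ξ ^ 2 * ‖a ξ‖ ^ 2))) hI1.neg hI2,
          integral_neg, integral_const_mul, integral_div,
          rq_eq_integral hwD.1 hwD0]
    _ ≤ _ := by gcongr

/-! ### Frequency cutoffs -/

/-- Restriction of a symbol to the frequencies `|D| < N`. -/
def cut (N : ℝ) (m : E3 → ℝ) : E3 → ℝ := {ξ | absD ξ < N}.indicator m

theorem measurableSet_absD_lt (N : ℝ) : MeasurableSet {ξ : E3 | absD ξ < N} :=
  measurableSet_lt measurable_absD measurable_const

theorem bsym_cut {N C : ℝ} {m : E3 → ℝ} (hm : Measurable m)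
    (h : ∀ ξ, absD ξ < N → |m ξ| ≤ C) : BSym (cut N m) := by
  refine ⟨hm.indicator (measurableSet_absD_lt N), max C 0, fun ξ => ?_⟩
  by_cases hξ : absD ξ < N
  · rw [cut, indicator_of_mem (show ξ ∈ {ξ | absD ξ < N} from hξ)]
    exact (h ξ hξ).trans (le_max_left _ _)
  · rw [cut, indicator_of_notMem (show ξ ∉ {ξ | absD ξ < N} from hξ)]
    simp

theorem cut_of_lt {N : ℝ} {m : E3 → ℝ} {ξ : E3} (h : absD ξ < N) : cut N m ξ = m ξ :=
  indicator_of_mem (s := {ξ | absD ξ < N}) h m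

theorem cut_of_not_lt {N : ℝ} {m : E3 → ℝ} {ξ : E3} (h : ¬ absD ξ < N) : cut N m ξ = 0 :=
  indicator_of_notMem (s := {ξ | absD ξ < N}) h m

theorem cut_nonneg {N : ℝ} {m : E3 → ℝ} (h : ∀ ξ, 0 ≤ m ξ) (ξ : E3) : 0 ≤ cut N m ξ :=
  indicator_nonneg (fun ξ _ => h ξ) ξ

theorem cut_le {N : ℝ} {m : E3 → ℝ} (h : ∀ ξ, 0 ≤ m ξ) (ξ : E3) : cut N m ξ ≤ m ξ :=
  indicator_le_self' (fun ξ _ => h ξ) ξ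

theorem bsym_cut_one (N : ℝ) : BSym (cut N fun _ => 1) :=
  bsym_cut (C := 1) measurable_const (by simp)

/-- The projection on the frequencies `|D| < N`. -/
def proj (N : ℝ) : H →L[ℝ] H := mulOp _ (bsym_cut_one N)

theorem proj_coe (N : ℝ) (a : H) :
    proj N a =ᵐ[volume] fun ξ => if absD ξ < N then a ξ else 0 := by
  filter_upwards [mulOp_coe _ (bsym_cut_one N) a] with ξ hξ
  rw [proj, hξ]
  split_ifs with h
  · rw [cut_of_lt h]; simp
  · rw [cut_of_not_lt h]; simp

/-- On band-limited functions an unbounded weight may be replaced by its bounded truncation, so the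
calculus for `BSym` weights applies to Sobolev norms of truncated solutions. -/
theorem qf_cut_eq {N : ℝ} {m : E3 → ℝ} {a : H} (ha : proj N a = a) : qf (cut N m) a = qf m a := by
  have h := proj_coe N a
  rw [ha] at h
  refine lintegral_congr_ae ?_
  filter_upwards [h] with ξ hξ
  by_cases hN : absD ξ < N
  · rw [cut_of_lt hN]
  · rw [hξ, if_neg hN]; simp

theorem rq_cut_eq {N : ℝ} {m : E3 → ℝ} {a : H} (ha : proj N a = a) : rq (cut N m) a = rq m a := by
  rw [rq, rq, qf_cut_eq ha]

theorem qf_proj_le (N : ℝ) (m : E3 → ℝ) (a : H) : qf m (proj N a) ≤ qf m a := by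
  refine lintegral_mono_ae ?_
  filter_upwards [proj_coe N a] with ξ hξ
  rw [hξ]
  split_ifs <;> simp

theorem proj_proj {N M : ℝ} (h : N ≤ M) (a : H) : proj M (proj N a) = proj N a := by
  ext1
  filter_upwards [proj_coe M (proj N a), proj_coe N a] with ξ h1 h2
  rw [h1, h2]
  split_ifs with h3 h4 h5
  · rfl
  · rfl
  · exact absurd (h5.trans_le h) h3
  · rfl

theorem tendsto_proj (a : H) : Tendsto (fun N : ℕ => proj N a) atTop (𝓝 a) := by
  have hm := measurable_coe a
  rw [tendsto_iff_norm_sub_tendsto_zero]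
  have hsq : ∀ N : ℕ, ENNReal.ofReal (‖proj N a - a‖ ^ 2) =
      ∫⁻ ξ, ({ξ : E3 | (N : ℝ) ≤ absD ξ}.indicator (fun ξ => ‖a ξ‖ₑ ^ 2) ξ) := by
    intro N
    rw [← qf_one]
    refine lintegral_congr_ae ?_
    filter_upwards [proj_coe N a, Lp.coeFn_sub (proj N a) a] with ξ h1 h2
    rw [h2, Pi.sub_apply, h1]
    by_cases h : absD ξ < N
    · rw [if_pos h, indicator_of_notMem (by simpa using h)]; simp
    · rw [if_neg h, indicator_of_mem (by simpa using h)]; simp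
  have hlim : Tendsto (fun N : ℕ => ∫⁻ ξ,
      ({ξ : E3 | (N : ℝ) ≤ absD ξ}.indicator (fun ξ => ‖a ξ‖ₑ ^ 2) ξ)) atTop
      (𝓝 (∫⁻ _ : E3, 0)) := by
    refine tendsto_lintegral_of_dominated_convergence (fun ξ => ‖a ξ‖ₑ ^ 2) ?_ ?_ ?_ ?_
    · intro N
      exact Measurable.indicator (by fun_prop) (measurableSet_le_absD _)
    · intro N
      exact Eventually.of_forall fun ξ => indicator_le_self' (fun _ _ => zero_le) ξ
    · have := qf_one a
      simp only [qf, ENNReal.ofReal_one, one_mul] at this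
      rw [this]; exact ENNReal.ofReal_ne_top
    · refine Eventually.of_forall fun ξ => ?_
      refine tendsto_const_nhds.congr' ?_
      obtain ⟨n, hn⟩ := exists_nat_gt (absD ξ)
      filter_upwards [eventually_ge_atTop n] with N hN
      rw [indicator_of_notMem]
      simp only [mem_ofPred_eq, not_le]
      exact hn.trans_le (by exact_mod_cast hN)
  rw [lintegral_zero] at hlim
  have h3 : Tendsto (fun N : ℕ => ‖proj N a - a‖ ^ 2) atTop (𝓝 0) := by
    have := (ENNReal.tendsto_toReal ENNReal.zero_ne_top).comp hlim
    refine this.congr fun N => ?_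
    rw [Function.comp_apply, ← hsq, ENNReal.toReal_ofReal (by positivity)]
  have h4 := h3.sqrt
  simpa using h4

end QuasiGeo
end

noncomputable section

namespace QuasiGeo

/-! ### The quadratic nonlinearity on the Fourier side -/

/-- The direction `(-ξ₂, ξ₁, 0, -F ξ₃)` of the quasi-geostrophic fields at frequency `ξ`. -/
def rho (F : ℝ) (ξ : E3) : R4 := WithLp.toLp 2 ![-ξ 1, ξ 0, 0, -(F * ξ 2)]

/-- The horizontal cross product. -/
def cross (p q : E3) : ℝ := p 0 * q 1 - p 1 * q 0

@[fun_prop]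
theorem continuous_rho (F : ℝ) : Continuous (rho F) := by
  unfold rho
  refine (PiLp.continuous_toLp 2 _).comp (continuous_pi fun i => ?_)
  fin_cases i <;> simp <;> fun_prop

theorem rho_add (F : ℝ) (p q : E3) : rho F (p + q) = rho F p + rho F q := by
  ext i; fin_cases i <;> simp [rho] <;> ring

theorem rho_neg (F : ℝ) (p : E3) : rho F (-p) = -rho F p := by
  ext i; fin_cases i <;> simp [rho]

theorem norm_sq_rho (F : ℝ) (ξ : E3) : ‖rho F ξ‖ ^ 2 = ξ 0 ^ 2 + ξ 1 ^ 2 + F ^ 2 * ξ 2 ^ 2 := by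
  rw [EuclideanSpace.real_norm_sq_eq, Fin.sum_univ_four]
  simp [rho]; ring

theorem norm_sq_E3 (ξ : E3) : ‖ξ‖ ^ 2 = ξ 0 ^ 2 + ξ 1 ^ 2 + ξ 2 ^ 2 := by
  rw [EuclideanSpace.real_norm_sq_eq, Fin.sum_univ_three]

theorem rho_eq_zero_iff {F : ℝ} (hF : 0 < F) {ξ : E3} : rho F ξ = 0 ↔ ξ = 0 := by
  rw [← norm_eq_zero, ← sq_eq_zero_iff, norm_sq_rho]
  constructor
  · intro h
    rw [← norm_eq_zero, ← sq_eq_zero_iff, norm_sq_E3]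
    have h2 : F ^ 2 * ξ 2 ^ 2 = 0 := by nlinarith [sq_nonneg (ξ 0), sq_nonneg (ξ 1), sq_nonneg (F * ξ 2)]
    have h3 : ξ 2 ^ 2 = 0 := by
      rcases mul_eq_zero.1 h2 with h | h
      · exact absurd h (by positivity)
      · exact h
    nlinarith
  · rintro rfl; simp

/-- Only horizontal components enter `cross`, and these are common to `p` and `rho F p`. Hence
Lagrange's identity in the plane gives the bound with constant 1, whatever `F` is. -/
theorem abs_cross_le_rho_mul_norm (F : ℝ) (p q : E3) : |cross p q| ≤ ‖rho F p‖ * ‖q‖ := by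
  rw [← abs_of_nonneg (mul_nonneg (norm_nonneg (rho F p)) (norm_nonneg q)), ← sq_le_sq, mul_pow,
    norm_sq_rho, norm_sq_E3, cross]
  have h1 : 0 ≤ F ^ 2 * p 2 ^ 2 := by positivity
  nlinarith [sq_nonneg (p 0 * q 0 + p 1 * q 1), mul_nonneg (sq_nonneg (p 0)) (sq_nonneg (q 2)),
    mul_nonneg (sq_nonneg (p 1)) (sq_nonneg (q 2)), mul_nonneg h1 (sq_nonneg (q 0)),
    mul_nonneg h1 (sq_nonneg (q 1)), mul_nonneg h1 (sq_nonneg (q 2))]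

theorem abs_cross_le_rho_mul_rho (F : ℝ) (p q : E3) : |cross p q| ≤ ‖rho F p‖ * ‖rho F q‖ := by
  rw [← abs_of_nonneg (mul_nonneg (norm_nonneg (rho F p)) (norm_nonneg (rho F q))), ← sq_le_sq,
    mul_pow, norm_sq_rho, norm_sq_rho, cross]
  have h1 : 0 ≤ F ^ 2 * p 2 ^ 2 := by positivity
  have h2 : 0 ≤ F ^ 2 * q 2 ^ 2 := by positivity
  nlinarith [sq_nonneg (p 0 * q 0 + p 1 * q 1), mul_nonneg (sq_nonneg (p 0)) h2,
    mul_nonneg (sq_nonneg (p 1)) h2, mul_nonneg h1 (sq_nonneg (q 0)),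
    mul_nonneg h1 (sq_nonneg (q 1)), mul_nonneg h1 h2]

/-- The kernel of the nonlinearity. -/
def kern (F : ℝ) (ξ η : E3) : ℝ :=
  -(2 * Real.pi) * (cross (ξ - η) ξ / ‖rho F (ξ - η)‖) *
    (inner ℝ (rho F η) (rho F ξ) / (‖rho F η‖ * ‖rho F ξ‖))

/-- The transport term is in divergence form, so its single derivative falls on the output frequency
and none on the factors; the rest of the kernel comes from unit polarization vectors. -/
theorem abs_kern_le (F : ℝ) (ξ η : E3) : |kern F ξ η| ≤ absD ξ := by
  have h1 : |cross (ξ - η) ξ / ‖rho F (ξ - η)‖| ≤ ‖ξ‖ := by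
    rw [abs_div, abs_norm]
    refine div_le_of_le_mul₀ (norm_nonneg _) (norm_nonneg _) ?_
    rw [mul_comm]
    exact abs_cross_le_rho_mul_norm F _ _
  have h2 : |inner ℝ (rho F η) (rho F ξ) / (‖rho F η‖ * ‖rho F ξ‖)| ≤ 1 :=
    abs_real_inner_div_norm_mul_norm_le_one _ _
  rw [kern, abs_mul, abs_mul, abs_neg, abs_of_nonneg (by positivity : (0 : ℝ) ≤ 2 * Real.pi), absD]
  calc 2 * Real.pi * |cross (ξ - η) ξ / ‖rho F (ξ - η)‖| *
      |inner ℝ (rho F η) (rho F ξ) / (‖rho F η‖ * ‖rho F ξ‖)|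
      ≤ 2 * Real.pi * ‖ξ‖ * 1 := by gcongr
    _ = _ := mul_one _

/-- The reality condition: with this evenness, `B(a, a)` is Hermitian whenever `a` is. -/
theorem kern_neg_neg (F : ℝ) (ξ η : E3) : kern F (-ξ) (-η) = kern F ξ η := by
  have h : -ξ - -η = -(ξ - η) := by abel
  simp only [kern, h, rho_neg, norm_neg, inner_neg_neg, cross, PiLp.neg_apply]
  ring

theorem continuous_cross : Continuous fun z : E3 × E3 => cross z.1 z.2 := by
  unfold cross; fun_prop

@[fun_prop]
theorem measurable_cross {α : Type*} [MeasurableSpace α] {f g : α → E3} (hf : Measurable f)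
    (hg : Measurable g) : Measurable fun x => cross (f x) (g x) :=
  continuous_cross.measurable.comp (hf.prodMk hg)

@[fun_prop]
theorem measurable_rho (F : ℝ) : Measurable (rho F) := (continuous_rho F).measurable

@[fun_prop]
theorem measurable_kern {α : Type*} [MeasurableSpace α] (F : ℝ) {f g : α → E3} (hf : Measurable f)
    (hg : Measurable g) : Measurable fun x => kern F (f x) (g x) := by
  unfold kern
  fun_prop

/-- The bilinear form `∫ k(ξ, η) a(ξ - η) b(η) dη`. -/
def bil (F : ℝ) (a b : E3 → ℂ) (ξ : E3) : ℂ := ∫ η, (kern F ξ η : ℂ) * (a (ξ - η) * b η)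

theorem enorm_kern_mul_le (F : ℝ) (a b : E3 → ℂ) (ξ η : E3) :
    ‖(kern F ξ η : ℂ) * (a (ξ - η) * b η)‖ₑ ≤
      ENNReal.ofReal (absD ξ) * (‖a (ξ - η)‖ₑ * ‖b η‖ₑ) := by
  rw [enorm_mul, enorm_mul]
  gcongr
  rw [← ofReal_norm, Complex.norm_real]
  exact ENNReal.ofReal_le_ofReal (abs_kern_le F ξ η)

theorem enorm_bil_le (F : ℝ) {a b : E3 → ℂ} (ha : Measurable a) (hb : Measurable b) (ξ : E3) :
    ‖bil F a b ξ‖ₑ ≤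
      ENNReal.ofReal (absD ξ) * lconv (fun η => ‖a η‖ₑ) (fun η => ‖b η‖ₑ) ξ := by
  refine (enorm_integral_le_lintegral_enorm _).trans ?_
  rw [lconv, ← lintegral_const_mul _ (by fun_prop)]
  exact lintegral_mono fun η => enorm_kern_mul_le F a b ξ η

theorem lintegral_enorm_sq (a : H) : ∫⁻ ξ, ‖a ξ‖ₑ ^ 2 = ENNReal.ofReal (‖a‖ ^ 2) := by
  have := qf_one a
  simpa only [qf, ENNReal.ofReal_one, one_mul] using this

theorem lconv_enorm_le (a b : H) (ξ : E3) :
    lconv (fun η => ‖a η‖ₑ) (fun η => ‖b η‖ₑ) ξ ≤ ENNReal.ofReal (‖a‖ * ‖b‖) := by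
  have ha := measurable_coe a
  have hb := measurable_coe b
  have h := sq_lconv_le (f := fun η => ‖a η‖ₑ) (g := fun η => ‖b η‖ₑ) (by fun_prop) (by fun_prop) ξ
  rw [lintegral_enorm_sq, lintegral_enorm_sq, ← ENNReal.ofReal_mul (by positivity), ← mul_pow,
    ENNReal.ofReal_pow (by positivity)] at h
  exact (ENNReal.pow_le_pow_left_iff two_ne_zero).1 h

theorem integrable_kern_mul (F : ℝ) (a b : H) (ξ : E3) :
    Integrable fun η => (kern F ξ η : ℂ) * (a (ξ - η) * b η) := by
  have ha := measurable_coe a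
  have hb := measurable_coe b
  refine ⟨by fun_prop, ?_⟩
  refine (lintegral_mono fun η => enorm_kern_mul_le F a b ξ η).trans_lt ?_
  rw [lintegral_const_mul _ (by fun_prop)]
  exact ENNReal.mul_lt_top ENNReal.ofReal_lt_top
    ((lconv_enorm_le a b ξ).trans_lt ENNReal.ofReal_lt_top)

/-- The equality holds at every `ξ`, not just almost everywhere, since for fixed `ξ` the integral
only sees almost-everywhere classes. -/
theorem bil_congr (F : ℝ) {a a' b b' : E3 → ℂ} (ha : a =ᵐ[volume] a') (hb : b =ᵐ[volume] b') :
    bil F a b = bil F a' b' := by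
  ext ξ
  refine integral_congr_ae ?_
  filter_upwards [(quasiMeasurePreserving_sub_left volume ξ).ae ha, hb] with η h1 h2
  rw [h1, h2]

theorem bil_add_left (F : ℝ) (a a' b : H) (ξ : E3) :
    bil F (a + a' : H) b ξ = bil F a b ξ + bil F a' b ξ := by
  rw [bil_congr F (Lp.coeFn_add a a') (ae_eq_refl _), bil, bil, bil,
    ← integral_add (integrable_kern_mul F a b ξ) (integrable_kern_mul F a' b ξ)]
  congr 1; ext η
  simp only [Pi.add_apply]; ring

theorem bil_add_right (F : ℝ) (a b b' : H) (ξ : E3) :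
    bil F a (b + b' : H) ξ = bil F a b ξ + bil F a b' ξ := by
  rw [bil_congr F (ae_eq_refl _) (Lp.coeFn_add b b'), bil, bil, bil,
    ← integral_add (integrable_kern_mul F a b ξ) (integrable_kern_mul F a b' ξ)]
  congr 1; ext η
  simp only [Pi.add_apply]; ring

theorem bil_smul_left (F : ℝ) (c : ℝ) (a b : H) (ξ : E3) :
    bil F (c • a : H) b ξ = c • bil F a b ξ := by
  rw [bil_congr F (Lp.coeFn_smul c a) (ae_eq_refl _), bil, bil, ← integral_smul]
  congr 1; ext η
  simp only [Pi.smul_apply, Complex.real_smul]; ring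

theorem bil_smul_right (F : ℝ) (c : ℝ) (a b : H) (ξ : E3) :
    bil F a (c • b : H) ξ = c • bil F a b ξ := by
  rw [bil_congr F (ae_eq_refl _) (Lp.coeFn_smul c b), bil, bil, ← integral_smul]
  congr 1; ext η
  simp only [Pi.smul_apply, Complex.real_smul]; ring

theorem bil_self_sub (F : ℝ) (a b : H) (ξ : E3) :
    bil F a a ξ - bil F b b ξ = bil F (a - b : H) a ξ + bil F b (a - b : H) ξ := by
  have h1 := bil_add_left F (a - b) b a ξ
  have h2 := bil_add_right F b (a - b) b ξ
  rw [sub_add_cancel] at h1 h2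
  rw [h1, h2]; ring

theorem measurable_bil (F : ℝ) {a b : E3 → ℂ} (ha : Measurable a) (hb : Measurable b) :
    Measurable (bil F a b) := by
  refine StronglyMeasurable.measurable ?_
  refine StronglyMeasurable.integral_prod_right'
    (f := fun p : E3 × E3 => (kern F p.1 p.2 : ℂ) * (a (p.1 - p.2) * b p.2)) ?_
  refine Measurable.stronglyMeasurable ?_
  fun_prop

theorem volume_absD_lt_lt_top (N : ℝ) : volume {ξ : E3 | absD ξ < N} < ∞ := by
  refine lt_of_le_of_lt (measure_mono ?_) (measure_ball_lt_top (μ := volume) (x := (0 : E3)) (r := N))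
  intro ξ hξ
  have h1 : absD ξ < N := hξ
  rw [mem_ball_zero_iff]
  refine lt_of_le_of_lt ?_ h1
  have : 1 ≤ 2 * Real.pi := by linarith [Real.pi_gt_three]
  unfold absD
  nlinarith [norm_nonneg ξ]

/-- The bilinear form restricted to the output frequencies `|D| < N`. -/
def bilCut (F N : ℝ) (a b : E3 → ℂ) (ξ : E3) : ℂ := if absD ξ < N then bil F a b ξ else 0

theorem measurable_bilCut (F N : ℝ) {a b : E3 → ℂ} (ha : Measurable a) (hb : Measurable b) :
    Measurable (bilCut F N a b) :=
  Measurable.ite (measurableSet_absD_lt N) (measurable_bil F ha hb) measurable_const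

theorem enorm_bilCut_sq_le (F N : ℝ) (a b : H) (ξ : E3) :
    ‖bilCut F N a b ξ‖ₑ ^ 2 ≤ {ξ : E3 | absD ξ < N}.indicator
      (fun _ => ENNReal.ofReal ((|N| * (‖a‖ * ‖b‖)) ^ 2)) ξ := by
  unfold bilCut
  split_ifs with h
  · rw [indicator_of_mem (show ξ ∈ {ξ | absD ξ < N} from h), ENNReal.ofReal_pow (by positivity),
      ENNReal.ofReal_mul (abs_nonneg _)]
    gcongr
    refine (enorm_bil_le F (measurable_coe a) (measurable_coe b) ξ).trans ?_
    gcongr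
    · exact h.le.trans (le_abs_self N)
    · exact lconv_enorm_le a b ξ
  · simp

theorem lintegral_enorm_bilCut_sq_le (F N : ℝ) (a b : H) :
    ∫⁻ ξ, ‖bilCut F N a b ξ‖ₑ ^ 2 ≤
      ENNReal.ofReal ((|N| * (‖a‖ * ‖b‖)) ^ 2) * volume {ξ : E3 | absD ξ < N} := by
  refine (lintegral_mono (enorm_bilCut_sq_le F N a b)).trans ?_
  rw [lintegral_indicator (measurableSet_absD_lt N)]
  simp

theorem memLp_bilCut (F N : ℝ) (a b : H) : MemLp (bilCut F N a b) 2 volume := by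
  refine ⟨(measurable_bilCut F N (measurable_coe a) (measurable_coe b)).aestronglyMeasurable, ?_⟩
  rw [eLpNorm_lt_top_iff_lintegral_rpow_enorm_lt_top (by norm_num) (by norm_num)]
  simp only [ENNReal.toReal_ofNat, ENNReal.rpow_ofNat]
  exact (lintegral_enorm_bilCut_sq_le F N a b).trans_lt
    (ENNReal.mul_lt_top ENNReal.ofReal_lt_top (volume_absD_lt_lt_top N))

/-- The truncated nonlinearity as a bounded bilinear map. -/
def bilOp (F N : ℝ) : H →L[ℝ] H →L[ℝ] H :=
  LinearMap.mkContinuous₂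
    (LinearMap.mk₂ ℝ (fun a b => (memLp_bilCut F N a b).toLp _)
      (by
        intro a a' b
        ext1
        filter_upwards [(memLp_bilCut F N (a + a') b).coeFn_toLp, (memLp_bilCut F N a b).coeFn_toLp,
          (memLp_bilCut F N a' b).coeFn_toLp, Lp.coeFn_add ((memLp_bilCut F N a b).toLp _)
            ((memLp_bilCut F N a' b).toLp _)] with ξ h1 h2 h3 h4
        rw [h1, h4, Pi.add_apply, h2, h3]
        unfold bilCut
        split_ifs
        · exact bil_add_left F a a' b ξ
        · simp)
      (by
        intro c a b
        ext1
        filter_upwards [(memLp_bilCut F N (c • a) b).coeFn_toLp, (memLp_bilCut F N a b).coeFn_toLp,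
          Lp.coeFn_smul c ((memLp_bilCut F N a b).toLp _)] with ξ h1 h2 h4
        rw [h1, h4, Pi.smul_apply, h2]
        unfold bilCut
        split_ifs
        · exact bil_smul_left F c a b ξ
        · simp)
      (by
        intro a b b'
        ext1
        filter_upwards [(memLp_bilCut F N a (b + b')).coeFn_toLp, (memLp_bilCut F N a b).coeFn_toLp,
          (memLp_bilCut F N a b').coeFn_toLp, Lp.coeFn_add ((memLp_bilCut F N a b).toLp _)
            ((memLp_bilCut F N a b').toLp _)] with ξ h1 h2 h3 h4
        rw [h1, h4, Pi.add_apply, h2, h3]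
        unfold bilCut
        split_ifs
        · exact bil_add_right F a b b' ξ
        · simp)
      (by
        intro c a b
        ext1
        filter_upwards [(memLp_bilCut F N a (c • b)).coeFn_toLp, (memLp_bilCut F N a b).coeFn_toLp,
          Lp.coeFn_smul c ((memLp_bilCut F N a b).toLp _)] with ξ h1 h2 h4
        rw [h1, h4, Pi.smul_apply, h2]
        unfold bilCut
        split_ifs
        · exact bil_smul_right F c a b ξ
        · simp))
    -- On the band the form is pointwise at most `N ‖a‖ ‖b‖`, and the band has finite volume:
    -- truncating the output alone makes `B` bounded on L².
    (|N| * √(volume {ξ : E3 | absD ξ < N}).toReal)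
    (by
      intro a b
      rw [LinearMap.mk₂_apply]
      refine le_of_sq_le_sq ?_ (by positivity)
      rw [← ENNReal.ofReal_le_ofReal_iff (by positivity), ← lintegral_enorm_sq]
      have h1 : ∫⁻ ξ, ‖((memLp_bilCut F N a b).toLp _ : H) ξ‖ₑ ^ 2 =
          ∫⁻ ξ, ‖bilCut F N a b ξ‖ₑ ^ 2 := by
        refine lintegral_congr_ae ?_
        filter_upwards [(memLp_bilCut F N a b).coeFn_toLp] with ξ h
        rw [h]
      rw [h1]
      refine (lintegral_enorm_bilCut_sq_le F N a b).trans (le_of_eq ?_)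
      rw [← ENNReal.ofReal_toReal (volume_absD_lt_lt_top N).ne,
        ← ENNReal.ofReal_mul (by positivity), ENNReal.toReal_ofReal ENNReal.toReal_nonneg]
      congr 1
      rw [mul_pow, mul_pow, mul_pow, mul_pow, mul_pow, Real.sq_sqrt ENNReal.toReal_nonneg]
      ring)

theorem bilOp_coe (F N : ℝ) (a b : H) : bilOp F N a b =ᵐ[volume] bilCut F N a b :=
  (memLp_bilCut F N a b).coeFn_toLp

end QuasiGeo
end

noncomputable section

namespace QuasiGeo

/-! ### Hermitian symmetry -/

theorem memLp_conj_comp_neg (a : H) :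
    MemLp (fun ξ => (starRingEnd ℂ) (a (-ξ))) 2 (volume : Measure E3) := by
  have h := ((Lp.memLp a).comp_measurePreserving (Measure.measurePreserving_neg volume)).star
  exact h

/-- The real-linear involution `a ↦ conj a(-·)` as a linear map. -/
def hermLin : H →ₗ[ℝ] H where
  toFun := fun a => (memLp_conj_comp_neg a).toLp _
  map_add' := by
    intro a b
    ext1
    filter_upwards [(memLp_conj_comp_neg (a + b)).coeFn_toLp,
      (memLp_conj_comp_neg a).coeFn_toLp, (memLp_conj_comp_neg b).coeFn_toLp,
      (Measure.measurePreserving_neg volume).quasiMeasurePreserving.ae (Lp.coeFn_add a b),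
      Lp.coeFn_add ((memLp_conj_comp_neg a).toLp _) ((memLp_conj_comp_neg b).toLp _)]
      with ξ h1 h2 h3 h4 h5
    rw [h1, h5, Pi.add_apply, h2, h3, h4, Pi.add_apply, map_add]
  map_smul' := by
    intro c a
    ext1
    filter_upwards [(memLp_conj_comp_neg (c • a)).coeFn_toLp,
      (memLp_conj_comp_neg a).coeFn_toLp,
      (Measure.measurePreserving_neg volume).quasiMeasurePreserving.ae (Lp.coeFn_smul c a),
      Lp.coeFn_smul c ((memLp_conj_comp_neg a).toLp _)] with ξ h1 h2 h4 h5
    rw [h1, RingHom.id_apply, h5, Pi.smul_apply, h2, h4, Pi.smul_apply, Complex.real_smul,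
      Complex.real_smul, map_mul, Complex.conj_ofReal]

theorem hermLin_coe (a : H) : hermLin a =ᵐ[volume] fun ξ => (starRingEnd ℂ) (a (-ξ)) :=
  (memLp_conj_comp_neg a).coeFn_toLp

theorem norm_hermLin_le (a : H) : ‖hermLin a‖ ≤ 1 * ‖a‖ := by
  rw [one_mul]
  refine le_of_sq_le_sq ?_ (norm_nonneg _)
  rw [← ENNReal.ofReal_le_ofReal_iff (by positivity), ← lintegral_enorm_sq, ← lintegral_enorm_sq]
  have h1 : ∫⁻ ξ, ‖hermLin a ξ‖ₑ ^ 2 = ∫⁻ ξ, ‖a (-ξ)‖ₑ ^ 2 := by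
    refine lintegral_congr_ae ?_
    filter_upwards [hermLin_coe a] with ξ h
    rw [h, RCLike.enorm_conj]
  rw [h1]
  exact (lintegral_neg_eq_self (fun ξ => ‖a ξ‖ₑ ^ 2)).le

/-- The real-linear involution `a ↦ conj a(-·)`. -/
def hermOp : H →L[ℝ] H := hermLin.mkContinuous 1 norm_hermLin_le

theorem hermOp_coe (a : H) : hermOp a =ᵐ[volume] fun ξ => (starRingEnd ℂ) (a (-ξ)) :=
  (memLp_conj_comp_neg a).coeFn_toLp

/-- The closed real subspace of Hermitian functions supported in `|D| < N`. -/
def bandSpace (N : ℝ) : Submodule ℝ H where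
  carrier := {a | hermOp a = a ∧ proj N a = a}
  add_mem' := by
    rintro a b ⟨h1, h2⟩ ⟨h3, h4⟩
    exact ⟨by rw [map_add, h1, h3], by rw [map_add, h2, h4]⟩
  zero_mem' := ⟨map_zero _, map_zero _⟩
  smul_mem' := by
    rintro c a ⟨h1, h2⟩
    exact ⟨by rw [map_smul, h1], by rw [map_smul, h2]⟩

theorem isClosed_bandSpace (N : ℝ) : IsClosed (bandSpace N : Set H) :=
  (isClosed_eq hermOp.continuous continuous_id).inter (isClosed_eq (proj N).continuous continuous_id)

theorem hermOp_mulOp {m : E3 → ℝ} (hm : BSym m) (he : ∀ ξ, m (-ξ) = m ξ) (a : H) :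
    hermOp (mulOp m hm a) = mulOp m hm (hermOp a) := by
  ext1
  filter_upwards [hermOp_coe (mulOp m hm a), mulOp_coe m hm (hermOp a), hermOp_coe a,
    (Measure.measurePreserving_neg volume).quasiMeasurePreserving.ae (mulOp_coe m hm a)]
    with ξ h1 h2 h3 h4
  rw [h1, h2, h3, h4, map_mul, Complex.conj_ofReal, he]

theorem cut_even {N : ℝ} {m : E3 → ℝ} (h : ∀ ξ, m (-ξ) = m ξ) (ξ : E3) :
    cut N m (-ξ) = cut N m ξ := by
  by_cases hN : absD ξ < N
  · rw [cut_of_lt hN, cut_of_lt (by rwa [absD_neg]), h]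
  · rw [cut_of_not_lt hN, cut_of_not_lt (by rwa [absD_neg])]

theorem hermOp_proj (N : ℝ) (a : H) : hermOp (proj N a) = proj N (hermOp a) :=
  hermOp_mulOp _ (cut_even fun _ => rfl) a

theorem proj_mulOp_cut {N : ℝ} {m : E3 → ℝ} (hm : BSym (cut N m)) (a : H) :
    proj N (mulOp _ hm a) = mulOp _ hm a := by
  ext1
  filter_upwards [proj_coe N (mulOp _ hm a), mulOp_coe _ hm a] with ξ h1 h2
  rw [h1, h2]
  split_ifs with h
  · rfl
  · rw [cut_of_not_lt h]; simp

theorem proj_bilOp (F N : ℝ) (a b : H) : proj N (bilOp F N a b) = bilOp F N a b := by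
  ext1
  filter_upwards [proj_coe N (bilOp F N a b), bilOp_coe F N a b] with ξ h1 h2
  rw [h1, h2, bilCut]
  split_ifs <;> rfl

theorem proj_bilOp_of_le {F N M : ℝ} (h : N ≤ M) (a b : H) :
    proj N (bilOp F M a b) = bilOp F N a b := by
  ext1
  filter_upwards [proj_coe N (bilOp F M a b), bilOp_coe F M a b, bilOp_coe F N a b] with ξ h1 h2 h3
  rw [h1, h2, h3, bilCut, bilCut]
  split_ifs with h4 h5
  · rfl
  · exact absurd (h4.trans_le h) h5
  · rfl

theorem conj_bil_neg (F : ℝ) {a : H} (ha : hermOp a = a) (ξ : E3) :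
    (starRingEnd ℂ) (bil F a a (-ξ)) = bil F a a ξ := by
  have hc := hermOp_coe a
  rw [ha] at hc
  rw [bil, ← integral_conj, ← integral_neg_eq_self, bil]
  refine integral_congr_ae ?_
  filter_upwards [(quasiMeasurePreserving_sub_left volume ξ).ae hc, hc] with η h1 h2
  rw [h1, h2, map_mul, map_mul, Complex.conj_ofReal, kern_neg_neg]
  congr 4
  abel

theorem hermOp_bilOp (F N : ℝ) {a : H} (ha : hermOp a = a) :
    hermOp (bilOp F N a a) = bilOp F N a a := by
  ext1
  filter_upwards [hermOp_coe (bilOp F N a a), bilOp_coe F N a a,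
    (Measure.measurePreserving_neg volume).quasiMeasurePreserving.ae (bilOp_coe F N a a)]
    with ξ h1 h2 h3
  rw [h1, h2, h3, bilCut, bilCut, absD_neg]
  split_ifs
  · exact conj_bil_neg F ha ξ
  · simp

/-! ### Cancellations in the nonlinearity -/

/-- Every cancellation below has this form: the integral equals its own negative. -/
theorem integral_eq_zero_of_comp_eq_neg {α : Type*} [MeasurableSpace α] {μ : Measure α}
    {S : α → α} (hS : MeasurePreserving S μ μ) {g : α → ℂ} (hg : AEStronglyMeasurable g μ)
    (h : ∀ x, g (S x) = -g x) : ∫ x, g x ∂μ = 0 := by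
  have h1 : ∫ x, g (S x) ∂μ = ∫ x, g x ∂μ := by
    conv_rhs => rw [← hS.map_eq]
    rw [integral_map hS.measurable.aemeasurable (by rwa [hS.map_eq])]
  simp_rw [h, integral_neg] at h1
  exact self_eq_neg.1 h1.symm

/-- A cubic interaction involves three frequencies `p`, `q`, `-p-q` of sum zero. In the coordinates
`(p, q)`, this map exchanges the second and the third. -/
theorem measurePreserving_swap_snd_third :
    MeasurePreserving (fun z : E3 × E3 => (z.1, -z.1 - z.2)) := by
  have h := ((MeasurePreserving.id (volume : Measure E3)).prod
    (Measure.measurePreserving_neg (volume : Measure E3))).comp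
    (measurePreserving_prod_add (volume : Measure E3) (volume : Measure E3))
  have e : (fun z : E3 × E3 => (z.1, -z.1 - z.2)) =
      Prod.map id Neg.neg ∘ fun z : E3 × E3 => (z.1, z.1 + z.2) := by
    ext1 z
    simp only [Function.comp_apply, Prod.map_apply, id_eq, Prod.mk.injEq, true_and]
    abel
  rw [e]
  exact h

theorem measurePreserving_swap_fst_third :
    MeasurePreserving (fun z : E3 × E3 => (-z.1 - z.2, z.2)) := by
  have h := ((Measure.measurePreserving_swap (μ := (volume : Measure E3))
    (ν := (volume : Measure E3))).comp measurePreserving_swap_snd_third).comp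
    (Measure.measurePreserving_swap (μ := (volume : Measure E3)) (ν := (volume : Measure E3)))
  have e : (fun z : E3 × E3 => (-z.1 - z.2, z.2)) =
      (Prod.swap ∘ fun z : E3 × E3 => (z.1, -z.1 - z.2)) ∘ Prod.swap := by
    ext1 z
    simp only [Function.comp_apply, Prod.swap_prod_mk, Prod.fst_swap, Prod.snd_swap,
      Prod.mk.injEq, and_true]
    abel
  rw [e]
  exact h

/-- The antisymmetric part of the kernel. -/
def antiKern (F : ℝ) (z : E3 × E3) : ℝ :=
  -(2 * Real.pi) * cross z.1 z.2 * (‖rho F z.1‖ * ‖rho F z.2‖ * ‖rho F (z.1 + z.2)‖)⁻¹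

/-- The symmetric cubic expression `a(p) a(q) a(-p-q)`. -/
def triple (a : E3 → ℂ) (z : E3 × E3) : ℂ := a z.1 * a z.2 * a (-z.1 - z.2)

@[fun_prop]
theorem measurable_antiKern (F : ℝ) : Measurable (antiKern F) := by
  unfold antiKern; fun_prop

theorem measurable_triple {a : E3 → ℂ} (ha : Measurable a) : Measurable (triple a) := by
  unfold triple; fun_prop

/-- When three frequencies sum to zero, `cross` of any two is the same oriented area up to sign. The
denominator is symmetric in the three, so each transposition changes the sign of `antiKern`. -/
theorem antiKern_swap (F : ℝ) (z : E3 × E3) : antiKern F z.swap = -antiKern F z := by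
  simp only [antiKern, Prod.fst_swap, Prod.snd_swap, add_comm z.2, cross]
  ring

theorem antiKern_swap_snd_third (F : ℝ) (z : E3 × E3) :
    antiKern F (z.1, -z.1 - z.2) = -antiKern F z := by
  have h1 : z.1 + -(z.1 + z.2) = -z.2 := by abel
  have h2 : -z.1 - z.2 = -(z.1 + z.2) := by abel
  simp only [antiKern, h1, h2, rho_neg, norm_neg, cross, PiLp.neg_apply, PiLp.add_apply]
  ring

theorem antiKern_swap_fst_third (F : ℝ) (z : E3 × E3) :
    antiKern F (-z.1 - z.2, z.2) = -antiKern F z := by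
  have h1 : -(z.1 + z.2) + z.2 = -z.1 := by abel
  have h2 : -z.1 - z.2 = -(z.1 + z.2) := by abel
  simp only [antiKern, h1, h2, rho_neg, norm_neg, cross, PiLp.neg_apply, PiLp.add_apply]
  ring

theorem triple_swap (a : E3 → ℂ) (z : E3 × E3) : triple a z.swap = triple a z := by
  have h : -z.2 - z.1 = -z.1 - z.2 := by abel
  simp only [triple, Prod.fst_swap, Prod.snd_swap, h]; ring

theorem triple_swap_snd_third (a : E3 → ℂ) (z : E3 × E3) :
    triple a (z.1, -z.1 - z.2) = triple a z := by
  have h : -z.1 - (-z.1 - z.2) = z.2 := by abel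
  simp only [triple, h]; ring

theorem triple_swap_fst_third (a : E3 → ℂ) (z : E3 × E3) :
    triple a (-z.1 - z.2, z.2) = triple a z := by
  have h : -(-z.1 - z.2) - z.2 = z.1 := by abel
  simp only [triple, h]; ring

/-- `cross p (p + q) = cross p q`, and since `rho` is linear the polarization identity turns the
inner product into squared norms. The failure of antisymmetry is thus confined to an explicit
quadratic factor. -/
theorem kern_eq_antiKern (F : ℝ) (p q : E3) :
    kern F (p + q) q = antiKern F (p, q) *
      ((‖rho F (p + q)‖ ^ 2 + ‖rho F q‖ ^ 2 - ‖rho F p‖ ^ 2) / 2) := by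
  have h1 : cross p (p + q) = cross p q := by simp [cross]; ring
  have h2 : inner ℝ (rho F q) (rho F (p + q)) =
      (‖rho F (p + q)‖ ^ 2 + ‖rho F q‖ ^ 2 - ‖rho F p‖ ^ 2) / 2 := by
    have := norm_sub_sq_real (rho F (p + q)) (rho F q)
    rw [rho_add, add_sub_cancel_right, ← rho_add, real_inner_comm] at this
    linarith
  rw [kern, antiKern, add_sub_cancel_right, h1, h2]
  simp only [div_eq_mul_inv, mul_inv]
  ring

/-- `antiKern` is singular where `ρ` of the third frequency vanishes. One factor of that norm
removes the singularity, which makes the separate terms of the enstrophy cancellation integrable. -/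
theorem abs_antiKern_mul_le (F : ℝ) (z : E3 × E3) :
    |antiKern F z| * ‖rho F (z.1 + z.2)‖ ≤ 2 * Real.pi := by
  set x := ‖rho F z.1‖
  set y := ‖rho F z.2‖
  set w := ‖rho F (z.1 + z.2)‖
  have hc := abs_cross_le_rho_mul_rho F z.1 z.2
  have hx : 0 ≤ x := norm_nonneg _
  have hy : 0 ≤ y := norm_nonneg _
  have hw : 0 ≤ w := norm_nonneg _
  rw [antiKern, abs_mul, abs_mul, abs_neg, abs_of_nonneg (by positivity : (0 : ℝ) ≤ 2 * Real.pi),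
    abs_inv, abs_mul (_ * _), abs_mul, abs_norm, abs_norm, abs_norm, mul_inv]
  have h1 : |cross z.1 z.2| * (x * y)⁻¹ ≤ 1 := by
    rw [← div_eq_mul_inv]; exact div_le_one_of_le₀ hc (by positivity)
  have h2 : w⁻¹ * w ≤ 1 := inv_mul_le_one_of_le₀ le_rfl hw
  calc 2 * Real.pi * |cross z.1 z.2| * ((x * y)⁻¹ * w⁻¹) * w
      = 2 * Real.pi * ((|cross z.1 z.2| * (x * y)⁻¹) * (w⁻¹ * w)) := by ring
    _ ≤ 2 * Real.pi * (1 * 1) := by gcongr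
    _ = _ := by ring

theorem norm_rho_le (F : ℝ) (ξ : E3) : ‖rho F ξ‖ ≤ (1 + |F|) * absD ξ := by
  have h0 : ‖ξ‖ ≤ absD ξ := by
    have : 1 ≤ 2 * Real.pi := by linarith [Real.pi_gt_three]
    unfold absD; nlinarith [norm_nonneg ξ]
  have h1 : ‖rho F ξ‖ ≤ (1 + |F|) * ‖ξ‖ := by
    refine le_of_sq_le_sq ?_ (by positivity)
    rw [mul_pow, norm_sq_rho, norm_sq_E3]
    have h2 : (1 + |F|) ^ 2 = 1 + 2 * |F| + F ^ 2 := by rw [add_sq, sq_abs]; ring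
    rw [h2]
    have h3 := abs_nonneg F
    have h4 : 0 ≤ (2 * |F| + F ^ 2) * (ξ 0 ^ 2 + ξ 1 ^ 2) := by positivity
    have h5 : 0 ≤ (1 + 2 * |F|) * ξ 2 ^ 2 := by positivity
    nlinarith
  refine h1.trans ?_
  gcongr

/-- The representative of a band-limited function that vanishes for `|D| ≥ N`. -/
def bandRep (N : ℝ) (a : E3 → ℂ) (ξ : E3) : ℂ := if absD ξ < N then a ξ else 0

theorem measurable_bandRep (N : ℝ) {a : E3 → ℂ} (ha : Measurable a) : Measurable (bandRep N a) :=
  Measurable.ite (measurableSet_absD_lt N) ha measurable_const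

theorem absD_lt_of_bandRep_ne {N : ℝ} {a : E3 → ℂ} {ξ : E3} (h : bandRep N a ξ ≠ 0) :
    absD ξ < N := by
  by_contra h1
  exact h (if_neg h1)

theorem bandRep_ae_eq {N : ℝ} {a : H} (ha : proj N a = a) : bandRep N a =ᵐ[volume] a := by
  have h := proj_coe N a
  rw [ha] at h
  exact h.symm

theorem sq_oneNorm_le_of_proj {N : ℝ} {a : H} (ha : proj N a = a) :
    oneNorm a ^ 2 ≤ volume {ξ : E3 | absD ξ < N} * ENNReal.ofReal (‖a‖ ^ 2) := by
  have hm := measurable_coe a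
  have h := sq_lintegral_mul_le (μ := (volume : Measure E3))
    (f := {ξ : E3 | absD ξ < N}.indicator fun _ => 1) (g := fun ξ => ‖a ξ‖ₑ)
    (measurable_const.indicator (measurableSet_absD_lt N)).aemeasurable (by fun_prop)
  rw [lintegral_enorm_sq] at h
  have h1 : ∫⁻ ξ, ({ξ : E3 | absD ξ < N}.indicator (fun _ => (1 : ℝ≥0∞)) ξ) ^ 2 =
      volume {ξ : E3 | absD ξ < N} := by
    rw [← lintegral_indicator_one (measurableSet_absD_lt N)]
    refine lintegral_congr fun ξ => ?_
    by_cases hξ : ξ ∈ {ξ : E3 | absD ξ < N}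
    · simp [indicator_of_mem hξ]
    · simp [indicator_of_notMem hξ]
  rw [h1] at h
  refine le_trans (le_of_eq ?_) h
  congr 1
  refine lintegral_congr_ae ?_
  filter_upwards [bandRep_ae_eq ha] with ξ hξ
  by_cases h2 : ξ ∈ {ξ : E3 | absD ξ < N}
  · rw [indicator_of_mem h2, one_mul]
  · have h3 : bandRep N a ξ = 0 := if_neg h2
    rw [← hξ, h3]; simp

theorem oneNorm_lt_top_of_proj {N : ℝ} {a : H} (ha : proj N a = a) : oneNorm a < ∞ := by
  by_contra h
  have h1 := sq_oneNorm_le_of_proj ha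
  rw [not_lt, top_le_iff] at h
  rw [h, ENNReal.top_pow two_ne_zero, top_le_iff] at h1
  exact absurd h1
    (ENNReal.mul_lt_top (volume_absD_lt_lt_top N) (ENNReal.ofReal_lt_top (r := ‖a‖ ^ 2))).ne

/-- Band limitation puts `a` in L¹ as well as L². The cubic integral is at most `‖a‖_{L¹} ‖a‖²`, by
Cauchy–Schwarz in `q` for fixed `p`. -/
theorem integrable_triple {N : ℝ} {a : H} (ha : proj N a = a) :
    Integrable (triple (bandRep N a)) (volume : Measure (E3 × E3)) := by
  have hb := measurable_bandRep N (measurable_coe a)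
  set b := bandRep N a
  have hba : b =ᵐ[volume] a := bandRep_ae_eq ha
  have ht := measurable_triple hb
  refine ⟨ht.aestronglyMeasurable, ?_⟩
  have h1 : ∫⁻ z, ‖triple b z‖ₑ ∂(volume : Measure (E3 × E3)) =
      ∫⁻ p, ∫⁻ q, ‖triple b (p, q)‖ₑ := by
    rw [Measure.volume_eq_prod, lintegral_prod _ (by fun_prop)]
  have hsq : ∫⁻ q, ‖b q‖ₑ ^ 2 = ENNReal.ofReal (‖a‖ ^ 2) := by
    rw [← lintegral_enorm_sq]
    refine lintegral_congr_ae ?_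
    filter_upwards [hba] with ξ hξ
    rw [hξ]
  rw [HasFiniteIntegral, h1]
  have h2 : ∀ p, ∫⁻ q, ‖triple b (p, q)‖ₑ ≤ ‖b p‖ₑ * ENNReal.ofReal (‖a‖ ^ 2) := by
    intro p
    simp only [triple, enorm_mul, mul_assoc]
    rw [lintegral_const_mul _ (by fun_prop)]
    gcongr
    have h3 := sq_lintegral_mul_le (μ := (volume : Measure E3)) (f := fun q => ‖b q‖ₑ)
      (g := fun q => ‖b (-p - q)‖ₑ) (by fun_prop) (by fun_prop)
    rw [lintegral_sub_left_eq_self (fun q => ‖b q‖ₑ ^ 2) (-p), hsq, ← sq] at h3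
    exact (ENNReal.pow_le_pow_left_iff two_ne_zero).1 h3
  refine (lintegral_mono h2).trans_lt ?_
  rw [lintegral_mul_const _ (by fun_prop)]
  refine ENNReal.mul_lt_top ?_ ENNReal.ofReal_lt_top
  have h4 : ∫⁻ p, ‖b p‖ₑ = oneNorm a := by
    refine lintegral_congr_ae ?_
    filter_upwards [hba] with ξ hξ
    rw [hξ]
  rw [h4]
  exact oneNorm_lt_top_of_proj ha

theorem integrable_mul_triple {N C : ℝ} {a : H} (ha : proj N a = a) {f : E3 × E3 → ℝ}
    (hf : Measurable f)
    (h : ∀ z, absD z.1 < N → absD z.2 < N → absD (z.1 + z.2) < N → |f z| ≤ C) :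
    Integrable (fun z => (f z : ℂ) * triple (bandRep N a) z) (volume : Measure (E3 × E3)) := by
  have hb := measurable_triple (measurable_bandRep N (measurable_coe a))
  refine ((integrable_triple ha).norm.const_mul C).mono' (by fun_prop)
    (Eventually.of_forall fun z => ?_)
  by_cases h0 : triple (bandRep N a) z = 0
  · simp [h0]
  · have h1 : bandRep N a z.1 ≠ 0 := fun h => h0 (by simp [triple, h])
    have h2 : bandRep N a z.2 ≠ 0 := fun h => h0 (by simp [triple, h])
    have h3 : bandRep N a (-z.1 - z.2) ≠ 0 := fun h => h0 (by simp [triple, h])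
    rw [norm_mul, Complex.norm_real]
    gcongr
    refine h z (absD_lt_of_bandRep_ne h1) (absD_lt_of_bandRep_ne h2) ?_
    have := absD_lt_of_bandRep_ne h3
    rwa [show -z.1 - z.2 = -(z.1 + z.2) by abel, absD_neg] at this

set_option maxHeartbeats 1000000 in
/-- The pairing of the nonlinearity with a multiple of `a` as a symmetric cubic integral. -/
theorem inner_mulOp_bilOp_eq {F N C : ℝ} {m : E3 → ℝ} (hmm : Measurable m)
    (hm : BSym (cut N m))
    (hmC : ∀ ξ, absD ξ < N → |m ξ * absD ξ| ≤ C) {a : H} (hh : hermOp a = a)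
    (ha : proj N a = a) :
    inner ℝ (mulOp _ hm a) (bilOp F N a a) =
      (∫ z : E3 × E3, ((m (z.1 + z.2) * kern F (z.1 + z.2) z.2 : ℝ) : ℂ) *
        triple (bandRep N a) z).re := by
  have hbm := measurable_bandRep N (measurable_coe a)
  set b := bandRep N a with hb
  have hba : b =ᵐ[volume] a := bandRep_ae_eq ha
  set f : E3 × E3 → ℝ := fun z => m (z.1 + z.2) * kern F (z.1 + z.2) z.2 with hf
  have hfm : Measurable f := by rw [hf]; fun_prop
  have hint : Integrable (fun z => (f z : ℂ) * triple b z) (volume : Measure (E3 × E3)) := by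
    refine integrable_mul_triple (C := C) ha hfm fun z _ _ h => ?_
    refine le_trans ?_ (hmC _ h)
    rw [hf]
    simp only
    rw [abs_mul, abs_mul, abs_of_nonneg (absD_nonneg _)]
    exact mul_le_mul_of_nonneg_left (abs_kern_le F _ _) (abs_nonneg _)
  -- The variables become `p = ξ - η`, `q = η`. Hermitian symmetry then turns `conj (a ξ)` into `a
  -- (-p - q)`, which makes the cubic factor symmetric in the three frequencies.
  set S : E3 × E3 → E3 × E3 := fun z => (z.1 - z.2, z.2) with hS
  have hSp : MeasurePreserving S (volume : Measure (E3 × E3)) volume :=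
    measurePreserving_sub_prod volume volume
  have h1 : ∫ z, (f z : ℂ) * triple b z = ∫ z, (f (S z) : ℂ) * triple b (S z) := by
    have htm := measurable_triple hbm
    conv_lhs => rw [← hSp.map_eq]
    rw [integral_map hSp.measurable.aemeasurable (by rw [hSp.map_eq]; exact hint.1)]
  have hint2 : Integrable (fun z => (f (S z) : ℂ) * triple b (S z)) (volume : Measure (E3 × E3)) :=
    hSp.integrable_comp_of_integrable hint
  have h2 : ∫ z, (f (S z) : ℂ) * triple b (S z) =
      ∫ ξ, ∫ η, (f (S (ξ, η)) : ℂ) * triple b (S (ξ, η)) := by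
    rw [Measure.volume_eq_prod] at hint2 ⊢
    exact integral_prod _ hint2
  have hc := hermOp_coe a
  rw [hh] at hc
  have h3 : ∀ᵐ ξ, (∫ η, (f (S (ξ, η)) : ℂ) * triple b (S (ξ, η))) =
      (cut N m ξ : ℂ) * ((starRingEnd ℂ) (a ξ) * bilOp F N a a ξ) := by
    filter_upwards [(Measure.measurePreserving_neg volume).quasiMeasurePreserving.ae hc,
      (Measure.measurePreserving_neg volume).quasiMeasurePreserving.ae hba, bilOp_coe F N a a]
      with ξ h4 h5 h6
    have h7 : b (-ξ) = (starRingEnd ℂ) (a ξ) := by rw [h5, h4, neg_neg]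
    have h8 : ∀ η, (f (S (ξ, η)) : ℂ) * triple b (S (ξ, η)) =
        ((m ξ : ℂ) * (starRingEnd ℂ) (a ξ)) * ((kern F ξ η : ℂ) * (b (ξ - η) * b η)) := by
      intro η
      have h9 : -(ξ - η) - η = -ξ := by abel
      simp only [hf, hS, triple, sub_add_cancel, h9, h7]
      push_cast
      ring
    simp_rw [h8]
    rw [integral_const_mul]
    change _ * bil F b b ξ = _
    rw [bil_congr F hba hba, h6, bilCut]
    split_ifs with h10
    · rw [cut_of_lt h10]; ring
    · have : a ξ = 0 := by
        have h11 : b (-ξ) = 0 := by rw [hb, bandRep, absD_neg, if_neg h10]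
        rw [h7] at h11
        simpa using h11
      rw [this]; simp
  rw [h1, h2, integral_congr_ae h3, inner_mulOp_eq]
  have h12 : Integrable fun ξ => (cut N m ξ : ℂ) * ((starRingEnd ℂ) (a ξ) * bilOp F N a a ξ) := by
    refine Integrable.congr ?_ h3
    rw [Measure.volume_eq_prod] at hint2
    exact hint2.integral_prod_left
  have h13 := integral_re h12
  simp only [RCLike.re_eq_complex_re] at h13
  rw [← h13]
  congr 1
  ext ξ
  rw [Complex.re_ofReal_mul]

/-- Conservation of energy by the nonlinearity. -/
theorem inner_bilOp_self {F N : ℝ} {a : H} (hh : hermOp a = a)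
    (ha : proj N a = a) : inner ℝ a (bilOp F N a a) = 0 := by
  have h := inner_mulOp_bilOp_eq (F := F) (C := N) (m := fun _ => 1) measurable_const
    (bsym_cut_one N) (fun ξ h => by
      rw [one_mul, abs_of_nonneg (absD_nonneg _)]; exact h.le) hh ha
  have h1 : mulOp _ (bsym_cut_one N) a = a := ha
  rw [h1] at h
  -- The quadratic factor of the kernel is symmetric under exchanging `q` with `-p - q`, because the
  -- norm of `ρ` is even; `antiKern` is odd under that exchange.
  rw [h, integral_eq_zero_of_comp_eq_neg measurePreserving_swap_snd_third]
  · simp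
  · have hb := measurable_triple (measurable_bandRep N (measurable_coe a))
    fun_prop
  · intro z
    have e1 : z.1 + (-z.1 - z.2) = -z.2 := by abel
    have e2 : -z.1 - z.2 = -(z.1 + z.2) := by abel
    have e3 := kern_eq_antiKern F z.1 (-z.1 - z.2)
    simp only [one_mul]
    rw [e3, kern_eq_antiKern, triple_swap_snd_third, antiKern_swap_snd_third, e1, e2, rho_neg,
      rho_neg, norm_neg, norm_neg]
    push_cast
    ring

/-- Conservation of the potential enstrophy by the nonlinearity. -/
theorem inner_mulOp_rho_bilOp_self {F N : ℝ} (hN : 0 ≤ N)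
    (hm : BSym (cut N fun ξ => ‖rho F ξ‖ ^ 2)) {a : H} (hh : hermOp a = a) (ha : proj N a = a) :
    inner ℝ (mulOp _ hm a) (bilOp F N a a) = 0 := by
  set M := (1 + |F|) * N with hM
  have hM0 : 0 ≤ M := by positivity
  have hrho : ∀ ξ, absD ξ < N → ‖rho F ξ‖ ≤ M := by
    intro ξ h
    refine (norm_rho_le F ξ).trans ?_
    rw [hM]
    gcongr
  rw [inner_mulOp_bilOp_eq (C := M ^ 2 * N) (by fun_prop) hm (fun ξ h => by
    rw [abs_mul, abs_of_nonneg (by positivity), abs_of_nonneg (absD_nonneg _)]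
    have := hrho ξ h
    have := absD_nonneg ξ
    gcongr) hh ha]
  have htm := measurable_triple (measurable_bandRep N (measurable_coe a))
  set t := triple (bandRep N a)
  set P1 : E3 × E3 → ℝ := fun z => ‖rho F z.1‖ ^ 2 with hP1
  set P2 : E3 × E3 → ℝ := fun z => ‖rho F z.2‖ ^ 2 with hP2
  set P3 : E3 × E3 → ℝ := fun z => ‖rho F (z.1 + z.2)‖ ^ 2 with hP3
  have hm1 : Measurable P1 := by rw [hP1]; fun_prop
  have hm2 : Measurable P2 := by rw [hP2]; fun_prop
  have hm3 : Measurable P3 := by rw [hP3]; fun_prop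
  have hI : ∀ P : E3 × E3 → ℝ, Measurable P →
      (∀ z, absD z.1 < N → absD z.2 < N → absD (z.1 + z.2) < N → |P z| ≤ M ^ 2) →
      Integrable (fun z => ((antiKern F z * (P3 z * P z) : ℝ) : ℂ) * t z) := by
    intro P hP hPM
    refine integrable_mul_triple (C := 2 * Real.pi * (M * M ^ 2)) ha (by fun_prop)
      fun z z1 z2 z3 => ?_
    have hk := abs_antiKern_mul_le F z
    have h3 := hrho _ z3
    have h4 := hPM z z1 z2 z3
    rw [hP3]
    simp only
    rw [abs_mul, abs_mul, abs_of_nonneg (sq_nonneg ‖rho F (z.1 + z.2)‖)]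
    calc |antiKern F z| * (‖rho F (z.1 + z.2)‖ ^ 2 * |P z|)
        = (|antiKern F z| * ‖rho F (z.1 + z.2)‖) * (‖rho F (z.1 + z.2)‖ * |P z|) := by ring
      _ ≤ 2 * Real.pi * (M * M ^ 2) := by gcongr
  have hI1 := hI P1 hm1 fun z z1 _ _ => by
    rw [hP1]; simp only; rw [abs_of_nonneg (by positivity)]
    have := hrho _ z1
    gcongr
  have hI2 := hI P2 hm2 fun z _ z2 _ => by
    rw [hP2]; simp only; rw [abs_of_nonneg (by positivity)]
    have := hrho _ z2
    gcongr
  have hI3 := hI P3 hm3 fun z _ _ z3 => by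
    rw [hP3]; simp only; rw [abs_of_nonneg (by positivity)]
    have := hrho _ z3
    gcongr
  have e23 : ∀ z : E3 × E3, -z.1 - z.2 = -(z.1 + z.2) := fun z => by abel
  -- The weighted kernel is `antiKern` times `P3 (P3 + P2 - P1) / 2`. Each monomial is symmetric
  -- under one transposition: `P3 P1` under first–third, `P3 P2` under second–third, `P3 P3` under
  -- first–second. Hence each integral vanishes separately.
  have hZ1 : ∫ z, ((antiKern F z * (P3 z * P1 z) : ℝ) : ℂ) * t z = 0 := by
    refine integral_eq_zero_of_comp_eq_neg measurePreserving_swap_fst_third (by fun_prop)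
      fun z => ?_
    have e1 : -z.1 - z.2 + z.2 = -z.1 := by abel
    simp only [t, triple_swap_fst_third, antiKern_swap_fst_third, hP1, hP3, e1]
    rw [e23, rho_neg, rho_neg, norm_neg, norm_neg]
    push_cast; ring
  have hZ2 : ∫ z, ((antiKern F z * (P3 z * P2 z) : ℝ) : ℂ) * t z = 0 := by
    refine integral_eq_zero_of_comp_eq_neg measurePreserving_swap_snd_third (by fun_prop)
      fun z => ?_
    have e1 : z.1 + (-z.1 - z.2) = -z.2 := by abel
    simp only [t, triple_swap_snd_third, antiKern_swap_snd_third, hP2, hP3, e1]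
    rw [e23, rho_neg, rho_neg, norm_neg, norm_neg]
    push_cast; ring
  have hZ3 : ∫ z, ((antiKern F z * (P3 z * P3 z) : ℝ) : ℂ) * t z = 0 := by
    refine integral_eq_zero_of_comp_eq_neg (S := Prod.swap) Measure.measurePreserving_swap
      (by fun_prop) fun z => ?_
    simp only [t, triple_swap, antiKern_swap, hP3, Prod.fst_swap, Prod.snd_swap, add_comm z.2]
    push_cast; ring
  have hsum : ∀ z : E3 × E3, ((‖rho F (z.1 + z.2)‖ ^ 2 * kern F (z.1 + z.2) z.2 : ℝ) : ℂ) * t z =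
      (1 / 2 : ℂ) * ((((antiKern F z * (P3 z * P3 z) : ℝ) : ℂ) * t z +
        ((antiKern F z * (P3 z * P2 z) : ℝ) : ℂ) * t z) -
        ((antiKern F z * (P3 z * P1 z) : ℝ) : ℂ) * t z) := by
    intro z
    rw [kern_eq_antiKern]
    simp only [hP1, hP2, hP3]
    push_cast; ring
  simp_rw [hsum]
  rw [integral_const_mul, integral_sub (f := fun z => ((antiKern F z * (P3 z * P3 z) : ℝ) : ℂ) * t z +
    ((antiKern F z * (P3 z * P2 z) : ℝ) : ℂ) * t z) (hI3.add hI2) hI1, integral_add hI3 hI2, hZ1, hZ2, hZ3]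
  simp

end QuasiGeo
end

noncomputable section

namespace QuasiGeo

/-! ### Frequency-truncated solutions -/

/-- Symbols `g` of diffusions: even, comparable to `-|D|²`. -/
structure DiffSym (ν₀ : ℝ) (g : E3 → ℝ) : Prop where
  measurable : Measurable g
  le : ∀ ξ, g ξ ≤ -(ν₀ * absD ξ ^ 2)
  bound : ∃ C, 0 ≤ C ∧ ∀ ξ, |g ξ| ≤ C * absD ξ ^ 2
  even : ∀ ξ, g (-ξ) = g ξ

theorem DiffSym.bsym {ν₀ : ℝ} {g : E3 → ℝ} (hg : DiffSym ν₀ g) (N : ℝ) : BSym (cut N g) := by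
  obtain ⟨C, hC0, hC⟩ := hg.bound
  refine bsym_cut (C := C * N ^ 2) hg.measurable fun ξ h => (hC ξ).trans ?_
  have := absD_nonneg ξ
  gcongr

/-- The truncated vector field `g a - B(a, a)`. -/
def field {ν₀ : ℝ} {g : E3 → ℝ} (F : ℝ) (hg : DiffSym ν₀ g) (N : ℝ) (a : H) : H :=
  mulOp (cut N g) (hg.bsym N) a - bilOp F N a a

theorem continuous_field {ν₀ : ℝ} {g : E3 → ℝ} (F : ℝ) (hg : DiffSym ν₀ g) (N : ℝ) :
    Continuous (field F hg N) := by
  unfold field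
  exact (mulOp _ _).continuous.sub ((bilOp F N).continuous.clm_apply continuous_id)

theorem field_coe {ν₀ : ℝ} {g : E3 → ℝ} (F : ℝ) (hg : DiffSym ν₀ g) (N : ℝ) (a : H) :
    ∀ᵐ ξ, field F hg N a ξ = if absD ξ < N then (g ξ : ℂ) * a ξ - bil F a a ξ else 0 := by
  filter_upwards [mulOp_coe _ (hg.bsym N) a, bilOp_coe F N a a,
    Lp.coeFn_sub (mulOp _ (hg.bsym N) a) (bilOp F N a a)] with ξ h1 h2 h3
  rw [field, h3, Pi.sub_apply, h1, h2, bilCut]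
  split_ifs with h
  · rw [cut_of_lt h]
  · rw [cut_of_not_lt h]; simp

theorem inner_mulOp_mulOp_nonpos {w g : E3 → ℝ} {ν₀ : ℝ} (hw : BSym w)
    (hw0 : ∀ ξ, 0 ≤ w ξ) (hwD : BSym fun ξ => w ξ * absD ξ ^ 2) {N : ℝ} (hg : DiffSym ν₀ g)
    {a : H} (ha : proj N a = a) :
    inner ℝ (mulOp w hw a) (mulOp (cut N g) (hg.bsym N) a) ≤
      -(ν₀ * rq (fun ξ => w ξ * absD ξ ^ 2) a) := by
  have hc := bandRep_ae_eq ha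
  rw [inner_mulOp_eq, rq_eq_integral hwD.1 (fun ξ => by have := hw0 ξ; positivity),
    ← integral_const_mul, ← integral_neg]
  refine integral_mono_ae (integrable_mul_re_conj_mul hw a _)
    ((integrable_mul_norm_sq hwD a).const_mul ν₀).neg ?_
  filter_upwards [mulOp_coe (cut N g) (hg.bsym N) a, hc] with ξ h1 h2
  rw [h1, mul_left_comm, Complex.conj_mul', ← Complex.ofReal_pow, ← Complex.ofReal_mul,
    Complex.ofReal_re]
  by_cases h : absD ξ < N
  · rw [cut_of_lt h]
    have h3 := mul_le_mul_of_nonneg_right (hg.le ξ) (sq_nonneg ‖a ξ‖)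
    have h4 := mul_le_mul_of_nonneg_left h3 (hw0 ξ)
    refine h4.trans (le_of_eq ?_)
    ring
  · have : a ξ = 0 := by rw [← h2, bandRep, if_neg h]
    simp [this]

/-- A solution on `[0, T]` of the system truncated at the frequency `N`. -/
structure IsApprox {ν₀ : ℝ} {g : E3 → ℝ} (F : ℝ) (hg : DiffSym ν₀ g) (N T : ℝ) (a₀ : H)
    (c : ℝ → H) : Prop where
  initial : c 0 = proj N a₀
  deriv : ∀ t ∈ Icc 0 T, HasDerivWithinAt c (field F hg N (c t)) (Icc 0 T) t
  herm : ∀ t ∈ Icc 0 T, hermOp (c t) = c t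
  band : ∀ t ∈ Icc 0 T, proj N (c t) = c t

/-- The truncated field is locally Lipschitz and preserves the Hermitian band-limited functions, a
closed real subspace. Energy conservation holds only for such functions, so the dissipative
existence theorem is applied inside that subspace. -/
theorem exists_isApprox {ν₀ : ℝ} (hν₀ : 0 < ν₀) {g : E3 → ℝ} (F : ℝ) (hg : DiffSym ν₀ g) (N : ℝ)
    {T : ℝ} (hT : 0 ≤ T) {a₀ : H} (ha₀ : hermOp a₀ = a₀) :
    ∃ c, IsApprox F hg N T a₀ c := by
  have : CompleteSpace (bandSpace N) := (isClosed_bandSpace N).completeSpace_coe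
  have hmem : ∀ a ∈ bandSpace N, field F hg N a ∈ bandSpace N := by
    rintro a ⟨h1, h2⟩
    refine ⟨?_, ?_⟩
    · rw [field, map_sub, hermOp_mulOp _ (cut_even hg.even), h1, hermOp_bilOp F N h1]
    · rw [field, map_sub, proj_mulOp_cut, proj_bilOp]
  set f : bandSpace N → bandSpace N := fun a => ⟨field F hg N a, hmem a a.2⟩ with hf
  have hlip : ∀ M : ℝ, ∃ L : NNReal, LipschitzOnWith L f (Metric.closedBall 0 M) := by
    intro M
    set B := ‖mulOp (cut N g) (hg.bsym N)‖ + ‖bilOp F N‖ * (2 * |M|) with hB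
    have hB0 : 0 ≤ B := by positivity
    refine ⟨Real.toNNReal B, LipschitzOnWith.of_dist_le_mul fun a ha b hb => ?_⟩
    rw [mem_closedBall_zero_iff] at ha hb
    have ha' : ‖(a : H)‖ ≤ |M| := ha.trans (le_abs_self M)
    have hb' : ‖(b : H)‖ ≤ |M| := hb.trans (le_abs_self M)
    rw [Real.coe_toNNReal _ hB0, dist_eq_norm, dist_eq_norm]
    change ‖field F hg N a - field F hg N b‖ ≤ B * ‖(a : H) - b‖
    have e : field F hg N a - field F hg N b = mulOp (cut N g) (hg.bsym N) ((a : H) - b) -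
        (bilOp F N ((a : H) - b) a + bilOp F N b ((a : H) - b)) := by
      simp only [field, map_sub, sub_apply]
      abel
    rw [e]
    calc _ ≤ ‖mulOp (cut N g) (hg.bsym N) ((a : H) - b)‖ +
          (‖bilOp F N ((a : H) - b) a‖ + ‖bilOp F N b ((a : H) - b)‖) :=
          (norm_sub_le _ _).trans (add_le_add le_rfl (norm_add_le _ _))
      _ ≤ ‖mulOp (cut N g) (hg.bsym N)‖ * ‖(a : H) - b‖ +
          (‖bilOp F N‖ * ‖(a : H) - b‖ * |M| + ‖bilOp F N‖ * |M| * ‖(a : H) - b‖) := by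
          gcongr
          · exact ContinuousLinearMap.le_opNorm _ _
          · exact (ContinuousLinearMap.le_opNorm₂ _ _ _).trans (by gcongr)
          · exact (ContinuousLinearMap.le_opNorm₂ _ _ _).trans (by gcongr)
      _ = _ := by rw [hB]; ring
  have hdiss : ∀ a : bandSpace N, inner ℝ a (f a) ≤ 0 := by
    rintro ⟨a, h1, h2⟩
    change inner ℝ a (field F hg N a) ≤ 0
    rw [field, inner_sub_right, inner_bilOp_self h1 h2, sub_zero]
    have h3 : mulOp _ (bsym_cut_one N) a = a := h2
    have h4 := inner_mulOp_mulOp_nonpos (bsym_cut_one N) (cut_nonneg fun _ => zero_le_one)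
      (bsym_cut (N := N) (m := fun ξ => absD ξ ^ 2) (C := N ^ 2) (by fun_prop) (fun ξ h => by
        rw [abs_of_nonneg (by positivity)]; have := absD_nonneg ξ; gcongr) |> fun h => by
          convert h using 2 with ξ
          by_cases hξ : absD ξ < N
          · rw [cut_of_lt hξ, cut_of_lt hξ, one_mul]
          · rw [cut_of_not_lt hξ, cut_of_not_lt hξ, zero_mul]) hg h2
    rw [h3] at h4
    refine h4.trans ?_
    have := rq_nonneg (fun ξ => cut N (fun _ => 1) ξ * absD ξ ^ 2) a
    nlinarith
  have hu₀ : proj N a₀ ∈ bandSpace N :=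
    ⟨by rw [hermOp_proj, ha₀], proj_proj le_rfl a₀⟩
  obtain ⟨u, hu0, hu⟩ := exists_solution_of_inner_nonpos f hlip hdiss ⟨_, hu₀⟩ T hT
  refine ⟨fun t => (u t : H), ?_, ?_, fun t _ => (u t).2.1, fun t _ => (u t).2.2⟩
  · rw [hu0]
  · intro t ht
    exact (bandSpace N).subtypeL.hasFDerivAt.comp_hasDerivWithinAt t (hu t ht)

/-! ### Energy estimates for the truncated solutions -/

theorem bsym_cut_of_continuous {m : E3 → ℝ} (hm : Continuous m) (N : ℝ) : BSym (cut N m) := by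
  have hK : IsCompact (Metric.closedBall (0 : E3) N) := isCompact_closedBall 0 N
  obtain ⟨C, hC⟩ := hK.exists_bound_of_continuousOn hm.continuousOn
  refine bsym_cut (C := C) hm.measurable fun ξ h => hC ξ ?_
  rw [mem_closedBall_zero_iff]
  have : 1 ≤ 2 * Real.pi := by linarith [Real.pi_gt_three]
  unfold absD at h
  nlinarith [norm_nonneg ξ]

theorem cut_mul_eq (N : ℝ) (m p : E3 → ℝ) :
    (fun ξ => cut N m ξ * p ξ) = cut N fun ξ => m ξ * p ξ := by
  ext ξ
  by_cases h : absD ξ < N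
  · rw [cut_of_lt h, cut_of_lt h]
  · rw [cut_of_not_lt h, cut_of_not_lt h, zero_mul]

@[fun_prop]
theorem continuous_sobW (s : ℝ) : Continuous (sobW s) := by
  unfold sobW
  exact Continuous.rpow_const (by fun_prop) fun ξ => Or.inl (by positivity)

/-- The weight `|D|² (1 + |D|²)^s`. -/
def gradW (s : ℝ) (ξ : E3) : ℝ := sobW s ξ * absD ξ ^ 2

theorem gradW_nonneg (s : ℝ) (ξ : E3) : 0 ≤ gradW s ξ := by
  have := sobW_pos s ξ
  unfold gradW; positivity

@[fun_prop]
theorem continuous_gradW (s : ℝ) : Continuous (gradW s) := by unfold gradW; fun_prop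

/-- The weight of the energy combined with the potential enstrophy. -/
def enstW (F : ℝ) (ξ : E3) : ℝ := 1 + ‖rho F ξ‖ ^ 2

theorem enstW_nonneg (F : ℝ) (ξ : E3) : 0 ≤ enstW F ξ := by unfold enstW; positivity

@[fun_prop]
theorem continuous_enstW (F : ℝ) : Continuous (enstW F) := by unfold enstW; fun_prop

/-- The dissipation of `enstW`. -/
def enstGradW (F : ℝ) (ξ : E3) : ℝ := enstW F ξ * absD ξ ^ 2

theorem enstGradW_nonneg (F : ℝ) (ξ : E3) : 0 ≤ enstGradW F ξ := by
  have := enstW_nonneg F ξ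
  unfold enstGradW; positivity

@[fun_prop]
theorem continuous_enstGradW (F : ℝ) : Continuous (enstGradW F) := by unfold enstGradW; fun_prop

theorem qf_lt_top_of_proj {m : E3 → ℝ} (hm : Continuous m) {N : ℝ} {a : H} (ha : proj N a = a) :
    qf m a < ∞ := by
  rw [← qf_cut_eq ha]
  exact qf_lt_top (bsym_cut_of_continuous hm N) a

theorem ofReal_rq_of_proj {m : E3 → ℝ} (hm : Continuous m) {N : ℝ} {a : H} (ha : proj N a = a) :
    ENNReal.ofReal (rq m a) = qf m a :=
  ENNReal.ofReal_toReal (qf_lt_top_of_proj hm ha).ne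

theorem qf_le_add {w w₁ w₂ : E3 → ℝ} {α β : ℝ} (hα : 0 ≤ α) (hβ : 0 ≤ β) (h₁ : Measurable w₁)
    (h₁0 : ∀ ξ, 0 ≤ w₁ ξ) (h₂ : Measurable w₂) (h₂0 : ∀ ξ, 0 ≤ w₂ ξ)
    (h : ∀ ξ, w ξ ≤ α * w₁ ξ + β * w₂ ξ) {a : E3 → ℂ} (ha : Measurable a) :
    qf w a ≤ ENNReal.ofReal α * qf w₁ a + ENNReal.ofReal β * qf w₂ a := by
  unfold qf
  rw [← lintegral_const_mul _ (by fun_prop), ← lintegral_const_mul _ (by fun_prop),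
    ← lintegral_add_left (by fun_prop)]
  refine lintegral_mono fun ξ => ?_
  calc ENNReal.ofReal (w ξ) * ‖a ξ‖ₑ ^ 2
      ≤ ENNReal.ofReal (α * w₁ ξ + β * w₂ ξ) * ‖a ξ‖ₑ ^ 2 := by gcongr; exact h ξ
    _ = _ := by
      rw [ENNReal.ofReal_add (mul_nonneg hα (h₁0 ξ)) (mul_nonneg hβ (h₂0 ξ)),
        ENNReal.ofReal_mul hα, ENNReal.ofReal_mul hβ]
      ring

theorem qf_le_mul {w w₁ : E3 → ℝ} {α : ℝ} (hα : 0 ≤ α) (h₁ : Measurable w₁)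
    (h : ∀ ξ, w ξ ≤ α * w₁ ξ) {a : E3 → ℂ} (ha : Measurable a) :
    qf w a ≤ ENNReal.ofReal α * qf w₁ a := by
  unfold qf
  rw [← lintegral_const_mul _ (by fun_prop)]
  refine lintegral_mono fun ξ => ?_
  rw [← mul_assoc, ← ENNReal.ofReal_mul hα]
  gcongr
  exact h ξ

theorem rq_le_add {w w₁ w₂ : E3 → ℝ} {α β N : ℝ} (hα : 0 ≤ α) (hβ : 0 ≤ β) (h₁ : Continuous w₁)
    (h₁0 : ∀ ξ, 0 ≤ w₁ ξ) (h₂ : Continuous w₂) (h₂0 : ∀ ξ, 0 ≤ w₂ ξ)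
    (h : ∀ ξ, w ξ ≤ α * w₁ ξ + β * w₂ ξ) {a : H} (ha : proj N a = a) :
    rq w a ≤ α * rq w₁ a + β * rq w₂ a := by
  have h1 := qf_le_add hα hβ h₁.measurable h₁0 h₂.measurable h₂0 h (measurable_coe a)
  rw [← ofReal_rq_of_proj h₁ ha, ← ofReal_rq_of_proj h₂ ha, ← ENNReal.ofReal_mul hα,
    ← ENNReal.ofReal_mul hβ, ← ENNReal.ofReal_add (mul_nonneg hα (rq_nonneg _ _))
      (mul_nonneg hβ (rq_nonneg _ _))] at h1
  exact ENNReal.toReal_le_of_le_ofReal (add_nonneg (mul_nonneg hα (rq_nonneg _ _))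
      (mul_nonneg hβ (rq_nonneg _ _))) h1

theorem rq_le_mul {w w₁ : E3 → ℝ} {α N : ℝ} (hα : 0 ≤ α) (h₁ : Continuous w₁)
    (h : ∀ ξ, w ξ ≤ α * w₁ ξ) {a : H} (ha : proj N a = a) :
    rq w a ≤ α * rq w₁ a := by
  have h1 := qf_le_mul hα h₁.measurable h (measurable_coe a)
  rw [← ofReal_rq_of_proj h₁ ha, ← ENNReal.ofReal_mul hα] at h1
  exact ENNReal.toReal_le_of_le_ofReal (mul_nonneg hα (rq_nonneg _ _)) h1

section

variable {ν₀ : ℝ} {g : E3 → ℝ} {F : ℝ} {hg : DiffSym ν₀ g} {N T : ℝ} {a₀ : H} {c : ℝ → H}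

theorem IsApprox.continuousOn (hc : IsApprox F hg N T a₀ c) : ContinuousOn c (Icc 0 T) :=
  fun t ht => (hc.deriv t ht).continuousWithinAt

theorem IsApprox.continuousOn_rq (hc : IsApprox F hg N T a₀ c) {m : E3 → ℝ} (hm : Continuous m)
    (hm0 : ∀ ξ, 0 ≤ m ξ) : ContinuousOn (fun t => rq m (c t)) (Icc 0 T) := by
  refine (QuasiGeo.continuousOn_rq (bsym_cut_of_continuous hm N) (cut_nonneg hm0)
    hc.continuousOn).congr fun t ht => ?_
  exact (rq_cut_eq (hc.band t ht)).symm

theorem IsApprox.hasDerivWithinAt_rq (hc : IsApprox F hg N T a₀ c) {m : E3 → ℝ}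
    (hm : Continuous m) (hm0 : ∀ ξ, 0 ≤ m ξ) {t : ℝ} (ht : t ∈ Icc 0 T) :
    HasDerivWithinAt (fun t => rq m (c t))
      (2 * inner ℝ (mulOp _ (bsym_cut_of_continuous hm N) (c t)) (field F hg N (c t)))
      (Icc 0 T) t := by
  refine (QuasiGeo.hasDerivWithinAt_rq (bsym_cut_of_continuous hm N) (cut_nonneg hm0)
    (hc.deriv t ht)).congr (fun t ht => ?_) ?_
  · exact (rq_cut_eq (hc.band t ht)).symm
  · exact (rq_cut_eq (hc.band t ht)).symm

/-- Decay of energy and potential enstrophy. -/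
theorem IsApprox.enstrophy_le (hν₀ : 0 < ν₀) (hN : 0 ≤ N) (hc : IsApprox F hg N T a₀ c) {t₀ t : ℝ}
    (ht₀ : 0 ≤ t₀) (h0 : t₀ ≤ t) (ht : t ≤ T) :
    rq (enstW F) (c t) + 2 * ν₀ * ∫ τ in t₀..t, rq (enstGradW F) (c τ) ≤ rq (enstW F) (c t₀) := by
  have hsub : Icc t₀ T ⊆ Icc 0 T := Icc_subset_Icc_left ht₀
  have h := gronwall_add_integral_le (y := fun t => rq (enstW F) (c t))
    (z := fun t => 2 * ν₀ * rq (enstGradW F) (c t)) (k := fun _ => 0) (a := t₀) (b := T)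
    (fun t ht => (hc.hasDerivWithinAt_rq (continuous_enstW F) (enstW_nonneg F) (hsub ht)).mono hsub)
    ((continuousOn_const.mul (hc.continuousOn_rq (continuous_enstGradW F)
      (enstGradW_nonneg F))).mono hsub)
    continuousOn_const (fun t _ => mul_nonneg (by positivity) (rq_nonneg _ _))
    (fun t _ => le_rfl) ?_ (t := t) ⟨h0, ht⟩
  · rw [intervalIntegral.integral_const_mul] at h
    simpa using h
  · intro t ht
    have hb := hc.band t (hsub ht)
    have hh := hc.herm t (hsub ht)
    have hrho : Continuous fun ξ => ‖rho F ξ‖ ^ 2 := by fun_prop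
    -- The weight `1 + |ρ|²` splits into energy and potential enstrophy, and the nonlinearity
    -- contributes nothing to either. No Grönwall growth appears.
    have e1 : mulOp _ (bsym_cut_of_continuous (continuous_enstW F) N) (c t) =
        c t + mulOp _ (bsym_cut_of_continuous hrho N) (c t) := by
      ext1
      filter_upwards [mulOp_coe _ (bsym_cut_of_continuous (continuous_enstW F) N) (c t),
        mulOp_coe _ (bsym_cut_of_continuous hrho N) (c t), bandRep_ae_eq hb,
        Lp.coeFn_add (c t) (mulOp _ (bsym_cut_of_continuous hrho N) (c t))] with ξ h1 h2 h3 h4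
      rw [h4, Pi.add_apply, h1, h2]
      by_cases h : absD ξ < N
      · rw [cut_of_lt h, cut_of_lt h, enstW]; push_cast; ring
      · rw [← h3, bandRep, if_neg h]; simp
    have e2 : inner ℝ (mulOp _ (bsym_cut_of_continuous (continuous_enstW F) N) (c t))
        (bilOp F N (c t) (c t)) = 0 := by
      rw [e1, inner_add_left, inner_bilOp_self hh hb, inner_mulOp_rho_bilOp_self hN _ hh hb,
        add_zero]
    have hwD : BSym fun ξ => cut N (enstW F) ξ * absD ξ ^ 2 := by
      rw [cut_mul_eq]
      exact bsym_cut_of_continuous (continuous_enstGradW F) N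
    have h3 := inner_mulOp_mulOp_nonpos (bsym_cut_of_continuous (continuous_enstW F) N)
      (cut_nonneg (enstW_nonneg F)) hwD hg hb
    have e3 : rq (fun ξ => cut N (enstW F) ξ * absD ξ ^ 2) (c t) = rq (enstGradW F) (c t) := by
      rw [cut_mul_eq, rq_cut_eq hb]; rfl
    rw [e3] at h3
    rw [field, inner_sub_right, e2, sub_zero, zero_mul]
    linarith

/-- The energy estimate in `H^s`. -/
theorem IsApprox.deriv_sob_le (hν₀ : 0 < ν₀) (hc : IsApprox F hg N T a₀ c) {s : ℝ} (hs : 0 ≤ s)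
    {t A : ℝ} (ht : t ∈ Icc 0 T) (hA : 0 ≤ A) (hcA : oneNorm (c t) ^ 2 ≤ ENNReal.ofReal A) :
    2 * inner ℝ (mulOp _ (bsym_cut_of_continuous (continuous_sobW s) N) (c t))
      (field F hg N (c t)) + ν₀ * rq (gradW s) (c t) ≤
      4 * 4 ^ s / ν₀ * A * rq (sobW s) (c t) := by
  have hb := hc.band t ht
  have hm := measurable_coe (c t)
  have hwD : BSym fun ξ => cut N (sobW s) ξ * absD ξ ^ 2 := by
    rw [cut_mul_eq]
    exact bsym_cut_of_continuous (continuous_gradW s) N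
  have e3 : rq (fun ξ => cut N (sobW s) ξ * absD ξ ^ 2) (c t) = rq (gradW s) (c t) := by
    rw [cut_mul_eq, rq_cut_eq hb]; rfl
  set f := lconv (fun η => ‖c t η‖ₑ) (fun η => ‖c t η‖ₑ) with hf
  have h := two_mul_inner_mulOp_le (w := cut N (sobW s)) (g := g) (a := c t)
    (v := field F hg N (c t)) (G := fun ξ => -bil F (c t) (c t) ξ) (f := f)
    (Φ := 4 * 4 ^ s * A * rq (sobW s) (c t)) hν₀
    (bsym_cut_of_continuous (continuous_sobW s) N) (cut_nonneg fun ξ => (sobW_pos s ξ).le)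
    hwD hg.le (measurable_lconv (by fun_prop) (by fun_prop)) ?_ ?_
    (by have := rq_nonneg (sobW s) (c t); positivity) ?_
  · rw [e3] at h
    have e : 4 * 4 ^ s / ν₀ * A * rq (sobW s) (c t) = 4 * 4 ^ s * A * rq (sobW s) (c t) / ν₀ := by
      ring
    rw [e]
    linarith
  · filter_upwards [field_coe F hg N (c t)] with ξ h1 hw
    have hN : absD ξ < N := by
      by_contra h2
      exact hw (cut_of_not_lt h2)
    rw [h1, if_pos hN, sub_eq_add_neg]
  · refine Eventually.of_forall fun ξ _ => ?_
    rw [enorm_neg]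
    exact enorm_bil_le F hm hm ξ
  -- At threshold `R = 0` the tail weight is the whole weight. Both factors of the convolution being
  -- `c t`, the two terms of the tame estimate coincide, which gives the constant `4 · 4^s`.
  · have h1 := lintegral_weight_sq_lconv_le (f := fun η => ‖c t η‖ₑ) (g := fun η => ‖c t η‖ₑ)
      (w := fun ξ => ENNReal.ofReal (tailW s 0 ξ)) (w' := fun ξ => ENNReal.ofReal (tailW s (0 / 2) ξ))
      (by fun_prop) (by fun_prop) (by fun_prop) (ofReal_tailW_le_add hs 0)
    simp only [zero_div, tailW_zero] at h1
    change _ ≤ 2 * ENNReal.ofReal (4 ^ s) * (oneNorm (c t) ^ 2 * qf (sobW s) (c t) +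
      oneNorm (c t) ^ 2 * qf (sobW s) (c t)) at h1
    calc ∫⁻ ξ, ENNReal.ofReal (cut N (sobW s) ξ) * f ξ ^ 2
        ≤ ∫⁻ ξ, ENNReal.ofReal (sobW s ξ) * f ξ ^ 2 := by
          refine lintegral_mono fun ξ => ?_
          gcongr
          exact cut_le (fun ξ => (sobW_pos s ξ).le) ξ
      _ ≤ _ := h1
      _ = 4 * ENNReal.ofReal (4 ^ s) * (oneNorm (c t) ^ 2 * qf (sobW s) (c t)) := by ring
      _ ≤ 4 * ENNReal.ofReal (4 ^ s) * (ENNReal.ofReal A * qf (sobW s) (c t)) := by gcongr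
      _ = _ := by
        rw [← ofReal_rq_of_proj (continuous_sobW s) hb, ← ENNReal.ofReal_mul hA,
          show (4 : ℝ≥0∞) = ENNReal.ofReal 4 by simp, ← ENNReal.ofReal_mul (by norm_num),
          ← ENNReal.ofReal_mul (by positivity)]
        congr 1; ring

end

end QuasiGeo
end

noncomputable section

namespace QuasiGeo

/-! ### Uniform bounds for the truncated solutions -/

theorem sobW_one (ξ : E3) : sobW 1 ξ = 1 + absD ξ ^ 2 := by rw [sobW, Real.rpow_one]

theorem sobW_mono {s s' : ℝ} (h : s ≤ s') (ξ : E3) : sobW s ξ ≤ sobW s' ξ :=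
  Real.rpow_le_rpow_of_exponent_le (by nlinarith [sq_nonneg (absD ξ)]) h

theorem enstW_le (F : ℝ) (ξ : E3) : enstW F ξ ≤ (1 + |F|) ^ 2 * sobW 1 ξ := by
  have h1 := norm_rho_le F ξ
  have h2 : ‖rho F ξ‖ ^ 2 ≤ ((1 + |F|) * absD ξ) ^ 2 := by gcongr
  rw [enstW, sobW_one]
  have h3 : 1 ≤ (1 + |F|) ^ 2 := one_le_pow₀ (by linarith [abs_nonneg F])
  nlinarith

/-- Positivity of `F` makes `ρ` control the vertical frequency too: `|ρ|² ≥ min(1, F²) |ξ|²`. Thus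
energy and enstrophy together dominate the H¹ norm. -/
theorem exists_sobW_one_le_enstW {F : ℝ} (hF : 0 < F) :
    ∃ C : ℝ, 0 < C ∧ ∀ ξ, sobW 1 ξ ≤ C * enstW F ξ := by
  set μ := min 1 (F ^ 2) with hμ
  have hμ0 : 0 < μ := by rw [hμ]; positivity
  refine ⟨1 + (2 * Real.pi) ^ 2 / μ, by positivity, fun ξ => ?_⟩
  have h1 : μ * ‖ξ‖ ^ 2 ≤ ‖rho F ξ‖ ^ 2 := by
    rw [norm_sq_rho, norm_sq_E3]
    have h2 : μ ≤ 1 := min_le_left _ _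
    have h3 : μ ≤ F ^ 2 := min_le_right _ _
    nlinarith [sq_nonneg (ξ 0), sq_nonneg (ξ 1), sq_nonneg (ξ 2),
      mul_nonneg (sub_nonneg.2 h2) (sq_nonneg (ξ 0)), mul_nonneg (sub_nonneg.2 h2) (sq_nonneg (ξ 1)),
      mul_nonneg (sub_nonneg.2 h3) (sq_nonneg (ξ 2))]
  have h4 : absD ξ ^ 2 ≤ (2 * Real.pi) ^ 2 / μ * ‖rho F ξ‖ ^ 2 := by
    rw [absD, mul_pow, div_mul_eq_mul_div, le_div_iff₀ hμ0]
    calc (2 * Real.pi) ^ 2 * ‖ξ‖ ^ 2 * μ = (2 * Real.pi) ^ 2 * (μ * ‖ξ‖ ^ 2) := by ring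
      _ ≤ _ := by gcongr
  rw [sobW_one, enstW]
  have h5 : 0 < (2 * Real.pi) ^ 2 / μ := by positivity
  nlinarith [sq_nonneg ‖rho F ξ‖]

theorem absD_rpow_le_sobW {δ : ℝ} (hδ : 0 < δ) (ξ : E3) :
    absD ξ ^ (1 + 2 * δ) ≤ sobW (1 / 2 + δ) ξ := by
  have h : absD ξ ^ (1 + 2 * δ) = (absD ξ ^ 2) ^ (1 / 2 + δ) := by
    rw [← Real.rpow_natCast, ← Real.rpow_mul (absD_nonneg ξ)]
    congr 1; push_cast; ring
  rw [h, sobW]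
  exact Real.rpow_le_rpow (sq_nonneg _) (by linarith) (by linarith)

/-- Interpolation of H¹ between H^(1/2+δ) and its dissipation at scale `R`. With `u = (1 +
|D|²)^(1/2)`, the inequality `2u ≤ R + u²/R` is multiplied by `u ≤ (1 + |D|²)^(1/2+δ)`. -/
theorem sobW_one_le_add {δ R : ℝ} (hδ : 0 < δ) (hR : 1 ≤ R) (ξ : E3) :
    sobW 1 ξ ≤ 2 * R * sobW (1 / 2 + δ) ξ + 2 * R⁻¹ * gradW (1 / 2 + δ) ξ := by
  set u := sobW (1 / 2) ξ with hu
  have hu2 : u ^ 2 = 1 + absD ξ ^ 2 := by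
    rw [hu, sobW, ← Real.rpow_natCast, ← Real.rpow_mul (by positivity)]
    norm_num
  have hu0 : 0 < u := sobW_pos _ _
  have hu1 : 1 ≤ u := by nlinarith [sq_nonneg (absD ξ)]
  have hus : u ≤ sobW (1 / 2 + δ) ξ := sobW_mono (by linarith) ξ
  have hR0 : 0 < R := by linarith
  have hx : absD ξ ^ 2 = u ^ 2 - 1 := by linarith
  have key : u ≤ 2 * R + 2 * R⁻¹ * (u ^ 2 - 1) := by
    have h1 : 0 ≤ R⁻¹ * (R - u) ^ 2 := by positivity
    have h2 : R⁻¹ * (R - u) ^ 2 = R - 2 * u + R⁻¹ * u ^ 2 := by field_simp; ring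
    have h3 : R⁻¹ ≤ 1 := inv_le_one_of_one_le₀ hR
    nlinarith
  rw [sobW_one, ← hu2, gradW, hx]
  calc u ^ 2 = u * u := sq u
    _ ≤ (2 * R + 2 * R⁻¹ * (u ^ 2 - 1)) * u := by gcongr
    _ ≤ (2 * R + 2 * R⁻¹ * (u ^ 2 - 1)) * sobW (1 / 2 + δ) ξ := by
        have h5 : 0 ≤ 2 * R + 2 * R⁻¹ * (u ^ 2 - 1) := hu0.le.trans key
        gcongr
    _ = _ := by ring

theorem rq_proj_le {m : E3 → ℝ} (N : ℝ) {a : H} (ha : qf m a < ∞) : rq m (proj N a) ≤ rq m a :=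
  ENNReal.toReal_mono ha.ne (qf_proj_le N m a)

theorem exists_mul_le_integral {z : ℝ → ℝ} {T : ℝ} (hT : 0 ≤ T) (hz : ContinuousOn z (Icc 0 T)) :
    ∃ t ∈ Icc 0 T, z t * T ≤ ∫ τ in (0 : ℝ)..T, z τ := by
  obtain ⟨t, ht, hmin⟩ := isCompact_Icc.exists_isMinOn (nonempty_Icc.2 hT) hz
  refine ⟨t, ht, ?_⟩
  have h := intervalIntegral.integral_mono_on (μ := volume) (f := fun _ => z t) (g := z) hT
    intervalIntegrable_const (hz.intervalIntegrable_of_Icc hT) fun x hx => hmin hx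
  simpa [mul_comm] using h

/-- A continuity argument for a differential inequality that is only available while `y ≤ 4 Y`. -/
theorem add_integral_le_two_mul_of_bootstrap {y D z : ℝ → ℝ} {T μ κ Y y₀ : ℝ}
    (hyd : ∀ t ∈ Icc 0 T, HasDerivWithinAt y (D t) (Icc 0 T) t) (hzc : ContinuousOn z (Icc 0 T))
    (hyn : ∀ t, 0 ≤ y t) (hzn : ∀ t, 0 ≤ z t) (hμ : 0 ≤ μ) (hY : 0 < Y) (hy0 : y 0 ≤ y₀) (hy₀Y : y₀ ≤ Y) (hκ : 0 < κ)
    (hκT : κ * T ≤ 1) (hdiff : ∀ t ∈ Icc 0 T, y t ≤ 4 * Y → D t + μ * z t ≤ κ / 2 * y t)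
    {t : ℝ} (ht : t ∈ Icc 0 T) : y t + μ * ∫ τ in (0 : ℝ)..t, z τ ≤ 2 * y₀ := by
  have hexp : ∀ t ≤ T, Real.exp (κ * t) ≤ 4 := fun t ht => by
    have h3 : κ * t ≤ 1 := le_trans (by gcongr) hκT
    exact (Real.exp_le_exp.2 h3).trans (by linarith [Real.exp_one_lt_d9])
  have hboot : ∀ t ∈ Icc 0 T, y t ≤ 4 * Y := by
    -- The barrier `Y exp(κt)` stays below `4Y` as `κT ≤ 1`, and it grows at rate `κ`, twice what
    -- the differential inequality allows for `y`. At a contact point the inequality is available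
    -- and strict, so `y` cannot cross.
    have hbar := image_le_of_deriv_right_lt_deriv_boundary' (f := y) (f' := D) (a := 0) (b := T)
      (B := fun t => Y * Real.exp (κ * t))
      (B' := fun t => Y * (Real.exp (κ * t) * κ))
      (fun t ht => (hyd t ht).continuousWithinAt)
      (fun t ht => by
        have h3 := hyd t ⟨ht.1, ht.2.le⟩
        refine h3.mono_of_mem_nhdsWithin ?_
        exact mem_of_superset (Icc_mem_nhdsGE ht.2) (Icc_subset_Icc_left ht.1))
      (by simp only [mul_zero, Real.exp_zero, mul_one]; exact hy0.trans hy₀Y)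
      (by fun_prop)
      (fun t _ => by
        have h3 : HasDerivAt (fun t : ℝ => κ * t) κ t := by
          simpa using (hasDerivAt_id t).const_mul κ
        exact ((h3.exp).const_mul Y).hasDerivWithinAt)
      ?_
    · intro t ht
      refine (hbar ht).trans ?_
      have h4 := hexp t ht.2
      nlinarith
    · intro t ht hyB
      have h4 := hexp t ht.2.le
      have h5 : y t ≤ 4 * Y := by rw [hyB]; nlinarith
      have h6 := hdiff t ⟨ht.1, ht.2.le⟩ h5
      have h10 : Y * (Real.exp (κ * t) * κ) = κ * y t := by rw [hyB]; ring
      rw [h10]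
      have h11 : 0 < κ * y t := by rw [hyB]; positivity
      have h12 : 0 ≤ μ * z t := mul_nonneg hμ (hzn t)
      linarith
  have h3 := gronwall_add_integral_le (y := y) (y' := D) (z := fun t => μ * z t)
    (k := fun _ => κ / 2) hyd (continuousOn_const.mul hzc) continuousOn_const
    (fun t _ => mul_nonneg hμ (hzn t)) (fun t _ => by positivity)
    (fun t ht => hdiff t ht (hboot t ht)) ht
  rw [intervalIntegral.integral_const_mul] at h3
  -- Once `y ≤ 4Y` is known, Grönwall at the true rate `κ/2` gives the factor `exp(1/2)`, relative
  -- to `y₀` and no longer to `Y`. This keeps the final bound proportional to the data when they are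
  -- small.
  have h4 : Real.exp (∫ _ in (0 : ℝ)..t, κ / 2) ≤ 2 := by
    rw [intervalIntegral.integral_const, sub_zero, smul_eq_mul]
    have h5 : t * (κ / 2) ≤ 1 / 2 := by
      have : κ * t ≤ 1 := le_trans (by gcongr; exact ht.2) hκT
      linarith
    have h6 := Real.exp_le_exp.2 h5
    have h7 : Real.exp (1 / 2) ^ 2 = Real.exp 1 := by
      rw [← Real.exp_nat_mul]; norm_num
    have h8 : Real.exp (1 / 2) ≤ 2 := by
      nlinarith [Real.exp_one_lt_d9, Real.exp_pos (1 / 2)]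
    linarith
  by_cases hn : 0 ≤ y₀
  · refine h3.trans ?_
    calc y 0 * Real.exp (∫ _ in (0 : ℝ)..t, κ / 2)
        ≤ y₀ * Real.exp (∫ _ in (0 : ℝ)..t, κ / 2) := by gcongr
      _ ≤ y₀ * 2 := by gcongr
      _ = 2 * y₀ := by ring
  · exact absurd (hyn 0) (by linarith)

/-- Propagation of regularity above `H¹`. -/
theorem exists_uniform_bound_of_one_le {F ν₀ s : ℝ} (hF : 0 < F) (hν₀ : 0 < ν₀) (hs : 1 ≤ s)
    {g : E3 → ℝ} (hg : DiffSym ν₀ g) {a₀ : H} (ha₀ : qf (sobW s) a₀ < ∞) :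
    ∃ M : ℝ, ∀ N T : ℝ, 0 ≤ N → 1 ≤ T → ∀ c, IsApprox F hg N T a₀ c → ∀ t ∈ Icc 0 T,
      rq (sobW s) (c t) + ν₀ * ∫ τ in (0 : ℝ)..t, rq (gradW s) (c τ) ≤ M := by
  -- For `δ = 1/2` and `R = 1` the weight is `|D|²(1 + |D|²)`, the dissipation of energy plus
  -- enstrophy. The squared L¹ norm is therefore integrable on the whole half-line, and the Grönwall
  -- factor does not depend on `N` or `T`.
  obtain ⟨C₁, hC₁, h1⟩ := exists_sq_oneNorm_le_scale (δ := 1 / 2) (by norm_num) (by norm_num)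
  obtain ⟨C₂, hC₂, h2⟩ := exists_sobW_one_le_enstW hF
  set K := 4 * 4 ^ s / ν₀ * (C₁ * C₂) with hK
  have hK0 : 0 ≤ K := by rw [hK]; positivity
  have hens : qf (enstW F) a₀ < ∞ := by
    refine lt_of_le_of_lt (qf_le_mul (α := (1 + |F|) ^ 2) (by positivity)
      (measurable_sobW s) (fun ξ => (enstW_le F ξ).trans ?_) (measurable_coe a₀))
      (ENNReal.mul_lt_top ENNReal.ofReal_lt_top ha₀)
    gcongr
    exact sobW_mono hs ξ
  refine ⟨rq (sobW s) a₀ * Real.exp (K * (rq (enstW F) a₀ / (2 * ν₀))), ?_⟩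
  intro N T hN hT c hc t ht
  have hT0 : (0 : ℝ) ≤ T := zero_le_one.trans hT
  have hkc : ContinuousOn (fun t => K * rq (enstGradW F) (c t)) (Icc 0 T) :=
    continuousOn_const.mul (hc.continuousOn_rq (continuous_enstGradW F) (enstGradW_nonneg F))
  have h := gronwall_add_integral_le (y := fun t => rq (sobW s) (c t))
    (z := fun t => ν₀ * rq (gradW s) (c t)) (k := fun t => K * rq (enstGradW F) (c t))
    (fun t ht => hc.hasDerivWithinAt_rq (continuous_sobW s) (fun ξ => (sobW_pos s ξ).le) ht)
    (continuousOn_const.mul (hc.continuousOn_rq (continuous_gradW s) (gradW_nonneg s)))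
    hkc (fun t _ => mul_nonneg hν₀.le (rq_nonneg _ _)) (fun t _ => mul_nonneg hK0 (rq_nonneg _ _))
    ?_ ht
  · rw [intervalIntegral.integral_const_mul, intervalIntegral.integral_const_mul] at h
    refine h.trans ?_
    rw [hc.initial]
    have h3 := hc.enstrophy_le hν₀ hN le_rfl ht.1 ht.2
    rw [hc.initial] at h3
    have h4 : ∫ τ in (0 : ℝ)..t, rq (enstGradW F) (c τ) ≤ rq (enstW F) a₀ / (2 * ν₀) := by
      rw [le_div_iff₀ (by positivity)]
      have := rq_nonneg (enstW F) (c t)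
      have := rq_proj_le N hens
      linarith
    have h5 := rq_nonneg (sobW s) a₀
    gcongr
    exact rq_proj_le N ha₀
  · intro t ht
    have hb := hc.band t ht
    have h3 : oneNorm (c t) ^ 2 ≤ ENNReal.ofReal (C₁ * (C₂ * rq (enstGradW F) (c t))) := by
      refine (h1 1 one_pos (c t) (measurable_coe _)).trans ?_
      rw [ENNReal.ofReal_mul hC₁.le, ENNReal.ofReal_mul hC₂.le,
        ofReal_rq_of_proj (continuous_enstGradW F) hb]
      gcongr
      refine qf_le_mul hC₂.le (continuous_enstGradW F).measurable (fun ξ => ?_) (measurable_coe _)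
      have h6 := h2 ξ
      rw [sobW_one] at h6
      norm_num
      rw [enstGradW]
      nlinarith [mul_le_mul_of_nonneg_right h6 (sq_nonneg (absD ξ))]
    have h4 := hc.deriv_sob_le hν₀ (zero_le_one.trans hs) ht
      (by have := rq_nonneg (enstGradW F) (c t); positivity) h3
    refine h4.trans (le_of_eq ?_)
    rw [hK]; ring

set_option maxHeartbeats 1000000 in
/-- Uniform bounds in `H^{1/2 + δ}` for `δ ≤ 1/2`, with the explicit dependence on the data. -/
theorem exists_uniform_bound_of_le_half {F ν₀ δ : ℝ} (hF : 0 < F) (hν₀ : 0 < ν₀) (hδ : 0 < δ)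
    (hδ2 : δ ≤ 1 / 2) :
    ∃ C : ℝ, 0 < C ∧ ∀ {g : E3 → ℝ} (hg : DiffSym ν₀ g) {a₀ : H},
      qf (sobW (1 / 2 + δ)) a₀ < ∞ →
      ∀ N T : ℝ, 0 ≤ N → 1 ≤ T → ∀ c, IsApprox F hg N T a₀ c → ∀ t ∈ Icc 0 T,
      rq (sobW (1 / 2 + δ)) (c t) + ν₀ * ∫ τ in (0 : ℝ)..t, rq (gradW (1 / 2 + δ)) (c τ) ≤
        C * (rq (sobW (1 / 2 + δ)) a₀ *
          max 1 (rq (sobW (1 / 2 + δ)) a₀) ^ (1 / (2 * δ))) := by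
  obtain ⟨C₁, hC₁, h1⟩ := exists_sq_oneNorm_le_scale hδ (by linarith)
  obtain ⟨C₂, hC₂, h2⟩ := exists_sobW_one_le_enstW hF
  set s := 1 / 2 + δ with hs
  have hs0 : 0 ≤ s := by linarith
  have hs1 : s ≤ 1 := by linarith
  set K := 4 * 4 ^ s / ν₀ * C₁ with hK
  have hK0 : 0 < K := by rw [hK]; positivity
  -- The value `8K/ν₀` yields `K R^(-2δ) ≤ ν₀/(8Y)` when `R^(2δ) = L Y`; the added 1 ensures `R ≥
  -- 1`.
  set L := 8 * K / ν₀ + 1 with hL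
  have hL0 : 0 < L := by rw [hL]; positivity
  set C₃ := 2 * (1 + |F|) ^ 2 * (2 + 4 * (ν₀ + 1) / ν₀) with hC₃
  have hC₃0 : 0 < C₃ := by rw [hC₃]; positivity
  refine ⟨(6 + 2 * (C₂ * C₃)) * L ^ (1 / (2 * δ)), by positivity, ?_⟩
  intro g hg a₀ ha₀ N T hN hT c hc t ht
  set y₀ := rq (sobW s) a₀ with hy₀
  have hy₀0 : 0 ≤ y₀ := rq_nonneg _ _
  set Y := max 1 y₀ with hY
  have hY1 : 1 ≤ Y := le_max_left _ _
  have hY0 : 0 < Y := by linarith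
  set R := (L * Y) ^ (1 / (2 * δ)) with hR
  have hLY1 : 1 ≤ L * Y := by
    have : 1 ≤ L := by rw [hL]; have : 0 ≤ 8 * K / ν₀ := by positivity
                       linarith
    nlinarith
  have hR1 : 1 ≤ R := Real.one_le_rpow hLY1 (by positivity)
  have hR0 : 0 < R := by linarith
  have hRδ : R ^ (2 * δ) = L * Y := by
    rw [hR, ← Real.rpow_mul (by positivity)]
    rw [one_div_mul_cancel (by positivity), Real.rpow_one]
  have hRK : K * R ^ (-(2 * δ)) ≤ ν₀ / (8 * Y) := by
    rw [Real.rpow_neg hR0.le, hRδ, ← div_eq_mul_inv, div_le_div_iff₀ (by positivity) (by positivity)]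
    have e : ν₀ * (L * Y) = (8 * K + ν₀) * Y := by rw [hL]; field_simp
    rw [e]
    nlinarith [mul_pos hν₀ hY0]
  -- The parabolic time of the scale `R`. Writing `ν₀ + 1` gives at once `ν₀ R² T₁ ≤ 1` and `T₁ ≤ 1
  -- ≤ T`.
  set T₁ := 1 / ((ν₀ + 1) * R ^ 2) with hT₁
  have hT₁0 : 0 < T₁ := by rw [hT₁]; positivity
  have hT₁1 : T₁ ≤ 1 := by
    rw [hT₁, div_le_one (by positivity)]
    nlinarith [one_le_pow₀ (n := 2) hR1]
  have hνT : ν₀ * R ^ 2 * T₁ ≤ 1 := by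
    rw [hT₁, mul_one_div, div_le_one (by positivity)]
    nlinarith [sq_nonneg R]
  have hT₁T : T₁ ≤ T := hT₁1.trans hT
  have hsub : Icc 0 T₁ ⊆ Icc 0 T := Icc_subset_Icc_right hT₁T
  set y := fun t => rq (sobW s) (c t) with hy
  set z := fun t => rq (gradW s) (c t) with hz
  set D := fun t => 2 * inner ℝ (mulOp _ (bsym_cut_of_continuous (continuous_sobW s) N) (c t))
      (field F hg N (c t)) with hD
  have hyd : ∀ t ∈ Icc 0 T, HasDerivWithinAt y (D t) (Icc 0 T) t := fun t ht =>
    hc.hasDerivWithinAt_rq (continuous_sobW s) (fun ξ => (sobW_pos s ξ).le) ht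
  have hzc : ContinuousOn z (Icc 0 T) := hc.continuousOn_rq (continuous_gradW s) (gradW_nonneg s)
  have hyn : ∀ t, 0 ≤ y t := fun t => rq_nonneg _ _
  have hzn : ∀ t, 0 ≤ z t := fun t => rq_nonneg _ _
  have hy0 : y 0 ≤ y₀ := by
    simp only [hy, hc.initial]; exact rq_proj_le N ha₀
  -- The nonlinear term is at most `K R^(-2δ) (R² y + z) y`. While `y ≤ 4Y`, the choice of `R`
  -- bounds it by `ν₀/2 (R² y + z)`: half of the dissipation absorbs `z`, and linear growth at rate
  -- `ν₀R²/2` remains.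
  have hdiff : ∀ t ∈ Icc 0 T, y t ≤ 4 * Y → D t + ν₀ / 2 * z t ≤ ν₀ * R ^ 2 / 2 * y t := by
    intro t ht hyt
    have hb := hc.band t ht
    set A := C₁ * (R ^ (-(2 * δ)) * R ^ 2 * y t + R ^ (-(2 * δ)) * z t) with hA
    have hRp : 0 < R ^ (-(2 * δ)) := Real.rpow_pos_of_pos hR0 _
    have hA0 : 0 ≤ A := by have := hyn t; have := hzn t; positivity
    have h3 : oneNorm (c t) ^ 2 ≤ ENNReal.ofReal A := by
      refine (h1 R hR0 (c t) (measurable_coe _)).trans ?_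
      rw [hA, ENNReal.ofReal_mul hC₁.le,
        ENNReal.ofReal_add (by have := hyn t; positivity) (by have := hzn t; positivity),
        ENNReal.ofReal_mul (p := R ^ (-(2 * δ)) * R ^ 2) (by positivity),
        ENNReal.ofReal_mul (q := z t) hRp.le,
        ofReal_rq_of_proj (continuous_sobW s) hb, ofReal_rq_of_proj (continuous_gradW s) hb]
      gcongr
      refine qf_le_add (by positivity) hRp.le (measurable_sobW s) (fun ξ => (sobW_pos s ξ).le)
        (continuous_gradW s).measurable (gradW_nonneg s) (fun ξ => ?_) (measurable_coe _)
      have h6 := absD_rpow_le_sobW hδ ξ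
      calc R ^ (-(2 * δ)) * (absD ξ ^ (1 + 2 * δ) * (R ^ 2 + absD ξ ^ 2))
          ≤ R ^ (-(2 * δ)) * (sobW s ξ * (R ^ 2 + absD ξ ^ 2)) := by gcongr
        _ = _ := by rw [gradW]; ring
    have h4 := hc.deriv_sob_le hν₀ hs0 ht hA0 h3
    have h5 : 4 * 4 ^ s / ν₀ * A * y t ≤ ν₀ / (8 * Y) * (R ^ 2 * y t + z t) * (4 * Y) := by
      calc 4 * 4 ^ s / ν₀ * A * y t
          = (K * R ^ (-(2 * δ))) * (R ^ 2 * y t + z t) * y t := by rw [hA, hK]; ring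
        _ ≤ ν₀ / (8 * Y) * (R ^ 2 * y t + z t) * (4 * Y) := by
            have := hyn t
            have := hzn t
            gcongr
    have h6 : ν₀ / (8 * Y) * (R ^ 2 * y t + z t) * (4 * Y) = ν₀ / 2 * (R ^ 2 * y t + z t) := by
      field_simp; ring
    have h7 : D t + ν₀ * z t ≤ 4 * 4 ^ s / ν₀ * A * y t := h4
    linarith
  have hfirst : ∀ t ∈ Icc 0 T₁, y t + ν₀ / 2 * ∫ τ in (0 : ℝ)..t, z τ ≤ 2 * y₀ :=
    fun t ht => add_integral_le_two_mul_of_bootstrap (κ := ν₀ * R ^ 2) (Y := Y)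
      (fun t ht => (hyd t (hsub ht)).mono hsub) (hzc.mono hsub) hyn hzn (by positivity) hY0 hy0
      (le_max_right _ _) (by positivity) hνT (fun t ht => hdiff t (hsub ht)) ht
  -- An instant at which the dissipation is at most its mean over `[0, T₁]`, hence of order `R² y₀`.
  -- The solution is in H¹ there with an explicit norm.
  obtain ⟨t₀, ht₀, hzt₀⟩ := exists_mul_le_integral hT₁0.le (hzc.mono hsub)
  have hIz : ν₀ * ∫ τ in (0 : ℝ)..T₁, z τ ≤ 4 * y₀ := by
    have h3 := hfirst T₁ ⟨hT₁0.le, le_rfl⟩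
    have := hyn T₁
    linarith
  have hzt₀' : z t₀ ≤ 4 * (ν₀ + 1) / ν₀ * R ^ 2 * y₀ := by
    have h3 : ν₀ * (z t₀ * T₁) ≤ 4 * y₀ := le_trans (by gcongr) hIz
    have h4 : z t₀ = (ν₀ * (z t₀ * T₁)) * ((ν₀ + 1) * R ^ 2 / ν₀) := by
      rw [hT₁]; field_simp
    rw [h4]
    calc (ν₀ * (z t₀ * T₁)) * ((ν₀ + 1) * R ^ 2 / ν₀) ≤ 4 * y₀ * ((ν₀ + 1) * R ^ 2 / ν₀) := by
          gcongr
      _ = _ := by ring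
  have hyt₀ : y t₀ ≤ 2 * y₀ := by
    have h3 := hfirst t₀ ht₀
    have h4 : 0 ≤ ∫ τ in (0 : ℝ)..t₀, z τ :=
      intervalIntegral.integral_nonneg ht₀.1 fun u _ => hzn u
    have h5 : 0 ≤ ν₀ / 2 * ∫ τ in (0 : ℝ)..t₀, z τ := by positivity
    linarith
  -- Interpolating at the same scale `R` balances `R y(t₀)` against `R⁻¹ z(t₀)`; both are of order
  -- `R y₀`, and `C₃` collects the constants.
  have hens₀ : rq (enstW F) (c t₀) ≤ C₃ * R * y₀ := by
    have h3 : rq (enstW F) (c t₀) ≤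
        (1 + |F|) ^ 2 * (2 * R) * y t₀ + (1 + |F|) ^ 2 * (2 * R⁻¹) * z t₀ := by
      refine rq_le_add (by positivity) (by positivity) (continuous_sobW s)
        (fun ξ => (sobW_pos s ξ).le) (continuous_gradW s) (gradW_nonneg s) (fun ξ => ?_)
        (hc.band t₀ (hsub ht₀))
      refine (enstW_le F ξ).trans ?_
      have h4 := sobW_one_le_add hδ hR1 ξ
      calc (1 + |F|) ^ 2 * sobW 1 ξ ≤ (1 + |F|) ^ 2 *
            (2 * R * sobW s ξ + 2 * R⁻¹ * gradW s ξ) := by gcongr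
        _ = _ := by ring
    refine h3.trans ?_
    calc (1 + |F|) ^ 2 * (2 * R) * y t₀ + (1 + |F|) ^ 2 * (2 * R⁻¹) * z t₀
        ≤ (1 + |F|) ^ 2 * (2 * R) * (2 * y₀) +
          (1 + |F|) ^ 2 * (2 * R⁻¹) * (4 * (ν₀ + 1) / ν₀ * R ^ 2 * y₀) := by gcongr
      _ = _ := by rw [hC₃]; field_simp
  have hC₂R : 0 ≤ C₂ * (C₃ * R * y₀) := by positivity
  -- From `t₀` on, the decay of energy and enstrophy controls H¹, which dominates H^s as `s ≤ 1`;
  -- this is where `δ ≤ 1/2` enters.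
  have hsecond : ∀ t, t₀ ≤ t → t ≤ T →
      y t ≤ C₂ * (C₃ * R * y₀) ∧ ν₀ * ∫ τ in t₀..t, z τ ≤ C₂ * (C₃ * R * y₀) := by
    intro t h3 h4
    have h5 := hc.enstrophy_le hν₀ hN ht₀.1 h3 h4
    have h6 : 0 ≤ ∫ τ in t₀..t, rq (enstGradW F) (c τ) :=
      intervalIntegral.integral_nonneg h3 fun u _ => rq_nonneg _ _
    have h7 := rq_nonneg (enstW F) (c t)
    have h8 : rq (enstW F) (c t) ≤ C₃ * R * y₀ := by nlinarith
    have hsubt : Icc t₀ t ⊆ Icc 0 T := Icc_subset_Icc ht₀.1 h4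
    constructor
    · refine (rq_le_mul hC₂.le (continuous_enstW F) (fun ξ => (sobW_mono hs1 ξ).trans (h2 ξ))
        (hc.band t ⟨ht₀.1.trans h3, h4⟩)).trans ?_
      gcongr
    · have h9 : ∫ τ in t₀..t, z τ ≤ ∫ τ in t₀..t, C₂ * rq (enstGradW F) (c τ) := by
        refine intervalIntegral.integral_mono_on h3
          ((hzc.mono hsubt).intervalIntegrable_of_Icc h3)
          (((continuousOn_const.mul (hc.continuousOn_rq (continuous_enstGradW F)
            (enstGradW_nonneg F))).mono hsubt).intervalIntegrable_of_Icc h3) fun τ hτ => ?_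
        refine rq_le_mul hC₂.le (continuous_enstGradW F) (fun ξ => ?_) (hc.band τ (hsubt hτ))
        rw [gradW, enstGradW, ← mul_assoc]
        exact mul_le_mul_of_nonneg_right ((sobW_mono hs1 ξ).trans (h2 ξ)) (sq_nonneg _)
      rw [intervalIntegral.integral_const_mul] at h9
      have h10 : ν₀ * ∫ τ in t₀..t, rq (enstGradW F) (c τ) ≤ C₃ * R * y₀ := by
        have : 0 ≤ ν₀ * ∫ τ in t₀..t, rq (enstGradW F) (c τ) := by positivity
        linarith
      calc ν₀ * ∫ τ in t₀..t, z τ ≤ ν₀ * (C₂ * ∫ τ in t₀..t, rq (enstGradW F) (c τ)) := by gcongr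
        _ = C₂ * (ν₀ * ∫ τ in t₀..t, rq (enstGradW F) (c τ)) := by ring
        _ ≤ _ := by gcongr
  have hRval : R = L ^ (1 / (2 * δ)) * Y ^ (1 / (2 * δ)) := by
    rw [hR, Real.mul_rpow hL0.le hY0.le]
  have hgoal : y t + ν₀ * ∫ τ in (0 : ℝ)..t, z τ ≤ (6 + 2 * (C₂ * C₃)) * (R * y₀) := by
    have hRy : y₀ ≤ R * y₀ := by nlinarith
    have hCC : 0 ≤ C₂ * C₃ * (R * y₀) := by positivity
    rcases le_total t T₁ with h3 | h3
    · have h4 := hfirst t ⟨ht.1, h3⟩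
      have h5 := hyn t
      have h6 : 0 ≤ ∫ τ in (0 : ℝ)..t, z τ :=
        intervalIntegral.integral_nonneg ht.1 fun u _ => hzn u
      linarith
    · have h4 : t₀ ≤ t := ht₀.2.trans h3
      obtain ⟨h5, h6⟩ := hsecond t h4 ht.2
      have hi : ∀ a b : ℝ, 0 ≤ a → a ≤ b → b ≤ T → IntervalIntegrable z volume a b :=
        fun a b ha hab hb => (hzc.mono (Icc_subset_Icc ha hb)).intervalIntegrable_of_Icc hab
      have h7 : ∫ τ in (0 : ℝ)..t, z τ = (∫ τ in (0 : ℝ)..t₀, z τ) + ∫ τ in t₀..t, z τ :=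
        (intervalIntegral.integral_add_adjacent_intervals (hi 0 t₀ le_rfl ht₀.1 (ht₀.2.trans hT₁T))
          (hi t₀ t ht₀.1 h4 ht.2)).symm
      have h8 : ∫ τ in (0 : ℝ)..T₁, z τ = (∫ τ in (0 : ℝ)..t₀, z τ) + ∫ τ in t₀..T₁, z τ :=
        (intervalIntegral.integral_add_adjacent_intervals (hi 0 t₀ le_rfl ht₀.1 (ht₀.2.trans hT₁T))
          (hi t₀ T₁ ht₀.1 ht₀.2 hT₁T)).symm
      have h9 : 0 ≤ ∫ τ in t₀..T₁, z τ :=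
        intervalIntegral.integral_nonneg ht₀.2 fun u _ => hzn u
      have h10 : ν₀ * ∫ τ in (0 : ℝ)..t₀, z τ ≤ 4 * y₀ := by
        refine le_trans ?_ hIz
        gcongr
        linarith
      rw [h7, mul_add]
      linarith
  refine hgoal.trans (le_of_eq ?_)
  rw [hRval]; ring

end QuasiGeo
end

noncomputable section

namespace QuasiGeo

/-! ### Convergence of the truncated solutions -/

theorem IsApprox.mono {ν₀ : ℝ} {g : E3 → ℝ} {F : ℝ} {hg : DiffSym ν₀ g} {N T T' : ℝ} {a₀ : H}
    {c : ℝ → H} (hc : IsApprox F hg N T a₀ c) (h : T' ≤ T) : IsApprox F hg N T' a₀ c where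
  initial := hc.initial
  deriv t ht := (hc.deriv t ⟨ht.1, ht.2.trans h⟩).mono (Icc_subset_Icc_right h)
  herm t ht := hc.herm t ⟨ht.1, ht.2.trans h⟩
  band t ht := hc.band t ⟨ht.1, ht.2.trans h⟩

theorem sobW_add_one (s : ℝ) (ξ : E3) : sobW (s + 1) ξ = sobW s ξ + gradW s ξ := by
  rw [gradW, sobW, sobW, Real.rpow_add (by positivity), Real.rpow_one]; ring

theorem one_le_sobW {s : ℝ} (hs : 0 ≤ s) (ξ : E3) : 1 ≤ sobW s ξ :=
  Real.one_le_rpow (by nlinarith [sq_nonneg (absD ξ)]) hs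

/-- Beyond frequency `n`, regularity H^s of the product is traded for the decay `(1 + n²)^(-s)`.
This measures the interactions that the truncation at level `n` discards. -/
theorem lintegral_indicator_sq_lconv_le {s n : ℝ} (hs : 0 ≤ s) (hn : 0 ≤ n) {a : E3 → ℂ}
    (ha : Measurable a) :
    ∫⁻ ξ, {ξ : E3 | n ≤ absD ξ}.indicator
        (fun ξ => lconv (fun η => ‖a η‖ₑ) (fun η => ‖a η‖ₑ) ξ ^ 2) ξ ≤
      ENNReal.ofReal ((1 + n ^ 2) ^ (-s)) *
        (4 * ENNReal.ofReal (4 ^ s) * (oneNorm a ^ 2 * qf (sobW s) a)) := by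
  set f := lconv (fun η => ‖a η‖ₑ) (fun η => ‖a η‖ₑ) with hf
  have hfm : Measurable f := measurable_lconv (by fun_prop) (by fun_prop)
  have h1 := lintegral_weight_sq_lconv_le (f := fun η => ‖a η‖ₑ) (g := fun η => ‖a η‖ₑ)
    (w := fun ξ => ENNReal.ofReal (tailW s 0 ξ)) (w' := fun ξ => ENNReal.ofReal (tailW s (0 / 2) ξ))
    (by fun_prop) (by fun_prop) (by fun_prop) (ofReal_tailW_le_add hs 0)
  simp only [zero_div, tailW_zero] at h1
  change _ ≤ 2 * ENNReal.ofReal (4 ^ s) * (oneNorm a ^ 2 * qf (sobW s) a +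
    oneNorm a ^ 2 * qf (sobW s) a) at h1
  calc _ ≤ ∫⁻ ξ, ENNReal.ofReal ((1 + n ^ 2) ^ (-s)) * (ENNReal.ofReal (sobW s ξ) * f ξ ^ 2) := by
        refine lintegral_mono fun ξ => ?_
        by_cases hξ : ξ ∈ {ξ : E3 | n ≤ absD ξ}
        swap
        · rw [indicator_of_notMem hξ]; exact zero_le
        rw [indicator_of_mem hξ]
        rw [← mul_assoc, ← ENNReal.ofReal_mul (by positivity)]
        refine le_mul_of_one_le_left' ?_
        rw [ENNReal.one_le_ofReal, Real.rpow_neg (by positivity), sobW, inv_mul_eq_div,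
          one_le_div (by positivity)]
        have : n ≤ absD ξ := hξ
        gcongr
    _ = ENNReal.ofReal ((1 + n ^ 2) ^ (-s)) * ∫⁻ ξ, ENNReal.ofReal (sobW s ξ) * f ξ ^ 2 :=
        lintegral_const_mul _ (by fun_prop)
    _ ≤ _ := by
        gcongr
        refine h1.trans (le_of_eq ?_)
        ring

theorem sq_add_three_le (x y z : ℝ≥0∞) : (x + y + z) ^ 2 ≤ 3 * (x ^ 2 + y ^ 2 + z ^ 2) := by
  rcases eq_or_ne x ∞ with rfl | hx
  · simp
  rcases eq_or_ne y ∞ with rfl | hy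
  · simp
  rcases eq_or_ne z ∞ with rfl | hz
  · simp
  lift x to NNReal using hx
  lift y to NNReal using hy
  lift z to NNReal using hz
  norm_cast
  rw [← NNReal.coe_le_coe]
  push_cast
  nlinarith [sq_nonneg ((x : ℝ) - y), sq_nonneg ((y : ℝ) - z), sq_nonneg ((x : ℝ) - z)]

section

variable {ν₀ : ℝ} {g : E3 → ℝ} {F : ℝ} {hg : DiffSym ν₀ g} {a₀ : H} {c d : ℝ → H} {n m T : ℝ}

/-- The `L²` energy estimate for the difference of two truncated solutions. -/
theorem IsApprox.deriv_sub_le (hν₀ : 0 < ν₀) (hc : IsApprox F hg n T a₀ c)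
    (hd : IsApprox F hg m T a₀ d) (hn : 0 ≤ n) (hnm : n ≤ m) {s : ℝ} (hs : 0 ≤ s) {t A B M : ℝ}
    (ht : t ∈ Icc 0 T) (hA : 0 ≤ A) (hB : 0 ≤ B) (hcA : oneNorm (c t) ^ 2 ≤ ENNReal.ofReal A)
    (hdB : oneNorm (d t) ^ 2 ≤ ENNReal.ofReal B) (hM : rq (sobW s) (c t) ≤ M) :
    2 * inner ℝ (c t - d t) (field F hg n (c t) - field F hg m (d t)) ≤
      3 / ν₀ * (A + B) * (‖c t - d t‖ ^ 2 + (1 + n ^ 2) ^ (-s) * (4 * 4 ^ s * M)) := by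
  have hM0 : 0 ≤ M := (rq_nonneg _ _).trans hM
  have hcb := hc.band t ht
  have hdb := hd.band t ht
  set W := c t - d t with hW
  have hWb : proj m W = W := by
    rw [hW, map_sub, hdb, ← hcb, proj_proj hnm]
  have hmc := measurable_coe (c t)
  have hmd := measurable_coe (d t)
  have hmW := measurable_coe W
  set f1 := lconv (fun η => ‖c t η‖ₑ) (fun η => ‖W η‖ₑ) with hf1
  set f2 := lconv (fun η => ‖d t η‖ₑ) (fun η => ‖W η‖ₑ) with hf2
  -- For `n ≤ |D| < m` the coarser solution `c` vanishes and its field lacks `B(c, c)`. Adding and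
  -- subtracting that term makes the difference satisfy the bilinear difference equation on the
  -- whole band `|D| < m`, with `f3` bounding the remainder.
  set f3 := {ξ : E3 | n ≤ absD ξ}.indicator
    (lconv (fun η => ‖c t η‖ₑ) (fun η => ‖c t η‖ₑ)) with hf3
  have hf1m : Measurable f1 := measurable_lconv (by fun_prop) (by fun_prop)
  have hf2m : Measurable f2 := measurable_lconv (by fun_prop) (by fun_prop)
  have hf3m : Measurable f3 :=
    (measurable_lconv (by fun_prop) (by fun_prop)).indicator (measurableSet_le_absD n)
  have hwD : BSym fun ξ => cut m (fun _ => 1) ξ * absD ξ ^ 2 := by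
    rw [cut_mul_eq]
    exact bsym_cut_of_continuous (by fun_prop) m
  set ε := (1 + n ^ 2) ^ (-s) with hε
  have hε0 : 0 ≤ ε := by rw [hε]; positivity
  have h := two_mul_inner_mulOp_le (w := cut m fun _ => 1) (g := g) (a := W)
    (v := field F hg n (c t) - field F hg m (d t))
    (G := fun ξ => -(bil F W (c t) ξ + bil F (d t) W ξ) +
      {ξ : E3 | n ≤ absD ξ}.indicator (bil F (c t) (c t)) ξ)
    (f := fun ξ => f1 ξ + f2 ξ + f3 ξ)
    (Φ := 3 * ((A + B) * (‖W‖ ^ 2 + ε * (4 * 4 ^ s * M)))) hν₀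
    (bsym_cut_one m) (cut_nonneg fun ξ => zero_le_one)
    hwD hg.le (by fun_prop) ?_ ?_ (by positivity) ?_
  · have e : mulOp _ (bsym_cut_one m) W = W := hWb
    rw [e] at h
    refine h.trans ?_
    have h1 := rq_nonneg (fun ξ => cut m (fun _ => 1) ξ * absD ξ ^ 2) W
    have e2 : 3 / ν₀ * (A + B) * (‖W‖ ^ 2 + ε * (4 * 4 ^ s * M)) =
        3 * ((A + B) * (‖W‖ ^ 2 + ε * (4 * 4 ^ s * M))) / ν₀ := by ring
    rw [e2]
    have := mul_nonneg hν₀.le h1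
    linarith
  · filter_upwards [field_coe F hg n (c t), field_coe F hg m (d t), Lp.coeFn_sub (c t) (d t),
      Lp.coeFn_sub (field F hg n (c t)) (field F hg m (d t)), bandRep_ae_eq hcb]
      with ξ h1 h2 h3 h4 h5 hw
    have hm : absD ξ < m := by
      by_contra h2
      exact hw (cut_of_not_lt h2)
    rw [h4, Pi.sub_apply, h1, h2, if_pos hm, h3, Pi.sub_apply, ← bil_self_sub]
    by_cases hξ : absD ξ < n
    · rw [if_pos hξ, indicator_of_notMem (by simpa using hξ)]
      ring
    · rw [if_neg hξ, indicator_of_mem (by simpa using hξ), ← h5, bandRep, if_neg hξ]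
      ring
  · refine Eventually.of_forall fun ξ _ => ?_
    rw [mul_add, mul_add]
    refine (enorm_add_le _ _).trans (add_le_add ?_ ?_)
    · rw [enorm_neg]
      refine (enorm_add_le _ _).trans (add_le_add ?_ ?_)
      · rw [hf1, lconv_comm]
        exact enorm_bil_le F hmW hmc ξ
      · exact enorm_bil_le F hmd hmW ξ
    · by_cases hξ : n ≤ absD ξ
      · rw [hf3, indicator_of_mem (show ξ ∈ {ξ : E3 | n ≤ absD ξ} from hξ),
          indicator_of_mem (show ξ ∈ {ξ : E3 | n ≤ absD ξ} from hξ)]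
        exact enorm_bil_le F hmc hmc ξ
      · rw [indicator_of_notMem (show ξ ∉ {ξ : E3 | n ≤ absD ξ} from hξ)]
        simp
  · have e1 : ∫⁻ ξ, f1 ξ ^ 2 ≤ ENNReal.ofReal (A * ‖W‖ ^ 2) := by
      refine (lintegral_sq_lconv_le (by fun_prop) (by fun_prop)).trans ?_
      rw [lintegral_enorm_sq, ENNReal.ofReal_mul hA]
      gcongr
      exact hcA
    have e2 : ∫⁻ ξ, f2 ξ ^ 2 ≤ ENNReal.ofReal (B * ‖W‖ ^ 2) := by
      refine (lintegral_sq_lconv_le (by fun_prop) (by fun_prop)).trans ?_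
      rw [lintegral_enorm_sq, ENNReal.ofReal_mul hB]
      gcongr
      exact hdB
    have e3 : ∫⁻ ξ, f3 ξ ^ 2 ≤ ENNReal.ofReal (ε * (4 * 4 ^ s * (A * M))) := by
      have h1 := lintegral_indicator_sq_lconv_le hs hn hmc
      calc ∫⁻ ξ, f3 ξ ^ 2 = _ := lintegral_congr fun ξ => by
            by_cases hξ : n ≤ absD ξ
            · rw [hf3, indicator_of_mem (show ξ ∈ {ξ : E3 | n ≤ absD ξ} from hξ),
                indicator_of_mem (show ξ ∈ {ξ : E3 | n ≤ absD ξ} from hξ)]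
            · rw [hf3, indicator_of_notMem (show ξ ∉ {ξ : E3 | n ≤ absD ξ} from hξ),
                indicator_of_notMem (show ξ ∉ {ξ : E3 | n ≤ absD ξ} from hξ)]
              simp
        _ ≤ _ := h1
        _ ≤ ENNReal.ofReal ε * (4 * ENNReal.ofReal (4 ^ s) *
            (ENNReal.ofReal A * ENNReal.ofReal M)) := by
          rw [← ofReal_rq_of_proj (continuous_sobW s) hcb]
          gcongr
        _ = _ := by
          rw [← ENNReal.ofReal_mul hA, show (4 : ℝ≥0∞) = ENNReal.ofReal 4 by simp,
            ← ENNReal.ofReal_mul (by norm_num), ← ENNReal.ofReal_mul (by positivity),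
            ← ENNReal.ofReal_mul hε0]
    calc ∫⁻ ξ, ENNReal.ofReal (cut m (fun _ => 1) ξ) * (f1 ξ + f2 ξ + f3 ξ) ^ 2
        ≤ ∫⁻ ξ, 3 * (f1 ξ ^ 2 + f2 ξ ^ 2 + f3 ξ ^ 2) := by
          refine lintegral_mono fun ξ => ?_
          refine (mul_le_of_le_one_left' ?_).trans (sq_add_three_le _ _ _)
          rw [ENNReal.ofReal_le_one]
          exact cut_le (fun _ => zero_le_one) ξ
      _ = 3 * ((∫⁻ ξ, f1 ξ ^ 2) + (∫⁻ ξ, f2 ξ ^ 2) + ∫⁻ ξ, f3 ξ ^ 2) := by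
          rw [lintegral_const_mul _ (by fun_prop), lintegral_add_left (by fun_prop),
            lintegral_add_left (by fun_prop)]
      _ ≤ 3 * (ENNReal.ofReal (A * ‖W‖ ^ 2) + ENNReal.ofReal (B * ‖W‖ ^ 2) +
            ENNReal.ofReal (ε * (4 * 4 ^ s * (A * M)))) := by gcongr
      _ = ENNReal.ofReal (3 * (A * ‖W‖ ^ 2 + B * ‖W‖ ^ 2 + ε * (4 * 4 ^ s * (A * M)))) := by
          rw [← ENNReal.ofReal_add (by positivity) (by positivity),
            ← ENNReal.ofReal_add (by positivity) (by positivity),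
            show (3 : ℝ≥0∞) = ENNReal.ofReal 3 by simp, ← ENNReal.ofReal_mul (by norm_num)]
      _ ≤ _ := by
          refine ENNReal.ofReal_le_ofReal ?_
          have : 0 ≤ B * (ε * (4 * 4 ^ s * M)) := by positivity
          nlinarith

/-- A bound, uniform in the truncation, for truncated solutions. -/
def UniformBound (F : ℝ) (hg : DiffSym ν₀ g) (s : ℝ) (a₀ : H) (M : ℝ) : Prop :=
  ∀ N T : ℝ, 0 ≤ N → 1 ≤ T → ∀ c, IsApprox F hg N T a₀ c → ∀ t ∈ Icc 0 T,
    rq (sobW s) (c t) + ν₀ * ∫ τ in (0 : ℝ)..t, rq (gradW s) (c τ) ≤ M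

theorem UniformBound.rq_le {s M : ℝ} (hM : UniformBound F hg s a₀ M) (hν₀ : 0 < ν₀) (hn : 0 ≤ n)
    (hT : 1 ≤ T) (hc : IsApprox F hg n T a₀ c) {t : ℝ} (ht : t ∈ Icc 0 T) :
    rq (sobW s) (c t) ≤ M := by
  have h1 := hM n T hn hT c hc t ht
  have h2 : 0 ≤ ∫ τ in (0 : ℝ)..t, rq (gradW s) (c τ) :=
    intervalIntegral.integral_nonneg ht.1 fun u _ => rq_nonneg _ _
  have := mul_nonneg hν₀.le h2
  linarith

theorem UniformBound.integral_le {s M : ℝ} (hM : UniformBound F hg s a₀ M) (hn : 0 ≤ n)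
    (hT : 1 ≤ T) (hc : IsApprox F hg n T a₀ c) {t : ℝ} (ht : t ∈ Icc 0 T) :
    ν₀ * ∫ τ in (0 : ℝ)..t, rq (gradW s) (c τ) ≤ M := by
  have h1 := hM n T hn hT c hc t ht
  have := rq_nonneg (sobW s) (c t)
  linarith

/-- Grönwall with a kernel made of the squared L¹ norms of both solutions. Its time integral is
bounded independently of the levels through the embedding of H^(s+1), so truncated solutions are
Cauchy in L², uniformly on `[0, T]`. -/
theorem exists_norm_sub_sq_le {s M : ℝ} (hν₀ : 0 < ν₀) (hs : 1 / 2 < s)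
    (hM : UniformBound F hg s a₀ M) (T : ℝ) (hT : 1 ≤ T) :
    ∃ K : ℝ, 0 ≤ K ∧ ∀ n m : ℝ, 0 ≤ n → n ≤ m → ∀ c d, IsApprox F hg n T a₀ c →
      IsApprox F hg m T a₀ d → ∀ t ∈ Icc 0 T,
      ‖c t - d t‖ ^ 2 ≤ K * (‖proj n a₀ - proj m a₀‖ ^ 2 + (1 + n ^ 2) ^ (-s) * (4 * 4 ^ s * M)) := by
  obtain ⟨C, hC, hCb⟩ := exists_sq_oneNorm_le_qf_sobW hs
  refine ⟨Real.exp (6 * C / ν₀ * (M * T + M / ν₀)), (Real.exp_pos _).le, ?_⟩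
  intro n m hn hnm c d hc hd t ht
  have hs0 : 0 ≤ s := by linarith
  set A : (ℝ → H) → ℝ → ℝ := fun c t => C * (rq (sobW s) (c t) + rq (gradW s) (c t)) with hAdef
  have hA0 : ∀ c t, 0 ≤ A c t := fun c t => by
    have h1 := rq_nonneg (sobW s) (c t)
    have h2 := rq_nonneg (gradW s) (c t)
    simp only [hAdef]; positivity
  have hA1 : ∀ {n c}, IsApprox F hg n T a₀ c → ∀ t ∈ Icc 0 T,
      oneNorm (c t) ^ 2 ≤ ENNReal.ofReal (A c t) := by
    intro n c hc t ht
    refine (hCb (c t) (measurable_coe _)).trans ?_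
    simp only [hAdef]
    rw [ENNReal.ofReal_mul hC.le, ENNReal.ofReal_add (rq_nonneg _ _) (rq_nonneg _ _),
      ofReal_rq_of_proj (continuous_sobW s) (hc.band t ht),
      ofReal_rq_of_proj (continuous_gradW s) (hc.band t ht)]
    gcongr
    have h1 := qf_le_add (w := sobW (s + 1)) zero_le_one zero_le_one (measurable_sobW s)
      (fun ξ => (sobW_pos s ξ).le) (continuous_gradW s).measurable (gradW_nonneg s)
      (fun ξ => by rw [sobW_add_one, one_mul, one_mul]) (measurable_coe (c t))
    simpa using h1
  have hAc : ∀ {n c}, IsApprox F hg n T a₀ c → ContinuousOn (A c) (Icc 0 T) := fun hc =>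
    continuousOn_const.mul ((hc.continuousOn_rq (continuous_sobW s)
      fun ξ => (sobW_pos s ξ).le).add (hc.continuousOn_rq (continuous_gradW s) (gradW_nonneg s)))
  have hAi : ∀ {n c}, 0 ≤ n → IsApprox F hg n T a₀ c →
      ∫ τ in (0 : ℝ)..t, A c τ ≤ C * (M * T + M / ν₀) := by
    intro n c hn hc
    have hsub : Icc 0 t ⊆ Icc 0 T := Icc_subset_Icc_right ht.2
    have i1 : IntervalIntegrable (fun τ => rq (sobW s) (c τ)) volume 0 t :=
      ((hc.continuousOn_rq (continuous_sobW s) fun ξ => (sobW_pos s ξ).le).mono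
        hsub).intervalIntegrable_of_Icc ht.1
    have i2 : IntervalIntegrable (fun τ => rq (gradW s) (c τ)) volume 0 t :=
      ((hc.continuousOn_rq (continuous_gradW s) (gradW_nonneg s)).mono
        hsub).intervalIntegrable_of_Icc ht.1
    simp only [hAdef]
    rw [intervalIntegral.integral_const_mul, intervalIntegral.integral_add i1 i2]
    have h1 := intervalIntegral.integral_mono_on (μ := volume) (g := fun _ => M) ht.1 i1
      intervalIntegrable_const fun τ hτ => hM.rq_le hν₀ hn hT hc (hsub hτ)
    rw [intervalIntegral.integral_const, smul_eq_mul, sub_zero] at h1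
    have h2 := hM.integral_le hn hT hc ht
    have h3 : ∫ τ in (0 : ℝ)..t, rq (gradW s) (c τ) ≤ M / ν₀ := by
      rw [le_div_iff₀ hν₀]; linarith
    have hM0 : 0 ≤ M := (rq_nonneg _ _).trans (hM.rq_le hν₀ hn hT hc ht)
    have h4 : t * M ≤ M * T := by rw [mul_comm]; gcongr; exact ht.2
    gcongr
    linarith
  set ε := (1 + n ^ 2) ^ (-s) * (4 * 4 ^ s * M) with hε
  have hε0 : 0 ≤ ε := by
    have : 0 ≤ M := (rq_nonneg _ _).trans (hM.rq_le hν₀ hn hT hc ht)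
    rw [hε]; positivity
  -- The truncation error `ε` is constant in time; adding it to the unknown makes the inequality
  -- homogeneous.
  have h := gronwall_add_integral_le (y := fun t => ‖c t - d t‖ ^ 2 + ε)
    (y' := fun t => 2 * inner ℝ (c t - d t) (field F hg n (c t) - field F hg m (d t)))
    (z := fun _ => 0) (k := fun t => 3 / ν₀ * (A c t + A d t))
    (fun t ht => (((hc.deriv t ht).sub (hd.deriv t ht)).norm_sq).add_const ε)
    continuousOn_const (continuousOn_const.mul ((hAc hc).add (hAc hd)))
    (fun _ _ => le_rfl) (fun t _ => by have := hA0 c t; have := hA0 d t; positivity)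
    (fun t ht => by
      rw [add_zero]
      exact hc.deriv_sub_le hν₀ hd hn hnm hs0 ht (hA0 c t) (hA0 d t) (hA1 hc t ht) (hA1 hd t ht)
        (hM.rq_le hν₀ hn hT hc ht)) ht
  simp only [intervalIntegral.integral_zero, add_zero] at h
  rw [hc.initial, hd.initial] at h
  have h1 : ∫ τ in (0 : ℝ)..t, 3 / ν₀ * (A c τ + A d τ) ≤ 6 * C / ν₀ * (M * T + M / ν₀) := by
    have hsub : Icc 0 t ⊆ Icc 0 T := Icc_subset_Icc_right ht.2
    rw [intervalIntegral.integral_const_mul, intervalIntegral.integral_add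
      (((hAc hc).mono hsub).intervalIntegrable_of_Icc ht.1)
      (((hAc hd).mono hsub).intervalIntegrable_of_Icc ht.1)]
    calc _ ≤ 3 / ν₀ * (C * (M * T + M / ν₀) + C * (M * T + M / ν₀)) := by
          gcongr
          · exact hAi hn hc
          · exact hAi (hn.trans hnm) hd
      _ = _ := by ring
  calc ‖c t - d t‖ ^ 2 ≤ ‖c t - d t‖ ^ 2 + ε := by linarith
    _ ≤ _ := h
    _ ≤ (‖proj n a₀ - proj m a₀‖ ^ 2 + ε) * Real.exp (6 * C / ν₀ * (M * T + M / ν₀)) := by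
        gcongr
    _ = _ := by ring

end

end QuasiGeo
end

noncomputable section

namespace QuasiGeo

/-! ### Semicontinuity and measurability of quadratic forms -/

/-- Monotone convergence. Forms with unbounded weight are suprema of continuous ones, hence lower
semicontinuous and measurable along continuous curves; estimates for them can be proved on each
band. -/
theorem iSup_qf_cut {m : E3 → ℝ} (hm : Measurable m) (hm0 : ∀ ξ, 0 ≤ m ξ) {a : E3 → ℂ}
    (ha : Measurable a) : ⨆ N : ℕ, qf (cut N m) a = qf m a := by
  unfold qf
  have hcm : ∀ N : ℕ, Measurable (cut N m) := fun N => hm.indicator (measurableSet_absD_lt N)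
  rw [← lintegral_iSup (fun N => by have := hcm N; fun_prop)]
  · refine lintegral_congr fun ξ => le_antisymm (iSup_le fun N => ?_) ?_
    · gcongr
      exact cut_le hm0 ξ
    · obtain ⟨N, hN⟩ := exists_nat_gt (absD ξ)
      refine le_iSup_of_le N ?_
      rw [cut_of_lt hN]
  · intro N N' h ξ
    have h' : (N : ℝ) ≤ N' := by exact_mod_cast h
    dsimp only
    gcongr
    by_cases hξ : absD ξ < N
    · rw [cut_of_lt hξ, cut_of_lt (hξ.trans_le h')]
    · rw [cut_of_not_lt hξ]
      exact cut_nonneg hm0 ξ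

theorem qf_le_liminf {ι : Type*} {l : Filter ι} [l.NeBot] {m : E3 → ℝ} (hm : Continuous m)
    (hm0 : ∀ ξ, 0 ≤ m ξ) {x : ι → H} {a : H} (h : Tendsto x l (𝓝 a)) :
    qf m a ≤ liminf (fun i => qf m (x i)) l := by
  rw [← iSup_qf_cut hm.measurable hm0 (measurable_coe a)]
  refine iSup_le fun N => ?_
  have hb := bsym_cut_of_continuous hm N
  have h1 : Tendsto (fun i => qf (cut N m) (x i)) l (𝓝 (qf (cut N m) a)) := by
    have h2 := ENNReal.tendsto_ofReal (((continuous_rq hb (cut_nonneg hm0)).tendsto a).comp h)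
    simp only [Function.comp_def, ofReal_rq hb] at h2
    exact h2
  rw [← h1.liminf_eq]
  exact liminf_le_liminf (Eventually.of_forall fun i => qf_mono (cut_le hm0) _)

theorem aemeasurable_qf {m : E3 → ℝ} (hm : Measurable m) (hm0 : ∀ ξ, 0 ≤ m ξ)
    (hb : ∀ N : ℝ, BSym (cut N m)) {a : ℝ → H} {S : Set ℝ} (hS : MeasurableSet S)
    (ha : ContinuousOn a S) : AEMeasurable (fun t => qf m (a t)) (volume.restrict S) := by
  simp_rw [← iSup_qf_cut hm hm0 (measurable_coe _)]
  refine AEMeasurable.iSup fun N => ?_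
  replace hb := hb N
  simp_rw [← ofReal_rq hb]
  exact ((continuousOn_rq hb (cut_nonneg hm0) ha).aemeasurable hS).ennreal_ofReal

/-! ### Solutions of the scalar equation -/

/-- `a` solves the Fourier form `a' = g a - B(a, a)` of the quasi-geostrophic system. -/
structure IsScalarSol {ν₀ : ℝ} {g : E3 → ℝ} (F : ℝ) (hg : DiffSym ν₀ g) (a : ℝ → H) : Prop where
  continuousOn : ContinuousOn a (Ici 0)
  eq : ∀ N t : ℝ, 0 ≤ t → proj N (a t) = proj N (a 0) + ∫ τ in (0 : ℝ)..t, field F hg N (a τ)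

theorem proj_mulOp_cut_of_le {g : E3 → ℝ} {N M : ℝ} (h : N ≤ M) (hN : BSym (cut N g))
    (hM : BSym (cut M g)) (a : H) : proj N (mulOp _ hM a) = mulOp _ hN a := by
  ext1
  filter_upwards [proj_coe N (mulOp _ hM a), mulOp_coe _ hM a, mulOp_coe _ hN a] with ξ h1 h2 h3
  rw [h1, h2, h3]
  split_ifs with h4
  · rw [cut_of_lt h4, cut_of_lt (h4.trans_le h)]
  · rw [cut_of_not_lt h4]; simp

theorem proj_field {ν₀ : ℝ} {g : E3 → ℝ} (F : ℝ) (hg : DiffSym ν₀ g) {N M : ℝ} (h : N ≤ M)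
    (a : H) : proj N (field F hg M a) = field F hg N a := by
  rw [field, field, map_sub, proj_bilOp_of_le h, proj_mulOp_cut_of_le h (hg.bsym N)]

section

variable {ν₀ : ℝ} {g : E3 → ℝ} {F : ℝ} {hg : DiffSym ν₀ g} {a₀ : H}

theorem norm_field_le (F : ℝ) (hg : DiffSym ν₀ g) (N : ℝ) {a : H} {r : ℝ} (h : ‖a‖ ≤ r) :
    ‖field F hg N a‖ ≤ ‖mulOp (cut N g) (hg.bsym N)‖ * r + ‖bilOp F N‖ * r * r := by
  refine (norm_sub_le _ _).trans (add_le_add ?_ ?_)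
  · exact (ContinuousLinearMap.le_opNorm _ _).trans (by gcongr)
  · exact (ContinuousLinearMap.le_opNorm₂ _ _ _).trans (by
      have := (norm_nonneg _).trans h
      gcongr)

/-- On `|D| < N`, the system truncated at any level `n ≥ N` has the same right-hand side as the full
equation. The level-`N` equation thus holds exactly before the limit `n → ∞`. -/
theorem IsApprox.proj_eq {n T : ℝ} {c : ℝ → H} (hc : IsApprox F hg n T a₀ c) {N : ℝ} (hN : N ≤ n)
    {t : ℝ} (ht : t ∈ Icc 0 T) :
    proj N (c t) = proj N (c 0) + ∫ τ in (0 : ℝ)..t, field F hg N (c τ) := by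
  have hsub : Icc 0 t ⊆ Icc 0 T := Icc_subset_Icc_right ht.2
  have h1 := intervalIntegral.integral_eq_sub_of_hasDeriv_right_of_le (a := 0) (b := t)
    (f := fun t => proj N (c t)) (f' := fun t => field F hg N (c t)) ht.1
    ((proj N).continuous.comp_continuousOn (hc.continuousOn.mono hsub))
    (fun τ hτ => by
      have h2 := hc.deriv τ (hsub (Ioo_subset_Icc_self hτ))
      have h3 := (proj N).hasFDerivAt.comp_hasDerivWithinAt τ h2
      rw [proj_field F hg hN] at h3
      refine h3.mono_of_mem_nhdsWithin ?_
      exact mem_nhdsWithin_of_mem_nhds (Icc_mem_nhds hτ.1 (hτ.2.trans_le ht.2)))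
    (((continuous_field F hg N).comp_continuousOn
      (hc.continuousOn.mono hsub)).intervalIntegrable_of_Icc ht.1)
  rw [h1]; abel

theorem IsApprox.lintegral_qf_gradW {n T s : ℝ} {c : ℝ → H} (hc : IsApprox F hg n T a₀ c) {t : ℝ}
    (ht : t ∈ Icc 0 T) :
    ∫⁻ τ in Icc 0 t, qf (gradW s) (c τ) = ENNReal.ofReal (∫ τ in (0 : ℝ)..t, rq (gradW s) (c τ)) := by
  have hsub : Icc 0 t ⊆ Icc 0 T := Icc_subset_Icc_right ht.2
  have hcont := (hc.continuousOn_rq (continuous_gradW s) (gradW_nonneg s)).mono hsub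
  rw [intervalIntegral.integral_of_le ht.1, ← integral_Icc_eq_integral_Ioc,
    ofReal_integral_eq_lintegral_ofReal hcont.integrableOn_Icc
      (Eventually.of_forall fun τ => rq_nonneg _ _)]
  refine setLIntegral_congr_fun measurableSet_Icc fun τ hτ => ?_
  exact (ofReal_rq_of_proj (continuous_gradW s) (hc.band τ (hsub hτ))).symm

/-- Existence for the scalar equation, from a uniform bound on truncated solutions. -/
theorem exists_isScalarSol {s M : ℝ} (hν₀ : 0 < ν₀) (hs : 1 / 2 < s) (ha₀ : hermOp a₀ = a₀)
    (hM : UniformBound F hg s a₀ M) :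
    ∃ a : ℝ → H, IsScalarSol F hg a ∧ a 0 = a₀ ∧ (∀ t, 0 ≤ t → hermOp (a t) = a t) ∧
      (∀ t, 0 ≤ t → qf (sobW s) (a t) ≤ ENNReal.ofReal M) ∧
      (∀ t, 0 ≤ t → ENNReal.ofReal ν₀ * ∫⁻ τ in Icc 0 t, qf (gradW s) (a τ) ≤
        ENNReal.ofReal M) := by
  -- The level-`n` solution is taken on `[0, n + 1]`: any bounded interval is eventually covered,
  -- and the length is at least 1, as `UniformBound` requires.
  choose c hc using fun n : ℕ => exists_isApprox hν₀ F hg (n : ℝ) (T := (n : ℝ) + 1)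
    (by positivity) ha₀
  have hcT : ∀ {T : ℝ} {n : ℕ}, T ≤ n → IsApprox F hg n T a₀ (c n) := fun h =>
    (hc _).mono (by linarith)
  have hs0 : 0 ≤ s := by linarith
  have hbase : ∀ (n : ℕ) (t : ℝ), t ∈ Icc (0 : ℝ) (n + 1) → ‖c n t‖ ^ 2 ≤ M := fun n t ht => by
    have h1 := hM.rq_le hν₀ (Nat.cast_nonneg n) (by simp) (hc n) ht
    rw [← rq_one]
    refine le_trans ?_ h1
    exact ENNReal.toReal_mono (qf_lt_top_of_proj (continuous_sobW s) ((hc n).band t ht)).ne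
      (qf_mono (fun ξ => one_le_sobW hs0 ξ) _)
  have hM0 : 0 ≤ M := (sq_nonneg _).trans (hbase 0 0 (by simp))
  have hcau : ∀ T : ℝ, UniformCauchySeqOn c atTop (Icc 0 T) := by
    intro T
    set T' := max T 1 with hT'
    obtain ⟨K, hK0, hK⟩ := exists_norm_sub_sq_le hν₀ hs hM T' (le_max_right _ _)
    have hε : Tendsto (fun n : ℕ => (1 + (n : ℝ) ^ 2) ^ (-s) * (4 * 4 ^ s * M)) atTop (𝓝 0) := by
      have h1 : Tendsto (fun n : ℕ => 1 + (n : ℝ) ^ 2) atTop atTop :=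
        tendsto_atTop_add_const_left _ _
          ((tendsto_pow_atTop two_ne_zero).comp tendsto_natCast_atTop_atTop)
      have h2 := ((tendsto_rpow_neg_atTop (y := s) (by linarith)).comp h1).mul_const (4 * 4 ^ s * M)
      simpa using h2
    have hp := (tendsto_proj a₀).cauchySeq
    rw [Metric.uniformCauchySeqOn_iff]
    intro ε hε0
    have hη : 0 < ε ^ 2 / (2 * (K + 1)) := by positivity
    obtain ⟨n₁, hn₁⟩ := Metric.cauchySeq_iff.1 hp (Real.sqrt (ε ^ 2 / (2 * (K + 1))))
      (Real.sqrt_pos.2 hη)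
    obtain ⟨n₂, hn₂⟩ := eventually_atTop.1 (hε.eventually (gt_mem_nhds hη))
    obtain ⟨n₃, hn₃⟩ := exists_nat_ge T'
    have key : ∀ n m : ℕ, max n₁ (max n₂ n₃) ≤ n → n ≤ m → ∀ t ∈ Icc 0 T,
        dist (c n t) (c m t) < ε := by
      intro n m hn hnm t ht
      have hn1 : n₁ ≤ n := (le_max_left _ _).trans hn
      have hn2 : n₂ ≤ n := (le_max_left _ _).trans ((le_max_right _ _).trans hn)
      have hn3 : n₃ ≤ n := (le_max_right _ _).trans ((le_max_right _ _).trans hn)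
      have hnm' : (n : ℝ) ≤ m := by exact_mod_cast hnm
      have hTn : T' ≤ n := hn₃.trans (by exact_mod_cast hn3)
      have h1 := hK n m (Nat.cast_nonneg n) hnm' (c n) (c m) (hcT hTn) (hcT (hTn.trans hnm')) t
        ⟨ht.1, ht.2.trans (le_max_left _ _)⟩
      have h2 := hn₁ n hn1 m (hn1.trans hnm)
      rw [dist_eq_norm] at h2 ⊢
      have h3 : ‖proj n a₀ - proj m a₀‖ ^ 2 < ε ^ 2 / (2 * (K + 1)) := by
        rwa [← Real.lt_sqrt (norm_nonneg _)]
      have h4 := hn₂ n hn2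
      refine lt_of_pow_lt_pow_left₀ 2 hε0.le (h1.trans_lt ?_)
      calc K * (‖proj n a₀ - proj m a₀‖ ^ 2 + (1 + (n : ℝ) ^ 2) ^ (-s) * (4 * 4 ^ s * M))
          ≤ K * (ε ^ 2 / (2 * (K + 1)) + ε ^ 2 / (2 * (K + 1))) := by gcongr
        _ = ε ^ 2 * (K / (K + 1)) := by field_simp; ring
        _ < ε ^ 2 * 1 := by
            gcongr
            rw [div_lt_one (by positivity)]; linarith
        _ = ε ^ 2 := mul_one _
    refine ⟨max n₁ (max n₂ n₃), fun m hm n hn t ht => ?_⟩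
    rcases le_total m n with h | h
    · exact key m n hm h t ht
    · rw [dist_comm]; exact key n m hn h t ht
  have hlim : ∀ t : ℝ, ∃ x : H, 0 ≤ t → Tendsto (fun n => c n t) atTop (𝓝 x) := by
    intro t
    by_cases ht : 0 ≤ t
    · obtain ⟨x, hx⟩ := cauchySeq_tendsto_of_complete ((hcau t).cauchySeq ⟨ht, le_rfl⟩)
      exact ⟨x, fun _ => hx⟩
    · exact ⟨0, fun h => absurd h ht⟩
  choose a ha using hlim
  have hunif : ∀ T : ℝ, TendstoUniformlyOn c a atTop (Icc 0 T) := fun T =>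
    (hcau T).tendstoUniformlyOn_of_tendsto fun t ht => ha t ht.1
  have hacont : ∀ T : ℝ, ContinuousOn a (Icc 0 T) := fun T => by
    refine (hunif T).continuousOn (Eventually.frequently ?_)
    obtain ⟨n₀, hn₀⟩ := exists_nat_ge T
    filter_upwards [eventually_ge_atTop n₀] with n hn
    exact (hcT (hn₀.trans (by exact_mod_cast hn))).continuousOn
  have hcontIci : ContinuousOn a (Ici 0) := fun t ht =>
    ((hacont (t + 1)) t ⟨ht, by linarith⟩).mono_of_mem_nhdsWithin <| by
      rw [← Ici_inter_Iic]
      exact inter_mem self_mem_nhdsWithin (mem_nhdsWithin_of_mem_nhds (Iic_mem_nhds (by linarith)))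
  have hevent : ∀ t : ℝ, ∀ᶠ n : ℕ in atTop, t ≤ n := fun t => by
    obtain ⟨n₀, hn₀⟩ := exists_nat_ge t
    filter_upwards [eventually_ge_atTop n₀] with n hn
    exact hn₀.trans (by exact_mod_cast hn)
  have ha0 : a 0 = a₀ := by
    refine tendsto_nhds_unique (ha 0 le_rfl) ?_
    simp_rw [fun n => (hc n).initial]
    exact tendsto_proj a₀
  refine ⟨a, ⟨hcontIci, ?_⟩, ha0, ?_, ?_, ?_⟩
  · intro N t ht
    have h1 : Tendsto (fun n => proj N (c n t)) atTop (𝓝 (proj N (a t))) :=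
      ((proj N).continuous.tendsto _).comp (ha t ht)
    have h2 : Tendsto (fun n => proj N (c n 0)) atTop (𝓝 (proj N (a 0))) :=
      ((proj N).continuous.tendsto _).comp (ha 0 le_rfl)
    have h3 : Tendsto (fun n => ∫ τ in (0 : ℝ)..t, field F hg N (c n τ)) atTop
        (𝓝 (∫ τ in (0 : ℝ)..t, field F hg N (a τ))) := by
      refine intervalIntegral.tendsto_integral_filter_of_dominated_convergence
        (fun _ => ‖mulOp (cut N g) (hg.bsym N)‖ * Real.sqrt M +
          ‖bilOp F N‖ * Real.sqrt M * Real.sqrt M) ?_ ?_ intervalIntegrable_const ?_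
      · filter_upwards [hevent t] with n hn
        rw [uIoc_of_le ht]
        exact (((continuous_field F hg N).comp_continuousOn (hcT hn).continuousOn).mono
          Ioc_subset_Icc_self).aestronglyMeasurable measurableSet_Ioc
      · filter_upwards [hevent t] with n hn
        refine Eventually.of_forall fun τ hτ => ?_
        rw [uIoc_of_le ht] at hτ
        refine norm_field_le F hg N (Real.le_sqrt_of_sq_le ?_)
        exact hbase n τ ⟨hτ.1.le, by linarith [hτ.2]⟩
      · refine Eventually.of_forall fun τ hτ => ?_
        rw [uIoc_of_le ht] at hτ
        exact ((continuous_field F hg N).tendsto _).comp (ha τ hτ.1.le)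
    refine tendsto_nhds_unique h1 ((h2.add h3).congr' ?_)
    filter_upwards [hevent t, hevent N] with n hn hN
    exact ((hcT hn).proj_eq hN ⟨ht, le_rfl⟩).symm
  · intro t ht
    refine tendsto_nhds_unique ((hermOp.continuous.tendsto _).comp (ha t ht))
      ((ha t ht).congr' ?_)
    filter_upwards [hevent t] with n hn
    exact ((hcT hn).herm t ⟨ht, le_rfl⟩).symm
  · intro t ht
    refine (qf_le_liminf (continuous_sobW s) (fun ξ => (sobW_pos s ξ).le) (ha t ht)).trans ?_
    refine liminf_le_of_frequently_le' (Eventually.frequently ?_)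
    filter_upwards [hevent t] with n hn
    rw [← ofReal_rq_of_proj (continuous_sobW s) ((hcT hn).band t ⟨ht, le_rfl⟩)]
    exact ENNReal.ofReal_le_ofReal
      (hM.rq_le hν₀ (Nat.cast_nonneg n) (by simp) (hc n) ⟨ht, by linarith⟩)
  · intro t ht
    obtain ⟨n₀, hn₀⟩ := exists_nat_ge t
    -- Lower semicontinuity at each time, then Fatou in time. The index is shifted by `n₀` so that
    -- every term of the sequence is defined on `[0, t]`.
    have h0 : ∀ τ ∈ Icc 0 t, qf (gradW s) (a τ) ≤
        liminf (fun n => qf (gradW s) (c (n + n₀) τ)) atTop := fun τ hτ =>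
      qf_le_liminf (continuous_gradW s) (gradW_nonneg s)
        ((tendsto_add_atTop_iff_nat n₀).2 (ha τ hτ.1))
    have hle : ∀ n : ℕ, t ≤ (n + n₀ : ℕ) := fun n => by push_cast; linarith [Nat.cast_nonneg (α := ℝ) n]
    have h1 : ∫⁻ τ in Icc 0 t, qf (gradW s) (a τ) ≤
        liminf (fun n => ∫⁻ τ in Icc 0 t, qf (gradW s) (c (n + n₀) τ)) atTop := by
      refine (setLIntegral_mono' measurableSet_Icc h0).trans (lintegral_liminf_le' fun n => ?_)
      exact aemeasurable_qf (continuous_gradW s).measurable (gradW_nonneg s)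
        (bsym_cut_of_continuous (continuous_gradW s)) measurableSet_Icc (hcT (hle n)).continuousOn
    have h2 : liminf (fun n => ∫⁻ τ in Icc 0 t, qf (gradW s) (c (n + n₀) τ)) atTop ≤
        ENNReal.ofReal (M / ν₀) := by
      refine liminf_le_of_frequently_le' (Frequently.of_forall fun n => ?_)
      have htm : t ∈ Icc 0 (((n + n₀ : ℕ) : ℝ) + 1) := ⟨ht, by linarith [hle n]⟩
      rw [(hc (n + n₀)).lintegral_qf_gradW htm]
      refine ENNReal.ofReal_le_ofReal ?_
      rw [le_div_iff₀ hν₀, mul_comm]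
      exact hM.integral_le (Nat.cast_nonneg _) (by push_cast; linarith [Nat.cast_nonneg (α := ℝ) n])
        (hc (n + n₀)) htm
    calc _ ≤ ENNReal.ofReal ν₀ * ENNReal.ofReal (M / ν₀) := by gcongr; exact h1.trans h2
      _ = ENNReal.ofReal M := by
        rw [← ENNReal.ofReal_mul hν₀.le, mul_div_cancel₀ _ hν₀.ne']

end

end QuasiGeo
end

noncomputable section

namespace QuasiGeo

/-! ### Energy inequalities for solutions of the scalar equation -/

/-- The energy inequality with the dissipation dropped and values in `[0, ∞]`: for a solution known
only in its class, the convolution integral may be infinite at some times. -/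
theorem ofReal_two_mul_inner_mulOp_le {w g : E3 → ℝ} {ν₀ : ℝ} (hν₀ : 0 < ν₀) (hw : BSym w)
    (hw0 : ∀ ξ, 0 ≤ w ξ) (hwD : BSym fun ξ => w ξ * absD ξ ^ 2)
    (hg : ∀ ξ, g ξ ≤ -(ν₀ * absD ξ ^ 2)) {a v : H} {G : E3 → ℂ} {f : E3 → ℝ≥0∞}
    (hf : Measurable f) (hv : ∀ᵐ ξ, w ξ ≠ 0 → v ξ = g ξ * a ξ + G ξ)
    (hG : ∀ᵐ ξ, w ξ ≠ 0 → ‖G ξ‖ₑ ≤ ENNReal.ofReal (absD ξ) * f ξ) :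
    ENNReal.ofReal (2 * inner ℝ (mulOp w hw a) v) ≤
      ENNReal.ofReal ν₀⁻¹ * ∫⁻ ξ, ENNReal.ofReal (w ξ) * f ξ ^ 2 := by
  set I := ∫⁻ ξ, ENNReal.ofReal (w ξ) * f ξ ^ 2 with hI
  rcases eq_or_ne I ∞ with h | h
  · rw [h, ENNReal.mul_top (by simpa using hν₀)]
    exact le_top
  · have h1 := two_mul_inner_mulOp_le hν₀ hw hw0 hwD hg hf hv hG ENNReal.toReal_nonneg
      (by rw [ENNReal.ofReal_toReal h])
    rw [← ENNReal.ofReal_toReal h, ← ENNReal.ofReal_mul (by positivity)]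
    refine ENNReal.ofReal_le_ofReal ?_
    have h2 := mul_nonneg hν₀.le (rq_nonneg (fun ξ => w ξ * absD ξ ^ 2) a)
    rw [inv_mul_eq_div]
    linarith

theorem sq_add_two_le (x y : ℝ≥0∞) : (x + y) ^ 2 ≤ 2 * (x ^ 2 + y ^ 2) := by
  have h := ENNReal.rpow_add_le_mul_rpow_add_rpow x y (p := 2) (by norm_num)
  norm_num at h
  exact_mod_cast h

theorem ofReal_integral_le_lintegral {f : ℝ → ℝ} {t : ℝ} (ht : 0 ≤ t)
    (hf : ContinuousOn f (Icc 0 t)) :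
    ENNReal.ofReal (∫ τ in (0 : ℝ)..t, f τ) ≤ ∫⁻ τ in Icc 0 t, ENNReal.ofReal (f τ) := by
  have hf' : ContinuousOn (fun τ => max (f τ) 0) (Icc 0 t) := hf.sup continuousOn_const
  calc ENNReal.ofReal (∫ τ in (0 : ℝ)..t, f τ)
      ≤ ENNReal.ofReal (∫ τ in (0 : ℝ)..t, max (f τ) 0) :=
        ENNReal.ofReal_le_ofReal (intervalIntegral.integral_mono_on ht
          (hf.intervalIntegrable_of_Icc ht) (hf'.intervalIntegrable_of_Icc ht)
          fun τ _ => le_max_left _ _)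
    _ = ∫⁻ τ in Icc 0 t, ENNReal.ofReal (max (f τ) 0) := by
        rw [intervalIntegral.integral_of_le ht, ← integral_Icc_eq_integral_Ioc,
          ofReal_integral_eq_lintegral_ofReal hf'.integrableOn_Icc
            (Eventually.of_forall fun τ => le_max_right _ _)]
    _ = _ := by
        refine lintegral_congr fun τ => ?_
        rcases le_total (f τ) 0 with h | h
        · rw [max_eq_right h, ENNReal.ofReal_zero, ENNReal.ofReal_of_nonpos h]
        · rw [max_eq_left h]

/-- The fundamental theorem of calculus, keeping only the positive part of the derivative; the
integrand can then be bounded in `[0, ∞]` without integrability conditions. -/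
theorem ofReal_rq_le_add_lintegral {w : E3 → ℝ} (hw : BSym w) (hw0 : ∀ ξ, 0 ≤ w ξ) {c v : ℝ → H}
    {t : ℝ} (ht : 0 ≤ t) (hv : ContinuousOn v (Icc 0 t))
    (hc : ∀ τ ∈ Icc 0 t, c τ = c 0 + ∫ σ in (0 : ℝ)..τ, v σ) :
    ENNReal.ofReal (rq w (c t)) ≤ ENNReal.ofReal (rq w (c 0)) +
      ∫⁻ τ in Icc 0 t, ENNReal.ofReal (2 * inner ℝ (mulOp w hw (c τ)) (v τ)) := by
  have hcont : ContinuousOn c (Icc 0 t) := by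
    refine ContinuousOn.congr (f := fun τ => c 0 + ∫ σ in (0 : ℝ)..τ, v σ)
      (continuousOn_const.add ?_) hc
    have := intervalIntegral.continuousOn_primitive_interval (μ := volume)
      (f := v) (a := 0) (b := t) (by rw [uIcc_of_le ht]; exact hv.integrableOn_Icc)
    rwa [uIcc_of_le ht] at this
  have hder : ∀ τ ∈ Ioo 0 t, HasDerivAt c (v τ) τ := by
    intro τ hτ
    have h1 : HasDerivAt (fun τ => ∫ σ in (0 : ℝ)..τ, v σ) (v τ) τ := by
      refine intervalIntegral.integral_hasDerivAt_right ?_ ?_ ?_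
      · exact (hv.mono (Icc_subset_Icc_right hτ.2.le)).intervalIntegrable_of_Icc hτ.1.le
      · exact ContinuousOn.stronglyMeasurableAtFilter isOpen_Ioo (hv.mono Ioo_subset_Icc_self) τ hτ
      · exact hv.continuousAt (Icc_mem_nhds hτ.1 hτ.2)
    refine (h1.const_add (c 0)).congr_of_eventuallyEq ?_
    filter_upwards [Ioo_mem_nhds hτ.1 hτ.2] with σ hσ
    exact hc σ (Ioo_subset_Icc_self hσ)
  have hdc : ContinuousOn (fun τ => 2 * inner ℝ (mulOp w hw (c τ)) (v τ)) (Icc 0 t) :=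
    continuousOn_const.mul (((mulOp w hw).continuous.comp_continuousOn hcont).inner hv)
  have h2 := intervalIntegral.integral_eq_sub_of_hasDeriv_right_of_le (a := 0) (b := t)
    (f := fun t => rq w (c t)) (f' := fun τ => 2 * inner ℝ (mulOp w hw (c τ)) (v τ)) ht
    (continuousOn_rq hw hw0 hcont)
    (fun τ hτ => hasDerivWithinAt_rq hw hw0 (hder τ hτ).hasDerivWithinAt)
    (hdc.intervalIntegrable_of_Icc ht)
  have h3 : rq w (c t) = rq w (c 0) + ∫ τ in (0 : ℝ)..t, 2 * inner ℝ (mulOp w hw (c τ)) (v τ) := by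
    rw [h2]; ring
  rw [h3]
  exact ENNReal.ofReal_add_le.trans (add_le_add le_rfl (ofReal_integral_le_lintegral ht hdc))

theorem qf_cut_proj (N : ℝ) (m : E3 → ℝ) (a : H) : qf (cut N m) (proj N a) = qf (cut N m) a := by
  refine lintegral_congr_ae ?_
  filter_upwards [proj_coe N a] with ξ hξ
  by_cases hN : absD ξ < N
  · rw [hξ, if_pos hN]
  · rw [cut_of_not_lt hN]; simp

theorem bsym_cut_tailW {s : ℝ} (R N : ℝ) : BSym (cut N (tailW s R)) := by
  obtain ⟨-, C, hC⟩ := bsym_cut_of_continuous (continuous_sobW s) N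
  refine bsym_cut (C := C) (measurable_tailW s R) fun ξ h => ?_
  have h1 := hC ξ
  rw [cut_of_lt h, abs_of_pos (sobW_pos s ξ)] at h1
  rw [abs_of_nonneg (tailW_nonneg s R ξ)]
  exact (tailW_le_sobW s R ξ).trans h1

theorem bsym_cut_tailW_mul {s : ℝ} (R N : ℝ) : BSym fun ξ => cut N (tailW s R) ξ * absD ξ ^ 2 := by
  rw [cut_mul_eq]
  obtain ⟨-, C, hC⟩ := bsym_cut_of_continuous (continuous_gradW s) N
  refine bsym_cut (C := C) (by fun_prop) fun ξ h => ?_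
  have h1 := hC ξ
  rw [cut_of_lt h, abs_of_nonneg (gradW_nonneg s ξ)] at h1
  rw [abs_of_nonneg (mul_nonneg (tailW_nonneg s R ξ) (sq_nonneg _))]
  refine le_trans ?_ h1
  rw [gradW]
  gcongr
  exact tailW_le_sobW s R ξ

section

variable {ν₀ : ℝ} {g : E3 → ℝ} {F : ℝ} {hg : DiffSym ν₀ g} {a b : ℝ → H}

/-- Propagation of the high-frequency part of the `H^s` norm. -/
theorem IsScalarSol.qf_tailW_le (hν₀ : 0 < ν₀) (h : IsScalarSol F hg a) {s : ℝ} (hs : 0 ≤ s)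
    (R : ℝ) {t : ℝ} (ht : 0 ≤ t) :
    qf (tailW s R) (a t) ≤ qf (tailW s R) (a 0) + ∫⁻ τ in Icc 0 t, ENNReal.ofReal ν₀⁻¹ *
      (4 * ENNReal.ofReal (4 ^ s) * (oneNorm (a τ) ^ 2 * qf (tailW s (R / 2)) (a τ))) := by
  -- A general solution satisfies a differential equation only after projection, so the estimate is
  -- made with the weight cut at `|D| < N`, and the supremum over `N` is taken.
  rw [← iSup_qf_cut (measurable_tailW s R) (tailW_nonneg s R) (measurable_coe (a t))]
  refine iSup_le fun n => ?_
  set N : ℝ := (n : ℝ) with hN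
  set w := cut N (tailW s R) with hwdef
  have hw : BSym w := bsym_cut_tailW R N
  have hw0 : ∀ ξ, 0 ≤ w ξ := cut_nonneg (tailW_nonneg s R)
  have hsub : Icc 0 t ⊆ Ici 0 := Icc_subset_Ici_self
  have h1 := ofReal_rq_le_add_lintegral hw hw0 (c := fun t => proj N (a t))
    (v := fun t => field F hg N (a t)) ht
    ((continuous_field F hg N).comp_continuousOn (h.continuousOn.mono hsub))
    (fun τ hτ => h.eq N τ hτ.1)
  rw [ofReal_rq hw, ofReal_rq hw, qf_cut_proj, qf_cut_proj] at h1
  refine h1.trans (add_le_add (qf_mono (cut_le (tailW_nonneg s R)) _) (lintegral_mono fun τ => ?_))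
  have hm := measurable_coe (a τ)
  set f := lconv (fun η => ‖a τ η‖ₑ) (fun η => ‖a τ η‖ₑ) with hf
  refine (ofReal_two_mul_inner_mulOp_le hν₀ hw hw0 (bsym_cut_tailW_mul R N) hg.le
    (G := fun ξ => -bil F (a τ) (a τ) ξ) (f := f)
    (measurable_lconv (by fun_prop) (by fun_prop)) ?_ ?_).trans ?_
  · filter_upwards [field_coe F hg N (a τ), proj_coe N (a τ)] with ξ h1 h2 hwξ
    have hξ : absD ξ < N := by
      by_contra h2
      exact hwξ (cut_of_not_lt h2)
    rw [h1, h2, if_pos hξ, if_pos hξ, sub_eq_add_neg]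
  · refine Eventually.of_forall fun ξ _ => ?_
    rw [enorm_neg]
    exact enorm_bil_le F hm hm ξ
  · have h1 := lintegral_weight_sq_lconv_le (f := fun η => ‖a τ η‖ₑ) (g := fun η => ‖a τ η‖ₑ)
      (w := fun ξ => ENNReal.ofReal (tailW s R ξ)) (w' := fun ξ => ENNReal.ofReal (tailW s (R / 2) ξ))
      (by fun_prop) (by fun_prop) (by fun_prop) (ofReal_tailW_le_add hs R)
    change _ ≤ 2 * ENNReal.ofReal (4 ^ s) * (oneNorm (a τ) ^ 2 * qf (tailW s (R / 2)) (a τ) +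
      oneNorm (a τ) ^ 2 * qf (tailW s (R / 2)) (a τ)) at h1
    gcongr
    calc ∫⁻ ξ, ENNReal.ofReal (w ξ) * f ξ ^ 2
        ≤ ∫⁻ ξ, ENNReal.ofReal (tailW s R ξ) * f ξ ^ 2 := by
          refine lintegral_mono fun ξ => ?_
          gcongr
          exact cut_le (tailW_nonneg s R) ξ
      _ ≤ _ := h1
      _ = _ := by ring

theorem tendsto_qf_tailW {s : ℝ} {a : E3 → ℂ} (ha : Measurable a) (h : qf (sobW s) a ≠ ∞)
    {R : ℕ → ℝ} (hR : Tendsto R atTop atTop) :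
    Tendsto (fun n => qf (tailW s (R n)) a) atTop (𝓝 0) := by
  have h1 := tendsto_lintegral_of_dominated_convergence
    (F := fun (n : ℕ) ξ => ENNReal.ofReal (tailW s (R n) ξ) * ‖a ξ‖ₑ ^ 2) (f := fun _ => 0)
    (μ := volume) (fun ξ => ENNReal.ofReal (sobW s ξ) * ‖a ξ‖ₑ ^ 2) (fun n => by fun_prop)
    (fun n => Eventually.of_forall fun ξ => by dsimp only; gcongr; exact tailW_le_sobW s _ ξ) h
    (Eventually.of_forall fun ξ => ?_)
  · simpa [qf] using h1
  · refine tendsto_const_nhds.congr' ?_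
    filter_upwards [hR.eventually_gt_atTop (absD ξ)] with n hn
    rw [tailW, indicator_of_notMem (by simpa using hn)]
    simp

/-- Below frequency `R` the H^s weight is bounded, so L² closeness suffices; above `R` each
function's tail is used and closeness is not needed. -/
theorem qf_sub_le (s R : ℝ) (hs : 0 ≤ s) (x y : H) :
    qf (sobW s) (x - y : H) ≤ ENNReal.ofReal ((1 + R ^ 2) ^ s * ‖x - y‖ ^ 2) +
      2 * (qf (tailW s R) x + qf (tailW s R) y) := by
  have hx := measurable_coe x
  have hy := measurable_coe y
  have hxy := measurable_coe (x - y)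
  have e2 : qf (tailW s R) (x - y : H) ≤ 2 * (qf (tailW s R) x + qf (tailW s R) y) := by
    unfold qf
    rw [← lintegral_add_left (by fun_prop), ← lintegral_const_mul _ (by fun_prop)]
    refine lintegral_mono_ae ?_
    filter_upwards [Lp.coeFn_sub x y] with ξ h1
    rw [h1, Pi.sub_apply]
    calc ENNReal.ofReal (tailW s R ξ) * ‖x ξ - y ξ‖ₑ ^ 2
        ≤ ENNReal.ofReal (tailW s R ξ) * (2 * (‖x ξ‖ₑ ^ 2 + ‖y ξ‖ₑ ^ 2)) := by
          gcongr
          have h3 := sq_add_two_le ‖x ξ‖ₑ ‖y ξ‖ₑ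
          exact (pow_le_pow_left' enorm_sub_le 2).trans h3
      _ = _ := by ring
  rw [← qf_const _ (by positivity)]
  refine le_trans ?_ (add_le_add le_rfl e2)
  by_cases hR : 0 ≤ R
  · unfold qf
    rw [← lintegral_add_left (by fun_prop)]
    refine lintegral_mono fun ξ => ?_
    rw [← add_mul, ← ENNReal.ofReal_add (by positivity) (tailW_nonneg s R ξ)]
    gcongr
    by_cases hξ : R ≤ absD ξ
    · rw [tailW, indicator_of_mem (by exact hξ)]
      have : 0 ≤ (1 + R ^ 2) ^ s := by positivity
      linarith
    · have h1 := tailW_nonneg s R ξ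
      have h2 : sobW s ξ ≤ (1 + R ^ 2) ^ s := by
        have := absD_nonneg ξ
        rw [sobW]
        gcongr
        exact (not_le.1 hξ).le
      linarith
  · refine le_add_left (qf_mono (fun ξ => ?_) _)
    rw [tailW, indicator_of_mem (show ξ ∈ {ξ | R ≤ absD ξ} from
      (not_le.1 hR).le.trans (absD_nonneg ξ))]

/-- Continuity in `H^s` of solutions bounded in `H^s`. -/
theorem IsScalarSol.tendsto_qf_sub (hν₀ : 0 < ν₀) (h : IsScalarSol F hg a) {s : ℝ} (hs : 1 / 2 < s)
    {M : ℝ≥0∞} (hM : M ≠ ∞) (haM : ∀ t, 0 ≤ t → qf (sobW s) (a t) ≤ M)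
    (hint : ∀ T : ℝ, ∫⁻ τ in Icc 0 T, qf (sobW (s + 1)) (a τ) ≠ ∞) {t : ℝ} (ht : 0 ≤ t) :
    Tendsto (fun τ => qf (sobW s) (a τ - a t : H)) (𝓝[Ici 0] t) (𝓝 0) := by
  obtain ⟨C, hC, hCb⟩ := exists_sq_oneNorm_le_qf_sobW hs
  have hs0 : 0 ≤ s := by linarith
  set T := t + 1 with hT
  have hcT : ContinuousOn a (Icc 0 T) := h.continuousOn.mono Icc_subset_Ici_self
  set κ : ℝ≥0∞ := ENNReal.ofReal ν₀⁻¹ * (4 * ENNReal.ofReal (4 ^ s)) * ENNReal.ofReal C with hκ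
  have hκt : κ ≠ ∞ := by
    rw [hκ]
    exact ENNReal.mul_ne_top (ENNReal.mul_ne_top ENNReal.ofReal_ne_top
      (ENNReal.mul_ne_top (by simp) ENNReal.ofReal_ne_top)) ENNReal.ofReal_ne_top
  have hmk : AEMeasurable (fun τ => qf (sobW (s + 1)) (a τ)) (volume.restrict (Icc 0 T)) :=
    aemeasurable_qf (measurable_sobW _) (fun ξ => (sobW_pos _ ξ).le)
      (bsym_cut_of_continuous (continuous_sobW _)) measurableSet_Icc hcT
  -- A single quantity bounding the tails at all times in `[0, T]`. It tends to 0 by dominated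
  -- convergence, the dominating function being a multiple of the integrable squared H^(s+1) norm.
  set E : ℕ → ℝ≥0∞ := fun n => qf (tailW s n) (a 0) + ∫⁻ τ in Icc 0 T,
    κ * (qf (sobW (s + 1)) (a τ) * qf (tailW s ((n : ℝ) / 2)) (a τ)) with hE
  have htail : ∀ n : ℕ, ∀ τ ∈ Icc 0 T, qf (tailW s n) (a τ) ≤ E n := by
    intro n τ hτ
    refine (h.qf_tailW_le hν₀ hs0 n hτ.1).trans (add_le_add le_rfl ?_)
    refine (lintegral_mono fun σ => ?_).trans (lintegral_mono_set (Icc_subset_Icc_right hτ.2))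
    calc _ ≤ ENNReal.ofReal ν₀⁻¹ * (4 * ENNReal.ofReal (4 ^ s) *
          ((ENNReal.ofReal C * qf (sobW (s + 1)) (a σ)) * qf (tailW s ((n : ℝ) / 2)) (a σ))) := by
          gcongr
          exact hCb _ (measurable_coe _)
      _ = _ := by rw [hκ]; ring
  have hE0 : Tendsto E atTop (𝓝 0) := by
    rw [← add_zero (0 : ℝ≥0∞)]
    refine Tendsto.add (tendsto_qf_tailW (measurable_coe _)
      (ne_top_of_le_ne_top hM (haM 0 le_rfl)) tendsto_natCast_atTop_atTop) ?_
    have hR : Tendsto (fun n : ℕ => (n : ℝ) / 2) atTop atTop :=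
      tendsto_natCast_atTop_atTop.atTop_div_const two_pos
    have hfin : ∀ᵐ τ ∂volume.restrict (Icc 0 T), qf (sobW (s + 1)) (a τ) < ∞ :=
      ae_lt_top' hmk (hint T)
    have h1 := tendsto_lintegral_of_dominated_convergence' (μ := volume.restrict (Icc 0 T))
      (F := fun (n : ℕ) τ => κ * (qf (sobW (s + 1)) (a τ) * qf (tailW s ((n : ℝ) / 2)) (a τ)))
      (f := fun _ => 0) (fun τ => κ * (qf (sobW (s + 1)) (a τ) * M))
      (fun n => (hmk.mul (aemeasurable_qf (measurable_tailW _ _) (tailW_nonneg _ _)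
        (bsym_cut_tailW _) measurableSet_Icc hcT)).const_mul κ)
      (fun n => (ae_restrict_iff' measurableSet_Icc).2 (Eventually.of_forall fun τ hτ => by
        dsimp only
        gcongr
        exact (qf_mono (tailW_le_sobW s _) _).trans (haM τ hτ.1))) ?_ ?_
    · simpa using h1
    · rw [lintegral_const_mul' _ _ hκt, lintegral_mul_const' _ _ hM]
      exact ENNReal.mul_ne_top hκt (ENNReal.mul_ne_top (hint T) hM)
    · filter_upwards [hfin, ae_restrict_mem measurableSet_Icc] with τ h2 hτ
      have h3 := tendsto_qf_tailW (measurable_coe (a τ))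
        (ne_top_of_le_ne_top hM (haM τ hτ.1)) hR
      have h4 := ENNReal.Tendsto.const_mul (ENNReal.Tendsto.const_mul h3 (Or.inr h2.ne))
        (Or.inr hκt)
      simpa using h4
  rw [ENNReal.tendsto_nhds_zero]
  intro ε hε
  rcases eq_or_ne ε ∞ with rfl | hεt
  · exact Eventually.of_forall fun _ => le_top
  have hε8 : 0 < ε / 8 := ENNReal.div_pos hε.ne' (by simp)
  obtain ⟨n, hn⟩ := (hE0.eventually (gt_mem_nhds hε8)).exists
  have hsq : Tendsto (fun τ => ENNReal.ofReal ((1 + (n : ℝ) ^ 2) ^ s * ‖a τ - a t‖ ^ 2)) (𝓝[Ici 0] t)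
      (𝓝 0) := by
    have h1 : Tendsto (fun τ => a τ - a t) (𝓝[Ici 0] t) (𝓝 0) := by
      have := (h.continuousOn t ht).sub_const (a t)
      simpa [ContinuousWithinAt] using this
    have h2 := ENNReal.tendsto_ofReal ((h1.norm.pow 2).const_mul ((1 + (n : ℝ) ^ 2) ^ s))
    simpa using h2
  have hε2 : 0 < ε / 2 := ENNReal.div_pos hε.ne' (by simp)
  filter_upwards [hsq.eventually (gt_mem_nhds hε2), self_mem_nhdsWithin,
    mem_nhdsWithin_of_mem_nhds (Iic_mem_nhds (show t < T by linarith))] with τ h1 h2 h3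
  refine (qf_sub_le s n hs0 (a τ) (a t)).trans ?_
  have h4 := (htail n τ ⟨h2, h3⟩).trans hn.le
  have h5 := (htail n t ⟨ht, by linarith⟩).trans hn.le
  calc _ ≤ ε / 2 + 2 * (ε / 8 + ε / 8) := by gcongr
    _ = ε := by
      rw [← ENNReal.ofReal_toReal hεt]
      rw [show (2 : ℝ≥0∞) = ENNReal.ofReal 2 by simp, show (8 : ℝ≥0∞) = ENNReal.ofReal 8 by simp,
        ← ENNReal.ofReal_div_of_pos (by norm_num), ← ENNReal.ofReal_div_of_pos (by norm_num),
        ← ENNReal.ofReal_add (by positivity) (by positivity), ← ENNReal.ofReal_mul (by positivity),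
        ← ENNReal.ofReal_add (by positivity) (by positivity)]
      congr 1; ring

/-- Uniqueness for the scalar equation. -/
theorem IsScalarSol.unique (hν₀ : 0 < ν₀) (ha : IsScalarSol F hg a) (hb : IsScalarSol F hg b)
    {s : ℝ} (hs : 1 / 2 < s)
    (hai : ∀ T : ℝ, ∫⁻ τ in Icc 0 T, qf (sobW (s + 1)) (a τ) ≠ ∞)
    (hbi : ∀ T : ℝ, ∫⁻ τ in Icc 0 T, qf (sobW (s + 1)) (b τ) ≠ ∞) (h0 : a 0 = b 0) {t : ℝ}
    (ht : 0 ≤ t) : a t = b t := by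
  obtain ⟨C, hC, hCb⟩ := exists_sq_oneNorm_le_qf_sobW hs
  set D : ℝ → ℝ≥0∞ := fun t => ENNReal.ofReal (‖a t - b t‖ ^ 2) with hD
  -- The L² difference is driven by the squared L¹ norms of the two solutions, each dominated by the
  -- squared H^(s+1) norm, which is integrable in time.
  set k : ℝ → ℝ≥0∞ := fun t => ENNReal.ofReal ν₀⁻¹ * (2 * (ENNReal.ofReal C *
    (qf (sobW (s + 1)) (a t) + qf (sobW (s + 1)) (b t)))) with hk
  have hcont : ContinuousOn (fun t => ‖a t - b t‖ ^ 2) (Icc 0 t) :=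
    ((ha.continuousOn.mono Icc_subset_Ici_self).sub
      (hb.continuousOn.mono Icc_subset_Ici_self)).norm.pow 2
  obtain ⟨M, hM⟩ := isCompact_Icc.exists_bound_of_continuousOn hcont
  have hz := eq_zero_of_le_lintegral_mul (D := D) (k := k) (T := t) (M := ENNReal.ofReal M)
    ENNReal.ofReal_ne_top (fun τ hτ => ENNReal.ofReal_le_ofReal
      ((le_abs_self _).trans (hM τ hτ))) ?_ ?_ t ⟨ht, le_rfl⟩
  · rw [hD, ENNReal.ofReal_eq_zero] at hz
    have h1 : ‖a t - b t‖ ^ 2 = 0 := le_antisymm hz (sq_nonneg _)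
    rwa [sq_eq_zero_iff, norm_eq_zero, sub_eq_zero] at h1
  · rw [hk, lintegral_const_mul' _ _ ENNReal.ofReal_ne_top, lintegral_const_mul' _ _ (by simp),
      lintegral_const_mul' _ _ ENNReal.ofReal_ne_top, lintegral_add_left']
    · exact ENNReal.mul_ne_top ENNReal.ofReal_ne_top (ENNReal.mul_ne_top (by simp)
        (ENNReal.mul_ne_top ENNReal.ofReal_ne_top (ENNReal.add_ne_top.2 ⟨hai t, hbi t⟩)))
    · exact aemeasurable_qf (measurable_sobW _) (fun ξ => (sobW_pos _ ξ).le)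
        (bsym_cut_of_continuous (continuous_sobW _)) measurableSet_Icc
        (ha.continuousOn.mono Icc_subset_Ici_self)
  · intro t ht
    rw [hD]
    dsimp only
    rw [← qf_one, ← iSup_qf_cut measurable_const (fun _ => zero_le_one) (measurable_coe _)]
    refine iSup_le fun n => ?_
    set N : ℝ := (n : ℝ) with hN
    set w := cut N (fun _ => (1 : ℝ)) with hwdef
    have hw : BSym w := bsym_cut_one N
    have hw0 : ∀ ξ, 0 ≤ w ξ := cut_nonneg fun _ => zero_le_one
    have hwD : BSym fun ξ => w ξ * absD ξ ^ 2 := by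
      rw [hwdef, cut_mul_eq]
      exact bsym_cut_of_continuous (by fun_prop) N
    have hac : ContinuousOn (fun τ => field F hg N (a τ)) (Icc 0 t) := (continuous_field F hg N).comp_continuousOn
      (ha.continuousOn.mono (show Icc 0 t ⊆ Ici 0 from Icc_subset_Ici_self))
    have hbc : ContinuousOn (fun τ => field F hg N (b τ)) (Icc 0 t) := (continuous_field F hg N).comp_continuousOn
      (hb.continuousOn.mono (show Icc 0 t ⊆ Ici 0 from Icc_subset_Ici_self))
    have h1 := ofReal_rq_le_add_lintegral hw hw0 (c := fun t => proj N (a t - b t))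
      (v := fun t => field F hg N (a t) - field F hg N (b t)) ht.1 (hac.sub hbc)
      (fun τ hτ => by
        have hsub : Icc 0 τ ⊆ Icc 0 t := Icc_subset_Icc_right hτ.2
        rw [intervalIntegral.integral_sub ((hac.mono hsub).intervalIntegrable_of_Icc hτ.1)
          ((hbc.mono hsub).intervalIntegrable_of_Icc hτ.1), map_sub, map_sub, ha.eq N τ hτ.1,
          hb.eq N τ hτ.1]
        abel)
    rw [ofReal_rq hw, ofReal_rq hw, qf_cut_proj, qf_cut_proj] at h1
    have e0 : qf w (a 0 - b 0 : H) = 0 := by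
      rw [h0, sub_self, ← ofReal_rq hw, rq_eq_inner hw hw0]; simp
    rw [e0, zero_add] at h1
    refine h1.trans (lintegral_mono fun τ => ?_)
    set W := a τ - b τ with hW
    have hma := measurable_coe (a τ)
    have hmb := measurable_coe (b τ)
    have hmW := measurable_coe W
    set f1 := lconv (fun η => ‖a τ η‖ₑ) (fun η => ‖W η‖ₑ) with hf1
    set f2 := lconv (fun η => ‖b τ η‖ₑ) (fun η => ‖W η‖ₑ) with hf2
    have hf1m : Measurable f1 := measurable_lconv (by fun_prop) (by fun_prop)
    have hf2m : Measurable f2 := measurable_lconv (by fun_prop) (by fun_prop)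
    refine (ofReal_two_mul_inner_mulOp_le hν₀ hw hw0 hwD hg.le
      (G := fun ξ => -(bil F W (a τ) ξ + bil F (b τ) W ξ)) (f := fun ξ => f1 ξ + f2 ξ)
      (by fun_prop) ?_ ?_).trans ?_
    · filter_upwards [field_coe F hg N (a τ), field_coe F hg N (b τ), proj_coe N W,
        Lp.coeFn_sub (a τ) (b τ), Lp.coeFn_sub (field F hg N (a τ)) (field F hg N (b τ))]
        with ξ h1 h2 h3 h4 h5 hwξ
      have hξ : absD ξ < N := by
        by_contra h2
        exact hwξ (cut_of_not_lt h2)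
      rw [h5, Pi.sub_apply, h1, h2, h3, if_pos hξ, if_pos hξ, if_pos hξ, h4, Pi.sub_apply,
        ← bil_self_sub]
      ring
    · refine Eventually.of_forall fun ξ _ => ?_
      rw [enorm_neg, mul_add]
      refine (enorm_add_le _ _).trans (add_le_add ?_ ?_)
      · rw [hf1, lconv_comm]
        exact enorm_bil_le F hmW hma ξ
      · exact enorm_bil_le F hmb hmW ξ
    · rw [hk, mul_assoc]
      gcongr
      have e1 : ∫⁻ ξ, f1 ξ ^ 2 ≤ ENNReal.ofReal C * qf (sobW (s + 1)) (a τ) * D τ := by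
        refine (lintegral_sq_lconv_le (by fun_prop) (by fun_prop)).trans ?_
        rw [lintegral_enorm_sq]
        gcongr
        exact hCb _ hma
      have e2 : ∫⁻ ξ, f2 ξ ^ 2 ≤ ENNReal.ofReal C * qf (sobW (s + 1)) (b τ) * D τ := by
        refine (lintegral_sq_lconv_le (by fun_prop) (by fun_prop)).trans ?_
        rw [lintegral_enorm_sq]
        gcongr
        exact hCb _ hmb
      calc ∫⁻ ξ, ENNReal.ofReal (w ξ) * (f1 ξ + f2 ξ) ^ 2
          ≤ ∫⁻ ξ, 2 * (f1 ξ ^ 2 + f2 ξ ^ 2) := by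
            refine lintegral_mono fun ξ => ?_
            refine (mul_le_of_le_one_left' ?_).trans (sq_add_two_le _ _)
            rw [ENNReal.ofReal_le_one]
            exact cut_le (fun _ => zero_le_one) ξ
        _ = 2 * ((∫⁻ ξ, f1 ξ ^ 2) + ∫⁻ ξ, f2 ξ ^ 2) := by
            rw [lintegral_const_mul _ (by fun_prop), lintegral_add_left (by fun_prop)]
        _ ≤ 2 * (ENNReal.ofReal C * qf (sobW (s + 1)) (a τ) * D τ +
              ENNReal.ofReal C * qf (sobW (s + 1)) (b τ) * D τ) := by gcongr
        _ = _ := by ring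

end

end QuasiGeo
end

noncomputable section

namespace QuasiGeo

/-! ### The Fourier transform on `L²` -/

section

variable {G G' : Type*} [NormedAddCommGroup G] [InnerProductSpace ℂ G] [CompleteSpace G]
  [NormedAddCommGroup G'] [InnerProductSpace ℂ G'] [CompleteSpace G']

theorem integral_smul_fourier_eq (f : Lp (α := E3) G 2 volume) (ψ : SchwartzMap E3 ℂ) :
    ∫ ξ, ψ ξ • (𝓕 f : Lp (α := E3) G 2 volume) ξ = ∫ x, 𝓕 ψ x • f x := by
  have h := Lp.fourier_toTemperedDistribution_eq f
  have h2 := congrArg (fun T => T ψ) h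
  simp only [TemperedDistribution.fourier_apply, Lp.toTemperedDistribution_apply] at h2
  exact h2.symm

/-- An L² function is determined by its tempered distribution. This lets identities for the
Plancherel transform be checked on Schwartz functions, where the transform is an integral. -/
theorem fourier_eq_of_integral_smul {f v : Lp (α := E3) G 2 volume}
    (h : ∀ ψ : SchwartzMap E3 ℂ, ∫ ξ, ψ ξ • v ξ = ∫ x, 𝓕 ψ x • f x) : 𝓕 f = v := by
  have hker := Lp.ker_toTemperedDistributionCLM_eq_bot (F := G) (μ := (volume : Measure E3)) (p := 2)
  refine (LinearMap.ker_eq_bot.1 hker) ?_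
  ext ψ
  have h1 := integral_smul_fourier_eq f ψ
  rw [← h ψ] at h1
  simpa [Lp.toTemperedDistribution_apply] using h1

theorem integrable_schwartz_smul {B : Type*} [NormedAddCommGroup B] [InnerProductSpace ℂ B]
    (ψ : SchwartzMap E3 ℂ) (f : Lp (α := E3) B 2 volume) :
    Integrable fun x => ψ x • f x :=
  memLp_one_iff_integrable.1 ((Lp.memLp f).smul (r := 1) (ψ.memLp 2 volume))

theorem fourier_compLp (L : G →L[ℂ] G') (f : Lp (α := E3) G 2 volume) :
    𝓕 (L.compLp f) = L.compLp (𝓕 f) := by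
  refine fourier_eq_of_integral_smul fun ψ => ?_
  calc ∫ ξ, ψ ξ • (L.compLp (𝓕 f)) ξ
      = ∫ ξ, L (ψ ξ • (𝓕 f : Lp (α := E3) G 2 volume) ξ) := by
        refine integral_congr_ae ?_
        filter_upwards [L.coeFn_compLp (𝓕 f)] with ξ h
        rw [h, map_smul]
    _ = ∫ x, L (𝓕 ψ x • f x) := by
        rw [L.integral_comp_comm (integrable_schwartz_smul ψ _), integral_smul_fourier_eq,
          ← L.integral_comp_comm (integrable_schwartz_smul (𝓕 ψ) _)]
    _ = _ := by
        refine integral_congr_ae ?_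
        filter_upwards [L.coeFn_compLp f] with x h
        rw [h, map_smul]

end

/-- The Schwartz function `η ↦ conj (ψ (ξ - η))`. -/
def conjReflect (ψ : SchwartzMap E3 ℂ) (ξ : E3) : SchwartzMap E3 ℂ :=
  SchwartzMap.postcompCLM (𝕜 := ℝ) (Complex.conjCLE : ℂ →L[ℝ] ℂ)
    (SchwartzMap.compCLMOfContinuousLinearEquiv ℝ (ContinuousLinearEquiv.neg ℝ : E3 ≃L[ℝ] E3)
      (SchwartzMap.compSubConstCLM ℝ (-ξ) ψ))

theorem conjReflect_apply (ψ : SchwartzMap E3 ℂ) (ξ η : E3) :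
    conjReflect ψ ξ η = (starRingEnd ℂ) (ψ (ξ - η)) := by
  simp [conjReflect, sub_eq_add_neg, add_comm]

theorem conj_smul_circle (z : Circle) (w : ℂ) :
    (starRingEnd ℂ) (z • w) = z⁻¹ • (starRingEnd ℂ) w := by
  rw [Circle.smul_def, Circle.smul_def, smul_eq_mul, smul_eq_mul, map_mul, Circle.coe_inv_eq_conj]

theorem fourier_conjReflect (ψ : SchwartzMap E3 ℂ) (ξ x : E3) :
    𝓕 (conjReflect ψ ξ) x =
      (starRingEnd ℂ) (Real.fourierChar (inner ℝ x ξ) • 𝓕 ψ x) := by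
  rw [SchwartzMap.fourier_coe, SchwartzMap.fourier_coe, Real.fourier_eq, Real.fourier_eq]
  rw [← integral_sub_left_eq_self _ volume ξ, Circle.smul_def, ← integral_smul,
    ← integral_conj]
  refine integral_congr_ae (Eventually.of_forall fun η => ?_)
  simp only [conjReflect_apply, sub_sub_cancel]
  rw [← Circle.smul_def, smul_smul, ← AddChar.map_add_eq_mul, conj_smul_circle,
    ← AddChar.map_neg_eq_inv, inner_sub_left, real_inner_comm x ξ]
  congr 3

/-- Modulation and conjugation under the Fourier transform. -/
theorem fourier_eq_of_modulation {u m v : H} (ξ : E3)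
    (hm : m =ᵐ[volume] fun x => Real.fourierChar (inner ℝ x ξ) • (starRingEnd ℂ) (u x))
    (hv : v =ᵐ[volume] fun η => (starRingEnd ℂ) ((𝓕 u : H) (ξ - η))) : 𝓕 m = v := by
  refine fourier_eq_of_integral_smul fun ψ => ?_
  calc ∫ η, ψ η • v η = ∫ η, ψ η • (starRingEnd ℂ) ((𝓕 u : H) (ξ - η)) :=
        integral_congr_ae (by filter_upwards [hv] with η h; rw [h])
    _ = ∫ η, ψ (ξ - η) • (starRingEnd ℂ) ((𝓕 u : H) η) := by
        rw [← integral_sub_left_eq_self _ volume ξ]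
        simp
    _ = (starRingEnd ℂ) (∫ η, conjReflect ψ ξ η • (𝓕 u : H) η) := by
        rw [← integral_conj]
        refine integral_congr_ae (Eventually.of_forall fun η => ?_)
        simp [conjReflect_apply]
    _ = (starRingEnd ℂ) (∫ x, 𝓕 (conjReflect ψ ξ) x • u x) := by rw [integral_smul_fourier_eq]
    _ = ∫ x, 𝓕 ψ x • m x := by
        rw [← integral_conj]
        refine integral_congr_ae ?_
        filter_upwards [hm] with x h
        rw [h, fourier_conjReflect, smul_eq_mul, map_mul, Complex.conj_conj, smul_eq_mul,
          Circle.smul_def, Circle.smul_def, smul_eq_mul, smul_eq_mul]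
        ring

/-- Real-valued elements of `L²(ℂ)`. -/
def IsRealValued (u : H) : Prop := ∀ᵐ x, (starRingEnd ℂ) (u x) = u x

theorem IsRealValued.hermOp_fourier {u : H} (hu : IsRealValued u) : hermOp (𝓕 u) = 𝓕 u := by
  refine (fourier_eq_of_modulation (u := u) 0 ?_ ?_).symm
  · filter_upwards [hu] with x h
    simp [h]
  · filter_upwards [hermOp_coe (𝓕 u)] with η h
    rw [h, zero_sub]

/-- The conjugate of the inverse transform has the same Fourier transform `v`, so the two coincide
by injectivity. -/
theorem isRealValued_fourierInv {v : H} (hv : hermOp v = v) : IsRealValued (𝓕⁻ v : H) := by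
  set u : H := 𝓕⁻ v with hu
  have hmem : MemLp (fun x => (starRingEnd ℂ) (u x)) 2 volume :=
    (Lp.memLp u).of_le (Complex.continuous_conj.comp_aestronglyMeasurable
      (Lp.aestronglyMeasurable u)) (by simp)
  have huv : 𝓕 u = v := by rw [hu]; exact fourier_fourierInv_eq v
  have h1 : 𝓕 (hmem.toLp _) = v := by
    refine fourier_eq_of_modulation (u := u) 0 ?_ ?_
    · filter_upwards [hmem.coeFn_toLp] with x h
      rw [h]; simp
    · rw [huv]
      have h2 := hermOp_coe v
      rw [hv] at h2
      filter_upwards [h2] with η h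
      rw [zero_sub]; exact h
  have h2 : hmem.toLp _ = u := by
    have := congrArg (fun w : H => (𝓕⁻ w : H)) (h1.trans huv.symm)
    simpa only [fourierInv_fourier_eq] using this
  have h3 := hmem.coeFn_toLp
  rw [h2] at h3
  filter_upwards [h3] with x h
  exact h.symm

theorem integral_mul_fourierInv_eq {f h : E3 → ℂ} (hf : Integrable f) (hh : Integrable h) :
    ∫ x, f x * 𝓕⁻ h x = ∫ ξ, 𝓕⁻ f ξ * h ξ := by
  have h1 := VectorFourier.integral_fourierIntegral_smul_eq_flip (μ := (volume : Measure E3))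
    (ν := (volume : Measure E3)) (L := -innerₗ E3) (e := Real.fourierChar) (f := f) (g := h)
    Real.continuous_fourierChar (by
      simp only [LinearMap.neg_apply, innerₗ_apply_apply]
      fun_prop) hf hh
  have e1 : VectorFourier.fourierIntegral Real.fourierChar volume (-innerₗ E3) f = 𝓕⁻ f := by
    rfl
  have e2 : VectorFourier.fourierIntegral Real.fourierChar volume (-innerₗ E3).flip h = 𝓕⁻ h := by
    ext x
    rw [Real.fourierInv_eq]
    simp [VectorFourier.fourierIntegral, real_inner_comm]
  rw [e1, e2] at h1
  exact h1.symm

theorem norm_fourierInv_le (h : E3 → ℂ) (x : E3) : ‖𝓕⁻ h x‖ ≤ ∫ ξ, ‖h ξ‖ := by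
  rw [Real.fourierInv_eq]
  refine (norm_integral_le_integral_norm _).trans (le_of_eq ?_)
  simp

theorem continuous_fourierInv {h : E3 → ℂ} (hh : Integrable h) : Continuous (𝓕⁻ h) := by
  refine VectorFourier.fourierIntegral_continuous (L := -innerₗ E3) Real.continuous_fourierChar (by
      simp only [LinearMap.neg_apply, innerₗ_apply_apply]
      fun_prop) hh

/-- Test fields such as `qTest` are integral inverse transforms, whereas `fhat` is the Plancherel
transform; this reconciles the two notions on L¹ ∩ L². -/
theorem fourierInv_toLp_ae_eq {h : E3 → ℂ} (h1 : Integrable h) (h2 : MemLp h 2) :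
    (𝓕⁻ (h2.toLp h) : H) =ᵐ[volume] 𝓕⁻ h := by
  refine ae_eq_of_integral_contDiff_smul_eq ((Lp.memLp _).locallyIntegrable (by norm_num))
    (continuous_fourierInv h1).locallyIntegrable fun g hg hgc => ?_
  set ψ : SchwartzMap E3 ℂ := HasCompactSupport.toSchwartzMap (f := fun x => (g x : ℂ))
    (hgc.comp_left Complex.ofReal_zero) (Complex.ofRealCLM.contDiff.comp hg) with hψ
  have hψx : ∀ x, ψ x = (g x : ℂ) := fun x => rfl
  have e1 : ∫ x, g x • (𝓕⁻ (h2.toLp h) : H) x = ∫ x, ψ x • (𝓕⁻ (h2.toLp h) : H) x := by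
    simp [hψx]
  have e2 : ∫ x, g x • 𝓕⁻ h x = ∫ x, ψ x * 𝓕⁻ h x := by
    simp [hψx]
  have e3 := integral_smul_fourier_eq (𝓕⁻ (h2.toLp h) : H) (𝓕⁻ ψ)
  rw [fourier_fourierInv_eq, fourier_fourierInv_eq] at e3
  rw [e1, e2, ← e3, integral_mul_fourierInv_eq ψ.integrable h1, ← SchwartzMap.fourierInv_coe]
  refine integral_congr_ae ?_
  filter_upwards [h2.coeFn_toLp] with x hx
  rw [hx, smul_eq_mul]

/-- Parseval's identity against a real-valued function. -/
theorem integral_mul_fourierInv {u : H} (hu : IsRealValued u) {h : E3 → ℂ} (h1 : Integrable h)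
    (h2 : MemLp h 2) : ∫ x, u x * 𝓕⁻ h x = ∫ ξ, (starRingEnd ℂ) ((𝓕 u : H) ξ) * h ξ := by
  have e := Lp.inner_fourier_eq u (𝓕⁻ (h2.toLp h) : H)
  rw [fourier_fourierInv_eq, L2.inner_def, L2.inner_def] at e
  calc ∫ x, u x * 𝓕⁻ h x = _ := by
        refine integral_congr_ae ?_
        filter_upwards [hu, fourierInv_toLp_ae_eq h1 h2] with x h3 h4
        rw [h4, RCLike.inner_apply, h3, mul_comm]
    _ = _ := e.symm
    _ = _ := by
        refine integral_congr_ae ?_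
        filter_upwards [h2.coeFn_toLp] with ξ h3
        rw [h3, RCLike.inner_apply, mul_comm]

theorem integrable_mul_of_H (u w : H) : Integrable fun x => u x * w x :=
  (Lp.memLp u).integrable_mul (Lp.memLp w)

/-- The Fourier transform of a product of `L²` functions. -/
theorem fourierInv_mul_eq {u w : H} (hu : IsRealValued u) (hw : IsRealValued w) (ξ : E3) :
    𝓕⁻ (fun x => u x * w x) ξ =
      (starRingEnd ℂ) (∫ η, (𝓕 u : H) (ξ - η) * (𝓕 w : H) η) := by
  -- The integral of `u w` against the character is the L² inner product of `w` with the modulated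
  -- conjugate of `u`. Plancherel turns it into a convolution at the point `ξ`.
  have hm : MemLp (fun x => Real.fourierChar (inner ℝ x ξ) • (starRingEnd ℂ) (u x)) 2 volume := by
    refine (Lp.memLp u).of_le ?_ (by simp)
    have h1 : Measurable fun x : E3 => (Real.fourierChar (inner ℝ x ξ) : ℂ) := by
      have : Continuous fun x : E3 => (Real.fourierChar (inner ℝ x ξ) : ℂ) :=
        continuous_subtype_val.comp (Real.continuous_fourierChar.comp (by fun_prop))
      exact this.measurable
    have hum := measurable_coe u
    simp_rw [Circle.smul_def]
    exact (h1.smul (Complex.continuous_conj.measurable.comp hum)).aestronglyMeasurable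
  have hv : MemLp (fun η => (starRingEnd ℂ) ((𝓕 u : H) (ξ - η))) 2 volume := by
    have h1 : MemLp (fun η => (𝓕 u : H) (ξ - η)) 2 volume :=
      (Lp.memLp (𝓕 u : H)).comp_measurePreserving (Measure.measurePreserving_sub_left volume ξ)
    exact h1.of_le (Complex.continuous_conj.comp_aestronglyMeasurable h1.1) (by simp)
  have h := fourier_eq_of_modulation (u := u) ξ hm.coeFn_toLp hv.coeFn_toLp
  have e := Lp.inner_fourier_eq w (hm.toLp _)
  rw [h, L2.inner_def, L2.inner_def] at e
  rw [Real.fourierInv_eq, ← integral_conj]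
  calc _ = _ := by
        refine integral_congr_ae ?_
        filter_upwards [hu, hw, hm.coeFn_toLp] with x h1 h2 h3
        rw [h3, RCLike.inner_apply, h1, h2, Circle.smul_def, Circle.smul_def, smul_eq_mul,
          smul_eq_mul]
        ring
    _ = _ := e.symm
    _ = _ := by
        refine integral_congr_ae ?_
        filter_upwards [hv.coeFn_toLp] with η h3
        rw [h3, RCLike.inner_apply, map_mul, mul_comm]

theorem integral_mul_mul_fourierInv {u w : H} (hu : IsRealValued u) (hw : IsRealValued w)
    {h : E3 → ℂ} (hh : Integrable h) :
    ∫ x, u x * w x * 𝓕⁻ h x =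
      ∫ ξ, (starRingEnd ℂ) (∫ η, (𝓕 u : H) (ξ - η) * (𝓕 w : H) η) * h ξ := by
  rw [integral_mul_fourierInv_eq (integrable_mul_of_H u w) hh]
  simp_rw [fourierInv_mul_eq hu hw]

end QuasiGeo
end

noncomputable section

namespace QuasiGeo

/-! ### The symbols -/

/-- The unit vector spanning the range of `𝒬` at the frequency `ξ`. -/
def evec (F : ℝ) (ξ : E3) : C4 :=
  WithLp.toLp 2 fun k => Complex.I * ((rho F ξ k / ‖rho F ξ‖ : ℝ) : ℂ)

@[simp]
theorem evec_apply (F : ℝ) (ξ : E3) (k : Fin 4) :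
    evec F ξ k = Complex.I * ((rho F ξ k / ‖rho F ξ‖ : ℝ) : ℂ) := rfl

theorem norm_sq_eq_sum (x : R4) : ‖x‖ ^ 2 = ∑ k, x k ^ 2 := by
  rw [EuclideanSpace.norm_sq_eq]; simp

theorem norm_evec {F : ℝ} (hF : 0 < F) {ξ : E3} (hξ : ξ ≠ 0) : ‖evec F ξ‖ = 1 := by
  have h : ‖rho F ξ‖ ≠ 0 := by
    rw [norm_ne_zero_iff]; exact fun h => hξ ((rho_eq_zero_iff hF).1 h)
  have h2 : ‖evec F ξ‖ ^ 2 = 1 := by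
    rw [EuclideanSpace.norm_sq_eq]
    simp only [evec_apply, norm_mul, Complex.norm_I, one_mul, Complex.norm_real, Real.norm_eq_abs,
      sq_abs, div_pow]
    rw [← Finset.sum_div, ← norm_sq_eq_sum, div_self (pow_ne_zero 2 h)]
  nlinarith [norm_nonneg (evec F ξ)]

theorem norm_evec_le (F : ℝ) (ξ : E3) : ‖evec F ξ‖ ≤ 1 := by
  have h2 : ‖evec F ξ‖ ^ 2 ≤ 1 := by
    rw [EuclideanSpace.norm_sq_eq]
    simp only [evec_apply, norm_mul, Complex.norm_I, one_mul, Complex.norm_real, Real.norm_eq_abs,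
      sq_abs, div_pow]
    rw [← Finset.sum_div, ← norm_sq_eq_sum]
    exact div_self_le_one _
  nlinarith [norm_nonneg (evec F ξ)]

theorem norm_evec_apply_le (F : ℝ) (ξ : E3) (k : Fin 4) : ‖evec F ξ k‖ ≤ 1 :=
  (PiLp.norm_apply_le (evec F ξ) k).trans (norm_evec_le F ξ)

/-- The factor `i` compensates the oddness of `rho`. Thus `a • evec` is the transform of a real
field exactly when `a` is Hermitian. -/
theorem evec_neg (F : ℝ) (ξ : E3) (k : Fin 4) :
    evec F (-ξ) k = (starRingEnd ℂ) (evec F ξ k) := by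
  simp [rho_neg, neg_div]

theorem measurable_evec (F : ℝ) (k : Fin 4) : Measurable fun ξ => evec F ξ k := by
  have h : Continuous (rho F) := continuous_rho F
  have h1 : Measurable fun ξ => rho F ξ k := ((EuclideanSpace.proj k).continuous.comp h).measurable
  have h2 : Measurable fun ξ => ‖rho F ξ‖ := h.norm.measurable
  simp only [evec_apply]
  exact measurable_const.mul (Complex.measurable_ofReal.comp (h1.div h2))

theorem measurable_evec_vec (F : ℝ) : Measurable (evec F) := by
  have h : Measurable fun ξ => (fun k => evec F ξ k : Fin 4 → ℂ) :=
    measurable_pi_lambda _ fun k => measurable_evec F k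
  exact (PiLp.continuous_toLp 2 (fun _ : Fin 4 => ℂ)).measurable.comp h

theorem inner_evec (F : ℝ) (ξ : E3) (u : C4) :
    inner ℂ (evec F ξ) u = ∑ k, (starRingEnd ℂ) (evec F ξ k) * u k := by
  rw [PiLp.inner_apply]
  refine Finset.sum_congr rfl fun k _ => ?_
  rw [RCLike.inner_apply, mul_comm]

theorem lapFSym_eq (F : ℝ) (ξ : E3) :
    lapFSym F ξ = ((-((2 * Real.pi) ^ 2 * ‖rho F ξ‖ ^ 2) : ℝ) : ℂ) := by
  rw [norm_sq_rho, lapFSym, dSym, dSym, dSym]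
  push_cast
  linear_combination (2 * Real.pi : ℂ) ^ 2 * ((ξ 0 : ℂ) ^ 2 + (ξ 1 : ℂ) ^ 2 +
    (F : ℂ) ^ 2 * (ξ 2 : ℂ) ^ 2) * Complex.I_sq

/-- Both `Ω` and the vector of derivatives in `𝒬` are `2πi` times `ρ`, and `Δ_F` is `-(2π)² |ρ|²`.
So `𝒬` is the orthogonal projection onto the line of `ρ`. -/
theorem qSym_eq {F : ℝ} (ξ : E3) (u : C4) :
    qSym F ξ u = (inner ℂ (evec F ξ) u) • evec F ξ := by
  rw [inner_evec, qSym, lapFSym_eq]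
  -- Where `ρ` vanishes, both sides are zero because the inverse of 0 is 0.
  by_cases h : ‖rho F ξ‖ = 0
  · have h0 : evec F ξ = 0 := by
      ext k
      simp [h]
    rw [h0, h]
    simp
  · have hc : (‖rho F ξ‖ : ℂ) ≠ 0 := by exact_mod_cast h
    have hpi : (Real.pi : ℂ) ≠ 0 := by exact_mod_cast Real.pi_ne_zero
    ext k
    simp only [Fin.sum_univ_four, evec_apply, omegaSym, dSym, PiLp.smul_apply, smul_eq_mul, map_mul,
      Complex.conj_I, Complex.conj_ofReal]
    fin_cases k <;> simp [rho] <;> field_simp <;> ring_nf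

/-- The real symbol of `Γ`. -/
def gammaR (ν ν' F : ℝ) (ξ : E3) : ℝ :=
  -(absD ξ ^ 2 * ((ν * (ξ 0 ^ 2 + ξ 1 ^ 2) + ν' * (F * ξ 2) ^ 2) / ‖rho F ξ‖ ^ 2))

theorem gammaSym_eq (ν ν' F : ℝ) (ξ : E3) : gammaSym ν ν' F ξ = (gammaR ν ν' F ξ : ℂ) := by
  have hlap : lapSym ξ = ((-(absD ξ ^ 2) : ℝ) : ℂ) := by
    rw [absD, mul_pow, norm_sq_E3, lapSym, dSym, dSym, dSym]
    push_cast
    linear_combination (2 * Real.pi : ℂ) ^ 2 * ((ξ 0 : ℂ) ^ 2 + (ξ 1 : ℂ) ^ 2 +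
      (ξ 2 : ℂ) ^ 2) * Complex.I_sq
  have hvisc : (ν : ℂ) * dSym 0 ξ ^ 2 + (ν : ℂ) * dSym 1 ξ ^ 2 +
      (ν' : ℂ) * (F : ℂ) ^ 2 * dSym 2 ξ ^ 2 =
      ((-((2 * Real.pi) ^ 2 * (ν * (ξ 0 ^ 2 + ξ 1 ^ 2) + ν' * (F * ξ 2) ^ 2)) : ℝ) : ℂ) := by
    rw [dSym, dSym, dSym]
    push_cast
    linear_combination (2 * Real.pi : ℂ) ^ 2 * ((ν : ℂ) * (ξ 0 : ℂ) ^ 2 + (ν : ℂ) * (ξ 1 : ℂ) ^ 2 +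
      (ν' : ℂ) * (F : ℂ) ^ 2 * (ξ 2 : ℂ) ^ 2) * Complex.I_sq
  rw [gammaSym, hlap, hvisc, lapFSym_eq, ← Complex.ofReal_inv, ← Complex.ofReal_mul,
    ← Complex.ofReal_mul]
  congr 1
  rw [gammaR]
  have hpi := Real.pi_ne_zero
  by_cases h : ‖rho F ξ‖ = 0
  · simp [h]
  · field_simp

/-- The quotient in `gammaR` is a mean of `ν` and `ν'`, with weights `ξ₁² + ξ₂²` and `F² ξ₃²` that
sum to `|ρ|²`. It therefore lies between `min ν ν'` and `max ν ν'`. -/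
theorem diffSym_gammaR {ν ν' F ν₀ : ℝ} (hF : 0 < F) (hν₀ : 0 < ν₀) (h : min ν ν' = ν₀) :
    DiffSym ν₀ (gammaR ν ν' F) := by
  have hν : ν₀ ≤ ν := h ▸ min_le_left _ _
  have hν' : ν₀ ≤ ν' := h ▸ min_le_right _ _
  refine ⟨?_, ?_, ⟨max ν ν', le_max_of_le_left (hν₀.le.trans hν), ?_⟩, ?_⟩
  · have h1 : Measurable fun ξ => ‖rho F ξ‖ := (continuous_rho F).norm.measurable
    have h2 : ∀ j : Fin 3, Measurable fun ξ : E3 => ξ j := fun j =>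
      (EuclideanSpace.proj (𝕜 := ℝ) j).continuous.measurable
    have := h2 0
    have := h2 1
    have := h2 2
    unfold gammaR
    fun_prop
  · intro ξ
    rw [gammaR, neg_le_neg_iff, mul_comm]
    by_cases hξ : ξ = 0
    · simp [hξ, absD]
    · have h0 : 0 < ‖rho F ξ‖ ^ 2 := by
        have : rho F ξ ≠ 0 := fun h => hξ ((rho_eq_zero_iff hF).1 h)
        positivity
      gcongr
      rw [le_div_iff₀ h0, norm_sq_rho]
      nlinarith [mul_nonneg (sub_nonneg.2 hν) (sq_nonneg (ξ 0)),
        mul_nonneg (sub_nonneg.2 hν) (sq_nonneg (ξ 1)),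
        mul_nonneg (sub_nonneg.2 hν') (sq_nonneg (F * ξ 2))]
  · intro ξ
    have hm1 : ν ≤ max ν ν' := le_max_left _ _
    have hm2 : ν' ≤ max ν ν' := le_max_right _ _
    have hν0 : 0 ≤ ν := hν₀.le.trans hν
    have hν0' : 0 ≤ ν' := hν₀.le.trans hν'
    rw [gammaR, abs_neg, abs_of_nonneg (by positivity), mul_comm]
    gcongr
    by_cases hξ : ‖rho F ξ‖ = 0
    · rw [hξ]; simp [hν0]
    · have h0 : 0 < ‖rho F ξ‖ ^ 2 := by positivity
      rw [div_le_iff₀ h0, norm_sq_rho]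
      nlinarith [mul_nonneg (sub_nonneg.2 hm1) (sq_nonneg (ξ 0)),
        mul_nonneg (sub_nonneg.2 hm1) (sq_nonneg (ξ 1)),
        mul_nonneg (sub_nonneg.2 hm2) (sq_nonneg (F * ξ 2))]
  · intro ξ
    simp [gammaR, absD_neg, rho_neg]

/-! ### Components of a field -/

/-- The `k`-th component of a real field, as a complex valued function. -/
def fieldComp (k : Fin 4) (f : Field) : H :=
  (EuclideanSpace.proj k : C4 →L[ℂ] ℂ).compLp (ofRealCLM.compLp f)

theorem fieldComp_coe (k : Fin 4) (f : Field) : fieldComp k f =ᵐ[volume] fun x => (f x k : ℂ) := by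
  filter_upwards [(EuclideanSpace.proj k : C4 →L[ℂ] ℂ).coeFn_compLp (ofRealCLM.compLp f),
    ofRealCLM.coeFn_compLp f] with x h1 h2
  rw [fieldComp, h1, h2]
  rfl

theorem isRealValued_fieldComp (k : Fin 4) (f : Field) : IsRealValued (fieldComp k f) := by
  filter_upwards [fieldComp_coe k f] with x h
  rw [h, Complex.conj_ofReal]

theorem fhat_apply (f : Field) (k : Fin 4) :
    ∀ᵐ ξ, fhat f ξ k = (𝓕 (fieldComp k f) : H) ξ := by
  have h := fourier_compLp (EuclideanSpace.proj k : C4 →L[ℂ] ℂ) (ofRealCLM.compLp f)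
  have h1 := (EuclideanSpace.proj k : C4 →L[ℂ] ℂ).coeFn_compLp (𝓕 (ofRealCLM.compLp f))
  rw [← h] at h1
  filter_upwards [h1] with ξ h2
  rw [fieldComp, h2]
  rfl

theorem fhat_sub (f g : Field) : fhat (f - g) = fhat f - fhat g := by
  have h : ofRealCLM.compLp (f - g) = ofRealCLM.compLp f - ofRealCLM.compLp g :=
    map_sub (ofRealCLM.compLpₗ 2 volume) f g
  rw [fhat, h]
  exact map_sub (Lp.fourierTransformₗᵢ E3 C4) _ _

theorem memLp_inner_evec (F : ℝ) (f : Field) :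
    MemLp (fun ξ => (inner ℂ (evec F ξ) (fhat f ξ) : ℂ)) 2 volume := by
  refine (Lp.memLp (fhat f)).of_le ?_ (Eventually.of_forall fun ξ => ?_)
  · exact ((measurable_evec_vec F).inner
      (Lp.stronglyMeasurable (fhat f)).measurable).aestronglyMeasurable
  · refine (norm_inner_le_norm _ _).trans ?_
    exact mul_le_of_le_one_left (norm_nonneg _) (norm_evec_le F ξ)

/-- The scalar Fourier coefficient of a quasi-geostrophic field. -/
def toScal (F : ℝ) (f : Field) : H := (memLp_inner_evec F f).toLp _

theorem toScal_coe (F : ℝ) (f : Field) :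
    toScal F f =ᵐ[volume] fun ξ => inner ℂ (evec F ξ) (fhat f ξ) :=
  (memLp_inner_evec F f).coeFn_toLp

theorem toScal_sub (F : ℝ) (f g : Field) : toScal F (f - g) = toScal F f - toScal F g := by
  ext1
  have h := Lp.coeFn_sub (fhat f) (fhat g)
  rw [← fhat_sub] at h
  filter_upwards [toScal_coe F (f - g), toScal_coe F f, toScal_coe F g, h,
    Lp.coeFn_sub (toScal F f) (toScal F g)] with ξ h1 h2 h3 h4 h5
  rw [h5, Pi.sub_apply, h1, h2, h3, h4, Pi.sub_apply, inner_sub_right]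

theorem IsQG.fhat_eq {F : ℝ} {f : Field} (hf : IsQG F f) :
    ∀ᵐ ξ, fhat f ξ = toScal F f ξ • evec F ξ := by
  filter_upwards [hf, toScal_coe F f] with ξ h1 h2
  rw [h2, ← qSym_eq, ← h1]

theorem IsQG.sub {F : ℝ} {f g : Field} (hf : IsQG F f) (hg : IsQG F g) : IsQG F (f - g) := by
  have h := Lp.coeFn_sub (fhat f) (fhat g)
  rw [← fhat_sub] at h
  filter_upwards [hf, hg, h] with ξ h1 h2 h3
  rw [h3, Pi.sub_apply, qSym_eq, inner_sub_right, sub_smul, ← qSym_eq, ← qSym_eq, ← h1, ← h2]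

theorem ae_ne_zero : ∀ᵐ ξ : E3, ξ ≠ 0 := by
  rw [ae_iff]
  simp

/-- `evec` has norm one away from the origin, so passing to the scalar coefficient preserves every
Sobolev norm. -/
theorem weightedNorm_sq {F : ℝ} (hF : 0 < F) (w : E3 → ℝ) {f : Field} (hf : IsQG F f) :
    weightedNorm w f ^ 2 = qf w (toScal F f) := by
  rw [weightedNorm, ← ENNReal.rpow_natCast, ← ENNReal.rpow_mul]
  norm_num
  refine lintegral_congr_ae ?_
  filter_upwards [hf.fhat_eq, ae_ne_zero] with ξ h1 h2
  rw [h1, enorm_smul, ← ofReal_norm (evec F ξ), norm_evec hF h2]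
  simp

theorem hermOp_toScal (F : ℝ) (f : Field) : hermOp (toScal F f) = toScal F f := by
  ext1
  have hk : ∀ k, ∀ᵐ ξ, (starRingEnd ℂ) (fhat f (-ξ) k) = fhat f ξ k := fun k => by
    have h := hermOp_coe (𝓕 (fieldComp k f))
    rw [(isRealValued_fieldComp k f).hermOp_fourier] at h
    have hn := (Measure.measurePreserving_neg (volume : Measure E3)).quasiMeasurePreserving.ae
      (fhat_apply f k)
    filter_upwards [h, fhat_apply f k, hn] with ξ h1 h2 h3
    rw [h2, h1, h3]
  have hn := (Measure.measurePreserving_neg (volume : Measure E3)).quasiMeasurePreserving.ae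
      (toScal_coe F f)
  filter_upwards [hermOp_coe (toScal F f), toScal_coe F f, hn, ae_all_iff.2 hk] with ξ h1 h2 h3 h4
  rw [h1, h3, h2, inner_evec, inner_evec, map_sum]
  refine Finset.sum_congr rfl fun k _ => ?_
  rw [map_mul, h4 k, evec_neg, Complex.conj_conj]

/-- Every Hermitian `a` is the scalar Fourier coefficient of a quasi-geostrophic field. -/
theorem exists_toScal_eq {F : ℝ} (hF : 0 < F) {a : H} (ha : hermOp a = a) :
    ∃ f : Field, IsQG F f ∧ toScal F f = a := by
  have hmem : ∀ k, MemLp (fun ξ => a ξ * evec F ξ k) 2 volume := fun k => by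
    refine (Lp.memLp a).of_le ?_ (Eventually.of_forall fun ξ => ?_)
    · exact ((measurable_coe a).mul (measurable_evec F k)).aestronglyMeasurable
    · rw [norm_mul]
      exact mul_le_of_le_one_right (norm_nonneg _) (norm_evec_apply_le F ξ k)
  have hherm : ∀ k, hermOp ((hmem k).toLp _) = (hmem k).toLp _ := fun k => by
    ext1
    have h := hermOp_coe a
    rw [ha] at h
    have hn := (Measure.measurePreserving_neg (volume : Measure E3)).quasiMeasurePreserving.ae
      (hmem k).coeFn_toLp
    filter_upwards [hermOp_coe ((hmem k).toLp _), (hmem k).coeFn_toLp, h, hn] with ξ h1 h2 h3 h4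
    rw [h1, h4, h2, map_mul, h3, evec_neg, Complex.conj_conj]
  set u : Fin 4 → H := fun k => 𝓕⁻ ((hmem k).toLp _) with hu
  have hreal : ∀ k, IsRealValued (u k) := fun k => isRealValued_fourierInv (hherm k)
  -- The components `u k` are real-valued by Hermitian symmetry of their transforms, so taking real
  -- parts loses nothing.
  have hf : MemLp (fun x => (WithLp.toLp 2 fun k => (u k x).re : R4)) 2 volume := by
    rw [memLp_piLp_iff]
    intro k
    exact (Lp.memLp (u k)).re
  set f : Field := hf.toLp _ with hfdef
  have hcomp : ∀ k, fieldComp k f = u k := fun k => by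
    ext1
    filter_upwards [fieldComp_coe k f, hf.coeFn_toLp, hreal k] with x h1 h2 h3
    rw [h1, hfdef, h2]
    exact Complex.conj_eq_iff_re.1 h3
  have hfhat : ∀ᵐ ξ, fhat f ξ = a ξ • evec F ξ := by
    filter_upwards [ae_all_iff.2 fun k => fhat_apply f k,
      ae_all_iff.2 fun k => (hmem k).coeFn_toLp] with ξ h1 h2
    ext k
    rw [h1 k, hcomp k, hu, PiLp.smul_apply, smul_eq_mul, ← h2 k]
    dsimp only
    rw [fourier_fourierInv_eq]
  have hinner : ∀ᵐ ξ, (inner ℂ (evec F ξ) (fhat f ξ) : ℂ) = a ξ := by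
    filter_upwards [hfhat, ae_ne_zero] with ξ h1 h2
    rw [h1, inner_smul_right, inner_self_eq_norm_sq_to_K, norm_evec hF h2]
    simp
  refine ⟨f, ?_, ?_⟩
  · filter_upwards [hfhat, hinner] with ξ h1 h2
    rw [qSym_eq, h2, ← h1]
  · ext1
    filter_upwards [toScal_coe F f, hinner] with ξ h1 h2
    rw [h1, h2]

end QuasiGeo
end

noncomputable section

namespace QuasiGeo

/-! ### The weak formulation on the Fourier side -/

theorem schwartz_dominated (χ : SchwartzMap E3 C4) {q : E3 → ℂ} (hq : Measurable q) {C : ℝ}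
    (h : ∀ ξ, ‖q ξ‖ ≤ C * ((1 + ‖ξ‖ ^ 2) * ‖χ ξ‖)) : Integrable q ∧ MemLp q 2 := by
  have hg : Function.HasTemperateGrowth fun ξ : E3 => 1 + ‖ξ‖ ^ 2 :=
    (Function.HasTemperateGrowth.const 1).add (Function.hasTemperateGrowth_norm_sq E3)
  set χ' : SchwartzMap E3 C4 := SchwartzMap.smulLeftCLM C4 (fun ξ : E3 => 1 + ‖ξ‖ ^ 2) χ with hχ'
  have hχ : ∀ ξ, ‖χ' ξ‖ = (1 + ‖ξ‖ ^ 2) * ‖χ ξ‖ := fun ξ => by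
    rw [hχ', SchwartzMap.smulLeftCLM_apply_apply hg, norm_smul, Real.norm_of_nonneg (by positivity)]
  have h' : ∀ ξ, ‖q ξ‖ ≤ C * ‖χ' ξ‖ := fun ξ => by rw [hχ]; exact h ξ
  constructor
  · rw [← memLp_one_iff_integrable]
    exact (χ'.memLp 1 volume).of_le_mul hq.aestronglyMeasurable (Eventually.of_forall h')
  · exact (χ'.memLp 2 volume).of_le_mul hq.aestronglyMeasurable (Eventually.of_forall h')

/-- The scalar coefficient of `𝒬 φ` for a test field `φ`. -/
def testCoef (F : ℝ) (φ : SchwartzMap E3 C4) (ξ : E3) : ℂ := inner ℂ (evec F ξ) (𝓕 φ ξ)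

theorem measurable_testCoef (F : ℝ) (φ : SchwartzMap E3 C4) : Measurable (testCoef F φ) :=
  (measurable_evec_vec F).inner (𝓕 φ).continuous.measurable

theorem norm_testCoef_le (F : ℝ) (φ : SchwartzMap E3 C4) (ξ : E3) :
    ‖testCoef F φ ξ‖ ≤ ‖𝓕 φ ξ‖ :=
  (norm_inner_le_norm _ _).trans (mul_le_of_le_one_left (norm_nonneg _) (norm_evec_le F ξ))

theorem testCoef_mul_dominated (F : ℝ) (φ : SchwartzMap E3 C4) {m : E3 → ℂ} (hm : Measurable m)
    {C : ℝ} (h : ∀ ξ, ‖m ξ‖ ≤ C * (1 + ‖ξ‖ ^ 2)) :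
    Integrable (fun ξ => m ξ * testCoef F φ ξ) ∧ MemLp (fun ξ => m ξ * testCoef F φ ξ) 2 := by
  refine schwartz_dominated (𝓕 φ) (C := C) (hm.mul (measurable_testCoef F φ)) fun ξ => ?_
  rw [norm_mul, ← mul_assoc]
  exact mul_le_mul (h ξ) (norm_testCoef_le F φ ξ) (norm_nonneg _) ((norm_nonneg _).trans (h ξ))

theorem fourierInv_apply {h : E3 → C4} (h1 : Integrable h) (x : E3) (k : Fin 4) :
    𝓕⁻ h x k = 𝓕⁻ (fun ξ => h ξ k) x := by
  rw [Real.fourierInv_eq, Real.fourierInv_eq]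
  have h2 : Integrable fun ξ => Real.fourierChar (inner ℝ ξ x) • h ξ := by
    have := (Real.fourierIntegral_convergent_iff (f := h) (μ := volume) (-x)).2 h1
    simpa using this
  exact ((EuclideanSpace.proj k : C4 →L[ℂ] ℂ).integral_comp_comm h2).symm

theorem pair_fourierInv {F : ℝ} {f : Field} (hf : IsQG F f) {h : E3 → C4}
    (h1 : ∀ k, Integrable fun ξ => h ξ k) (h2 : ∀ k, MemLp (fun ξ => h ξ k) 2) :
    pair f (𝓕⁻ h) = ∫ ξ, (starRingEnd ℂ) (toScal F f ξ) * inner ℂ (evec F ξ) (h ξ) := by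
  have hint : Integrable h := integrable_piLp_iff.2 h1
  have hi : ∀ k, Integrable fun x => fieldComp k f x * 𝓕⁻ (fun ξ => h ξ k) x := fun k => by
    have e := integrable_mul_of_H (fieldComp k f) (𝓕⁻ ((h2 k).toLp _))
    refine e.congr ?_
    filter_upwards [fourierInv_toLp_ae_eq (h1 k) (h2 k)] with x hx
    rw [hx]
  have hi' : ∀ k, Integrable fun ξ =>
      (starRingEnd ℂ) ((𝓕 (fieldComp k f) : H) ξ) * h ξ k := fun k => by
    have e : MemLp (fun ξ => (starRingEnd ℂ) ((𝓕 (fieldComp k f) : H) ξ)) 2 volume :=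
      (Lp.memLp (𝓕 (fieldComp k f) : H)).of_le (Complex.continuous_conj.comp_aestronglyMeasurable
        (Lp.aestronglyMeasurable _)) (by simp)
    exact e.integrable_mul (h2 k)
  calc pair f (𝓕⁻ h) = ∫ x, ∑ k, fieldComp k f x * 𝓕⁻ (fun ξ => h ξ k) x := by
        refine integral_congr_ae ?_
        filter_upwards [ae_all_iff.2 fun k => fieldComp_coe k f] with x hx
        refine Finset.sum_congr rfl fun k _ => ?_
        rw [hx k, fourierInv_apply hint]
    _ = ∑ k, ∫ x, fieldComp k f x * 𝓕⁻ (fun ξ => h ξ k) x := integral_finsetSum _ fun k _ => hi k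
    _ = ∑ k, ∫ ξ, (starRingEnd ℂ) ((𝓕 (fieldComp k f) : H) ξ) * h ξ k :=
        Finset.sum_congr rfl fun k _ =>
          integral_mul_fourierInv (isRealValued_fieldComp k f) (h1 k) (h2 k)
    _ = ∫ ξ, ∑ k, (starRingEnd ℂ) ((𝓕 (fieldComp k f) : H) ξ) * h ξ k :=
        (integral_finsetSum _ fun k _ => hi' k).symm
    _ = _ := by
        refine integral_congr_ae ?_
        filter_upwards [ae_all_iff.2 fun k => fhat_apply f k, hf.fhat_eq] with ξ h3 h4
        rw [inner_evec, Finset.mul_sum]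
        refine Finset.sum_congr rfl fun k _ => ?_
        rw [← h3 k, h4, PiLp.smul_apply, smul_eq_mul, map_mul]
        ring

theorem pair_schwartz {F : ℝ} {f : Field} (hf : IsQG F f) (φ : SchwartzMap E3 C4) :
    pair f φ = ∫ ξ, (starRingEnd ℂ) (toScal F f ξ) * testCoef F φ ξ := by
  have hm : ∀ k, Measurable fun ξ => 𝓕 φ ξ k := fun k =>
    ((EuclideanSpace.proj k : C4 →L[ℂ] ℂ).continuous.comp (𝓕 φ).continuous).measurable
  have h := fun k => schwartz_dominated (𝓕 φ) (hm k) (C := 1) fun ξ => by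
    have h1 := PiLp.norm_apply_le (𝓕 φ ξ) k
    have h2 := norm_nonneg (𝓕 φ ξ)
    nlinarith [sq_nonneg ‖ξ‖, mul_nonneg (sq_nonneg ‖ξ‖) h2]
  have e : (φ : E3 → C4) = 𝓕⁻ (fun ξ => 𝓕 φ ξ) := by
    have h1 : 𝓕⁻ (𝓕 φ) = φ := fourierInv_fourier_eq φ
    rw [← SchwartzMap.fourierInv_coe, h1]
  conv_lhs => rw [e]
  exact pair_fourierInv hf (fun k => (h k).1) fun k => (h k).2

theorem norm_le_one_add_sq (x : E3) : ‖x‖ ≤ 1 + ‖x‖ ^ 2 := by nlinarith [sq_nonneg (‖x‖ - 1)]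

theorem pair_gammaTest {F ν ν' ν₀ : ℝ} (hg : DiffSym ν₀ (gammaR ν ν' F)) {f : Field} (hf : IsQG F f)
    (φ : SchwartzMap E3 C4) :
    pair f (gammaTest ν ν' F φ) =
      ∫ ξ, (starRingEnd ℂ) (gammaR ν ν' F ξ * toScal F f ξ) * testCoef F φ ξ := by
  obtain ⟨C, hC0, hC⟩ := hg.bound
  have hm : ∀ k, Measurable fun ξ => 𝓕 φ ξ k := fun k =>
    ((EuclideanSpace.proj k : C4 →L[ℂ] ℂ).continuous.comp (𝓕 φ).continuous).measurable
  have h := fun k => schwartz_dominated (𝓕 φ) (q := fun ξ => (gammaSym ν ν' F ξ • 𝓕 φ ξ) k)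
    (by
      simp only [gammaSym_eq, PiLp.smul_apply, smul_eq_mul]
      exact (Complex.measurable_ofReal.comp hg.measurable).mul (hm k))
    (C := C * (2 * Real.pi) ^ 2) fun ξ => by
    rw [PiLp.smul_apply, gammaSym_eq, norm_smul, Complex.norm_real, Real.norm_eq_abs, mul_assoc,
      ← mul_assoc ((2 * Real.pi) ^ 2), ← mul_assoc]
    refine mul_le_mul ((hC ξ).trans ?_) (PiLp.norm_apply_le (𝓕 φ ξ) k) (norm_nonneg _)
      (by positivity)
    rw [absD, mul_pow]
    gcongr
    linarith
  rw [gammaTest, pair_fourierInv hf (fun k => (h k).1) fun k => (h k).2]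
  refine integral_congr_ae (Eventually.of_forall fun ξ => ?_)
  dsimp only
  rw [inner_smul_right, gammaSym_eq, map_mul, Complex.conj_ofReal, testCoef]
  ring

/-- Needed because `𝒬 φ` need not be Schwartz: its symbol is singular at the origin. Integrability
of `|ξ| |h|` is enough to differentiate under the integral. -/
theorem fderiv_fourierInv_apply {h : E3 → C4} (h1 : Integrable h)
    (h2 : Integrable fun ξ => ‖ξ‖ * ‖h ξ‖) (x : E3) (j : Fin 3) (k : Fin 4) :
    fderiv ℝ (𝓕⁻ h) x (EuclideanSpace.single j 1) k = 𝓕⁻ (fun ξ => dSym j ξ * h ξ k) x := by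
  have hd := (VectorFourier.hasFDerivAt_fourierIntegral (-innerSL ℝ : E3 →L[ℝ] E3 →L[ℝ] ℝ) h1 h2
    x).fderiv
  have e : VectorFourier.fourierIntegral Real.fourierChar volume
      (-innerSL ℝ : E3 →L[ℝ] E3 →L[ℝ] ℝ).toLinearMap₁₂ h = 𝓕⁻ h := rfl
  rw [e] at hd
  have hi : Integrable (VectorFourier.fourierSMulRight (-innerSL ℝ : E3 →L[ℝ] E3 →L[ℝ] ℝ) h) := by
    refine (h2.const_mul (2 * Real.pi * ‖(-innerSL ℝ : E3 →L[ℝ] E3 →L[ℝ] ℝ)‖)).mono'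
      (h1.1.fourierSMulRight) (Eventually.of_forall fun ξ => ?_)
    refine (VectorFourier.norm_fourierSMulRight_le _ h ξ).trans (le_of_eq ?_)
    ring
  have hii : Integrable fun ξ => Real.fourierChar (inner ℝ ξ x) •
      VectorFourier.fourierSMulRight (-innerSL ℝ : E3 →L[ℝ] E3 →L[ℝ] ℝ) h ξ := by
    have := (Real.fourierIntegral_convergent_iff (μ := volume) (-x)).2 hi
    simpa using this
  set ℓ : (E3 →L[ℝ] C4) →L[ℝ] ℂ := ((EuclideanSpace.proj k : C4 →L[ℂ] ℂ).restrictScalars ℝ).comp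
    (ContinuousLinearMap.apply ℝ C4 (EuclideanSpace.single j 1 : E3)) with hℓ
  have e2 : fderiv ℝ (𝓕⁻ h) x (EuclideanSpace.single j 1) k = ℓ (fderiv ℝ (𝓕⁻ h) x) := rfl
  rw [e2, hd, Real.fourierInv_eq]
  have e3 : VectorFourier.fourierIntegral Real.fourierChar volume
      (-innerSL ℝ : E3 →L[ℝ] E3 →L[ℝ] ℝ).toLinearMap₁₂
      (VectorFourier.fourierSMulRight (-innerSL ℝ : E3 →L[ℝ] E3 →L[ℝ] ℝ) h) x =
      ∫ ξ, Real.fourierChar (inner ℝ ξ x) •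
      VectorFourier.fourierSMulRight (-innerSL ℝ : E3 →L[ℝ] E3 →L[ℝ] ℝ) h ξ := by
    rw [VectorFourier.fourierIntegral]
    simp
  rw [e3, ← ℓ.integral_comp_comm hii]
  refine integral_congr_ae (Eventually.of_forall fun ξ => ?_)
  simp only [hℓ, ContinuousLinearMap.comp_apply, Circle.smul_def]
  have e4 : innerSL ℝ ξ (EuclideanSpace.single j 1 : E3) = ξ j := by
    rw [innerSL_apply_apply, EuclideanSpace.inner_single_right]
    simp
  simp [dSym, e4]
  ring

theorem norm_dSym_le (j : Fin 3) (ξ : E3) : ‖dSym j ξ‖ ≤ 2 * Real.pi * (1 + ‖ξ‖ ^ 2) := by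
  have h1 : ‖dSym j ξ‖ = 2 * Real.pi * |ξ j| := by
    rw [dSym, norm_mul, norm_mul, norm_mul, Complex.norm_I, Complex.norm_real, Complex.norm_real,
      Real.norm_eq_abs, Real.norm_eq_abs, abs_of_pos Real.pi_pos]
    simp
  rw [h1]
  gcongr
  exact (PiLp.norm_apply_le ξ j).trans (norm_le_one_add_sq ξ)

theorem measurable_dSym (j : Fin 3) : Measurable (dSym j) := by
  have h2 : Continuous fun ξ : E3 => ξ j := (EuclideanSpace.proj (𝕜 := ℝ) j).continuous
  unfold dSym
  exact (continuous_const.mul (Complex.continuous_ofReal.comp h2)).measurable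

/-- The origin of `kern`. The double sum factors into velocity against derivative and polarization
against polarization; the vertical velocity being zero, the first factor is a horizontal cross
product. The minus sign matches the sign of `B` in the equation. -/
theorem sum_kern (F : ℝ) (ξ η : E3) :
    ∑ j : Fin 3, ∑ k : Fin 4, (starRingEnd ℂ) (dSym j ξ) * (starRingEnd ℂ) (evec F ξ k) *
      (evec F (ξ - η) j.castSucc * evec F η k) = -(kern F ξ η : ℂ) := by
  have h1 : ∑ j : Fin 3, (starRingEnd ℂ) (dSym j ξ) * evec F (ξ - η) j.castSucc =
      ((2 * Real.pi * (cross (ξ - η) ξ / ‖rho F (ξ - η)‖) : ℝ) : ℂ) := by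
    rw [Fin.sum_univ_three]
    simp only [dSym, evec_apply, map_mul, Complex.conj_I, Complex.conj_ofReal, map_ofNat, cross]
    have e0 : rho F (ξ - η) (Fin.castSucc 0) = -(ξ - η) 1 := rfl
    have e1 : rho F (ξ - η) (Fin.castSucc 1) = (ξ - η) 0 := rfl
    have e2 : rho F (ξ - η) (Fin.castSucc 2) = 0 := rfl
    rw [e0, e1, e2]
    push_cast
    linear_combination (-(2 * Real.pi * (ξ 1 * ((ξ - η) 0 / ‖rho F (ξ - η)‖) -
      ξ 0 * ((ξ - η) 1 / ‖rho F (ξ - η)‖))) : ℂ) * Complex.I_sq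
  have h2 : ∑ k : Fin 4, (starRingEnd ℂ) (evec F ξ k) * evec F η k =
      ((inner ℝ (rho F η) (rho F ξ) / (‖rho F η‖ * ‖rho F ξ‖) : ℝ) : ℂ) := by
    rw [PiLp.inner_apply, Finset.sum_div, Complex.ofReal_sum]
    refine Finset.sum_congr rfl fun k _ => ?_
    simp only [evec_apply, map_mul, Complex.conj_I, Complex.conj_ofReal, RCLike.inner_apply, conj_trivial]
    push_cast
    linear_combination (-(rho F ξ k / ‖rho F ξ‖ * (rho F η k / ‖rho F η‖)) : ℂ) * Complex.I_sq
  calc _ = (∑ j : Fin 3, (starRingEnd ℂ) (dSym j ξ) * evec F (ξ - η) j.castSucc) *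
        ∑ k : Fin 4, (starRingEnd ℂ) (evec F ξ k) * evec F η k := by
        rw [Finset.sum_mul_sum]
        refine Finset.sum_congr rfl fun j _ => Finset.sum_congr rfl fun k _ => ?_
        ring
    _ = _ := by
        rw [h1, h2, kern]
        push_cast
        ring

theorem integrable_conv (u w : H) (ξ : E3) : Integrable fun η => u (ξ - η) * w η := by
  have h1 : MemLp (fun η => u (ξ - η)) 2 volume :=
    (Lp.memLp u).comp_measurePreserving (Measure.measurePreserving_sub_left volume ξ)
  exact h1.integrable_mul (Lp.memLp w)

/-- By Parseval each product `v^j U^k` becomes a convolution, then every component is replaced by `a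
• evec` and the sums over `j`, `k` collapse to the kernel. -/
theorem convPair_qTest {F : ℝ} {f : Field} (hf : IsQG F f) (φ : SchwartzMap E3 C4) :
    convPair f (qTest F φ) =
      ∫ ξ, (starRingEnd ℂ) (-bil F (toScal F f) (toScal F f) ξ) * testCoef F φ ξ := by
  set p := testCoef F φ with hp
  set a := toScal F f with ha
  set û : Fin 4 → H := fun k => 𝓕 (fieldComp k f) with hû
  set c : Fin 3 → Fin 4 → E3 → ℂ := fun j k ξ => ∫ η, û j.castSucc (ξ - η) * û k η with hc
  have hqk : ∀ k ξ, qSym F ξ (𝓕 φ ξ) k = evec F ξ k * p ξ := fun k ξ => by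
    rw [qSym_eq, PiLp.smul_apply, smul_eq_mul, mul_comm]; rfl
  have hk : ∀ k, Integrable fun ξ => evec F ξ k * p ξ := fun k =>
    (testCoef_mul_dominated F φ (measurable_evec F k) (C := 1) fun ξ => by
      have := norm_evec_apply_le F ξ k
      nlinarith [sq_nonneg ‖ξ‖]).1
  have hjk : ∀ (j : Fin 3) (k : Fin 4), Integrable fun ξ => dSym j ξ * evec F ξ k * p ξ :=
    fun j k => (testCoef_mul_dominated F φ ((measurable_dSym j).mul (measurable_evec F k))
      (C := 2 * Real.pi) fun ξ => by
        rw [Pi.mul_apply, norm_mul]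
        exact (mul_le_of_le_one_right (norm_nonneg _) (norm_evec_apply_le F ξ k)).trans
          (norm_dSym_le j ξ)).1
  have hint : Integrable fun ξ : E3 => qSym F ξ (𝓕 φ ξ) :=
    integrable_piLp_iff.2 fun k => by simp only [hqk]; exact hk k
  have hint2 : Integrable fun ξ : E3 => ‖ξ‖ * ‖qSym F ξ (𝓕 φ ξ)‖ := by
    have h1 := (testCoef_mul_dominated F φ (m := fun ξ => ((‖ξ‖ : ℝ) : ℂ))
      (Complex.measurable_ofReal.comp measurable_norm) (C := 1) fun ξ => by
        rw [Complex.norm_real, norm_norm, one_mul]; exact norm_le_one_add_sq ξ).1.norm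
    refine h1.mono' (measurable_norm.aestronglyMeasurable.mul hint.1.norm)
      (Eventually.of_forall fun ξ => ?_)
    rw [qSym_eq, norm_mul, norm_mul, norm_norm, norm_norm, Complex.norm_real, norm_norm, norm_smul]
    gcongr
    exact mul_le_of_le_one_right (norm_nonneg _) (norm_evec_le F ξ)
  have hbd : ∀ j k, Integrable fun x => fieldComp j f x * fieldComp k f x := fun j k =>
    integrable_mul_of_H _ _
  have hcc : ∀ j k, c j k = fun ξ => (starRingEnd ℂ)
      (𝓕⁻ (fun x => fieldComp j.castSucc f x * fieldComp k f x) ξ) := fun j k => by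
    ext1 ξ
    rw [fourierInv_mul_eq (isRealValued_fieldComp _ f) (isRealValued_fieldComp _ f),
      Complex.conj_conj]
  have hci : ∀ j k, Integrable fun ξ => (starRingEnd ℂ) (c j k ξ) * (dSym j ξ * evec F ξ k * p ξ) :=
    fun j k => by
      simp only [hcc, Complex.conj_conj]
      refine (hjk j k).bdd_mul
        (c := ∫ x, ‖fieldComp j.castSucc f x * fieldComp k f x‖)
        (continuous_fourierInv (hbd _ _)).aestronglyMeasurable
        (Eventually.of_forall fun ξ => norm_fourierInv_le _ ξ)
  have hxi : ∀ j k, Integrable fun x => fieldComp j.castSucc f x * fieldComp k f x *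
      𝓕⁻ (fun ξ => dSym j ξ * evec F ξ k * p ξ) x := fun (j : Fin 3) k =>
    (hbd _ _).mul_bdd (c := ∫ ξ, ‖dSym j ξ * evec F ξ k * p ξ‖)
      (continuous_fourierInv (hjk j k)).aestronglyMeasurable
      (Eventually.of_forall fun ξ => norm_fourierInv_le _ ξ)
  calc convPair f (qTest F φ)
      = ∫ x, ∑ j : Fin 3, ∑ k : Fin 4, fieldComp j.castSucc f x * fieldComp k f x *
          𝓕⁻ (fun ξ => dSym j ξ * evec F ξ k * p ξ) x := by
        refine integral_congr_ae ?_
        filter_upwards [ae_all_iff.2 fun k => fieldComp_coe k f] with x hx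
        refine Finset.sum_congr rfl fun j _ => Finset.sum_congr rfl fun k _ => ?_
        rw [hx, hx, qTest, fderiv_fourierInv_apply hint hint2]
        simp only [hqk, mul_assoc]
    _ = ∑ j : Fin 3, ∑ k : Fin 4, ∫ x, fieldComp j.castSucc f x * fieldComp k f x *
          𝓕⁻ (fun ξ => dSym j ξ * evec F ξ k * p ξ) x := by
        rw [integral_finsetSum _ fun j _ => integrable_finsetSum _ fun k _ => hxi j k]
        exact Finset.sum_congr rfl fun j _ => integral_finsetSum _ fun k _ => hxi j k
    _ = ∑ j : Fin 3, ∑ k : Fin 4, ∫ ξ, (starRingEnd ℂ) (c j k ξ) *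
          (dSym j ξ * evec F ξ k * p ξ) :=
        Finset.sum_congr rfl fun j _ => Finset.sum_congr rfl fun k _ =>
          integral_mul_mul_fourierInv (isRealValued_fieldComp _ f) (isRealValued_fieldComp _ f)
            (hjk j k)
    _ = ∫ ξ, ∑ j : Fin 3, ∑ k : Fin 4, (starRingEnd ℂ) (c j k ξ) *
          (dSym j ξ * evec F ξ k * p ξ) := by
        rw [integral_finsetSum _ fun j _ => integrable_finsetSum _ fun k _ => hci j k]
        exact Finset.sum_congr rfl fun j _ => (integral_finsetSum _ fun k _ => hci j k).symm
    _ = _ := by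
        refine integral_congr_ae (Eventually.of_forall fun ξ => ?_)
        dsimp only
        have hae : ∀ k, ∀ᵐ η, û k η = a η * evec F η k := fun k => by
          filter_upwards [fhat_apply f k, hf.fhat_eq] with η h1 h2
          rw [hû]
          dsimp only
          rw [← h1, h2, PiLp.smul_apply, smul_eq_mul]
        have hcint : ∀ (j : Fin 3) k, Integrable fun η => (starRingEnd ℂ) (dSym j ξ) *
            (starRingEnd ℂ) (evec F ξ k) * (û j.castSucc (ξ - η) * û k η) := fun j k =>
          (integrable_conv _ _ ξ).const_mul _
        have key : ∑ j : Fin 3, ∑ k : Fin 4, (starRingEnd ℂ) (dSym j ξ) *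
            (starRingEnd ℂ) (evec F ξ k) * c j k ξ = -bil F a a ξ := by
          calc _ = ∑ j : Fin 3, ∑ k : Fin 4, ∫ η, (starRingEnd ℂ) (dSym j ξ) *
                (starRingEnd ℂ) (evec F ξ k) * (û j.castSucc (ξ - η) * û k η) := by
                refine Finset.sum_congr rfl fun j _ => Finset.sum_congr rfl fun k _ => ?_
                rw [hc]
                exact (integral_const_mul _ _).symm
            _ = ∫ η, ∑ j : Fin 3, ∑ k : Fin 4, (starRingEnd ℂ) (dSym j ξ) *
                (starRingEnd ℂ) (evec F ξ k) * (û j.castSucc (ξ - η) * û k η) := by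
                rw [integral_finsetSum _ fun j _ => integrable_finsetSum _ fun k _ => hcint j k]
                exact Finset.sum_congr rfl fun j _ =>
                  (integral_finsetSum _ fun k _ => hcint j k).symm
            _ = ∫ η, -((kern F ξ η : ℂ) * (a (ξ - η) * a η)) := by
                refine integral_congr_ae ?_
                filter_upwards [ae_all_iff.2 hae,
                  (quasiMeasurePreserving_sub_left volume ξ).ae (ae_all_iff.2 hae)] with η h1 h2
                rw [← neg_mul, ← sum_kern, Finset.sum_mul]
                refine Finset.sum_congr rfl fun j _ => ?_
                rw [Finset.sum_mul]
                refine Finset.sum_congr rfl fun k _ => ?_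
                rw [h1, h2]
                ring
            _ = _ := by rw [integral_neg]; rfl
        rw [← key, map_sum, Finset.sum_mul]
        refine Finset.sum_congr rfl fun j _ => ?_
        rw [map_sum, Finset.sum_mul]
        refine Finset.sum_congr rfl fun k _ => ?_
        simp only [map_mul, Complex.conj_conj]
        ring

end QuasiGeo
end

noncomputable section

namespace QuasiGeo

/-! ### Equivalence of the weak formulation with the scalar equation -/

/-- The functional `x ↦ ∫ conj(x) q`. -/
def pairL (q : H) : H →L[ℝ] ℂ :=
  (Complex.conjCLE : ℂ →L[ℝ] ℂ).comp ((innerSL ℂ q).restrictScalars ℝ)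

theorem pairL_apply (q x : H) : pairL q x = ∫ ξ, (starRingEnd ℂ) (x ξ) * q ξ := by
  have h : pairL q x = inner ℂ x q := by
    simp [pairL, inner_conj_symm]
  rw [h, L2.inner_def]
  refine integral_congr_ae (Eventually.of_forall fun ξ => ?_)
  dsimp only
  rw [RCLike.inner_apply, mul_comm]

theorem pairL_toLp {q : E3 → ℂ} (hq : MemLp q 2) (x : H) :
    pairL (hq.toLp q) x = ∫ ξ, (starRingEnd ℂ) (x ξ) * q ξ := by
  rw [pairL_apply]
  refine integral_congr_ae ?_
  filter_upwards [hq.coeFn_toLp] with ξ h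
  rw [h]

theorem norm_bil_le (F : ℝ) (a b : H) (ξ : E3) : ‖bil F a b ξ‖ ≤ absD ξ * (‖a‖ * ‖b‖) := by
  have h := (enorm_bil_le F (measurable_coe a) (measurable_coe b) ξ).trans
    (mul_le_mul_right (lconv_enorm_le a b ξ) _)
  rw [← ENNReal.ofReal_mul (absD_nonneg ξ), ← ofReal_norm] at h
  exact (ENNReal.ofReal_le_ofReal_iff (mul_nonneg (absD_nonneg ξ) (by positivity))).1 h

theorem memLp_testCoef (F : ℝ) (φ : SchwartzMap E3 C4) : MemLp (testCoef F φ) 2 := by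
  have h := (testCoef_mul_dominated F φ (m := fun _ => 1) measurable_const (C := 1)
    fun ξ => by rw [norm_one]; nlinarith [sq_nonneg ‖ξ‖]).2
  simpa using h

theorem integrable_absD_mul_testCoef (F : ℝ) (φ : SchwartzMap E3 C4) :
    Integrable fun ξ => absD ξ * ‖testCoef F φ ξ‖ := by
  have h := (testCoef_mul_dominated F φ (m := fun ξ => ((absD ξ : ℝ) : ℂ))
    (Complex.measurable_ofReal.comp measurable_absD) (C := 2 * Real.pi) fun ξ => by
      rw [Complex.norm_real, Real.norm_of_nonneg (absD_nonneg ξ), absD]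
      gcongr
      exact norm_le_one_add_sq ξ).1.norm
  refine h.congr (Eventually.of_forall fun ξ => ?_)
  simp only [norm_mul, Complex.norm_real, Real.norm_of_nonneg (absD_nonneg ξ)]

section

variable {ν₀ : ℝ} {g : E3 → ℝ} {F : ℝ}

theorem DiffSym.memLp_mul_testCoef (hg : DiffSym ν₀ g) (F : ℝ) (φ : SchwartzMap E3 C4) :
    MemLp (fun ξ => (g ξ : ℂ) * testCoef F φ ξ) 2 := by
  obtain ⟨C, hC0, hC⟩ := hg.bound
  refine (testCoef_mul_dominated F φ (Complex.measurable_ofReal.comp hg.measurable)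
    (C := C * (2 * Real.pi) ^ 2) fun ξ => ?_).2
  rw [Function.comp_apply, Complex.norm_real, Real.norm_eq_abs]
  refine (hC ξ).trans ?_
  rw [absD, mul_pow, ← mul_assoc]
  gcongr
  linarith

theorem integrable_conj_bil_mul (F : ℝ) (φ : SchwartzMap E3 C4) (x : H) :
    Integrable fun ξ => (starRingEnd ℂ) (bil F x x ξ) * testCoef F φ ξ := by
  refine ((integrable_absD_mul_testCoef F φ).const_mul (‖x‖ * ‖x‖)).mono' ?_
    (Eventually.of_forall fun ξ => ?_)
  · exact ((Complex.continuous_conj.measurable.comp (measurable_bil F (measurable_coe x)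
      (measurable_coe x))).mul (measurable_testCoef F φ)).aestronglyMeasurable
  · rw [norm_mul, RCLike.norm_conj]
    calc _ ≤ absD ξ * (‖x‖ * ‖x‖) * ‖testCoef F φ ξ‖ := by gcongr; exact norm_bil_le F x x ξ
      _ = _ := by ring

/-- The weak form of the right-hand side `g a - B(a, a)`. -/
def weakRhs (F : ℝ) (hg : DiffSym ν₀ g) (φ : SchwartzMap E3 C4) (x : H) : ℂ :=
  pairL ((hg.memLp_mul_testCoef F φ).toLp _) x -
    ∫ ξ, (starRingEnd ℂ) (bil F x x ξ) * testCoef F φ ξ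

/-- The truncation of the quadratic term in `weakRhs`. -/
def bilPair (F N : ℝ) (φ : SchwartzMap E3 C4) (x : H) : ℂ :=
  ∫ ξ, if absD ξ < N then (starRingEnd ℂ) (bil F x x ξ) * testCoef F φ ξ else 0

theorem pairL_field (hg : DiffSym ν₀ g) (φ : SchwartzMap E3 C4) (N : ℝ) (x : H) :
    pairL ((memLp_testCoef F φ).toLp _) (field F hg N x) =
      pairL ((hg.memLp_mul_testCoef F φ).toLp _) (proj N x) - bilPair F N φ x := by
  have hb : bilPair F N φ x = pairL ((memLp_testCoef F φ).toLp _) (bilOp F N x x) := by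
    rw [pairL_toLp, bilPair]
    refine integral_congr_ae ?_
    filter_upwards [bilOp_coe F N x x] with ξ h
    rw [h, bilCut]
    split_ifs <;> simp
  rw [hb, field, map_sub]
  congr 1
  rw [pairL_toLp, pairL_toLp]
  refine integral_congr_ae ?_
  filter_upwards [mulOp_coe _ (hg.bsym N) x, proj_coe N x] with ξ h1 h2
  rw [h1, h2]
  split_ifs with h
  · rw [cut_of_lt h, map_mul, Complex.conj_ofReal]; ring
  · rw [cut_of_not_lt h]; simp

theorem norm_bilPair_le (F N : ℝ) (φ : SchwartzMap E3 C4) (x : H) :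
    ‖bilPair F N φ x‖ ≤ ‖x‖ * ‖x‖ * ∫ ξ, absD ξ * ‖testCoef F φ ξ‖ := by
  rw [← integral_const_mul]
  refine norm_integral_le_of_norm_le ((integrable_absD_mul_testCoef F φ).const_mul _)
    (Eventually.of_forall fun ξ => ?_)
  have h0 : 0 ≤ ‖x‖ * ‖x‖ * (absD ξ * ‖testCoef F φ ξ‖) :=
    mul_nonneg (by positivity) (mul_nonneg (absD_nonneg ξ) (norm_nonneg _))
  split_ifs
  · rw [norm_mul, RCLike.norm_conj]
    calc _ ≤ absD ξ * (‖x‖ * ‖x‖) * ‖testCoef F φ ξ‖ := by gcongr; exact norm_bil_le F x x ξ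
      _ = _ := by ring
  · simpa using h0

theorem tendsto_bilPair (F : ℝ) (φ : SchwartzMap E3 C4) (x : H) :
    Tendsto (fun n : ℕ => bilPair F n φ x) atTop
      (𝓝 (∫ ξ, (starRingEnd ℂ) (bil F x x ξ) * testCoef F φ ξ)) := by
  have hi := integrable_conj_bil_mul F φ x
  refine tendsto_integral_of_dominated_convergence
    (fun ξ => ‖(starRingEnd ℂ) (bil F x x ξ) * testCoef F φ ξ‖) (fun n => ?_) hi.norm
    (fun n => Eventually.of_forall fun ξ => ?_) (Eventually.of_forall fun ξ => ?_)
  · exact (Measurable.ite (measurableSet_absD_lt n)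
      ((Complex.continuous_conj.measurable.comp (measurable_bil F (measurable_coe x)
        (measurable_coe x))).mul (measurable_testCoef F φ)) measurable_const).aestronglyMeasurable
  · split_ifs
    · exact le_rfl
    · rw [norm_zero]; exact norm_nonneg _
  · refine tendsto_const_nhds.congr' ?_
    obtain ⟨n₀, hn₀⟩ := exists_nat_gt (absD ξ)
    filter_upwards [eventually_ge_atTop n₀] with n hn
    rw [if_pos (hn₀.trans_le (by exact_mod_cast hn))]

/-- Pairing the level-`N` equation with a test coefficient and letting `N → ∞`. Although `g a - B(a,
a)` need not be in L², the decay of the test function dominates all terms. -/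
theorem IsScalarSol.weak_eq {hg : DiffSym ν₀ g} {a : ℝ → H} (ha : IsScalarSol F hg a)
    (φ : SchwartzMap E3 C4) {t : ℝ} (ht : 0 ≤ t) :
    pairL ((memLp_testCoef F φ).toLp _) (a t) = pairL ((memLp_testCoef F φ).toLp _) (a 0) +
      ∫ τ in (0 : ℝ)..t, weakRhs F hg φ (a τ) := by
  set P := pairL ((memLp_testCoef F φ).toLp _) with hP
  set Q := pairL ((hg.memLp_mul_testCoef F φ).toLp _) with hQ
  have hac : ContinuousOn a (Icc 0 t) := ha.continuousOn.mono Icc_subset_Ici_self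
  have hfc : ∀ N, ContinuousOn (fun τ => field F hg N (a τ)) (Icc 0 t) := fun N =>
    (continuous_field F hg N).comp_continuousOn hac
  obtain ⟨M, hM⟩ := isCompact_Icc.exists_bound_of_continuousOn hac
  have hM0 : 0 ≤ M := (norm_nonneg _).trans (hM 0 ⟨le_rfl, ht⟩)
  have hN : ∀ n : ℕ, P (proj n (a t)) = P (proj n (a 0)) +
      ∫ τ in (0 : ℝ)..t, P (field F hg n (a τ)) := fun n => by
    rw [ha.eq n t ht, map_add,
      ← P.intervalIntegral_comp_comm ((hfc n).intervalIntegrable_of_Icc ht)]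
  have hlim : ∀ x : H, Tendsto (fun n : ℕ => P (proj n x)) atTop (𝓝 (P x)) := fun x =>
    (P.continuous.tendsto _).comp (tendsto_proj x)
  refine tendsto_nhds_unique (hlim (a t)) ?_
  simp_rw [hN]
  refine (hlim (a 0)).add ?_
  have hnp : ∀ (N : ℝ) (x : H), ‖proj N x‖ ≤ ‖x‖ := fun N x => by
    have h1 := qf_proj_le N (fun _ => 1) x
    rw [qf_one, qf_one, ENNReal.ofReal_le_ofReal_iff (by positivity)] at h1
    exact le_of_sq_le_sq h1 (norm_nonneg _)
  refine intervalIntegral.tendsto_integral_filter_of_dominated_convergence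
    (fun _ => ‖Q‖ * M + M * M * ∫ ξ, absD ξ * ‖testCoef F φ ξ‖) ?_ ?_ intervalIntegrable_const ?_
  · refine Eventually.of_forall fun n => ?_
    rw [uIoc_of_le ht]
    exact ((P.continuous.comp_continuousOn (hfc n)).mono
      Ioc_subset_Icc_self).aestronglyMeasurable measurableSet_Ioc
  · refine Eventually.of_forall fun n => Eventually.of_forall fun τ hτ => ?_
    rw [uIoc_of_le ht] at hτ
    have h1 := hM τ ⟨hτ.1.le, hτ.2⟩
    rw [hP, pairL_field]
    refine (norm_sub_le _ _).trans (add_le_add ?_ ?_)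
    · exact (Q.le_opNorm _).trans (by gcongr; exact (hnp _ _).trans h1)
    · refine (norm_bilPair_le F n φ (a τ)).trans ?_
      have h2 : 0 ≤ ∫ ξ, absD ξ * ‖testCoef F φ ξ‖ :=
        integral_nonneg fun ξ => mul_nonneg (absD_nonneg ξ) (norm_nonneg _)
      gcongr
  · refine Eventually.of_forall fun τ hτ => ?_
    simp only [hP, pairL_field]
    exact ((Q.continuous.tendsto _).comp (tendsto_proj (a τ))).sub (tendsto_bilPair F φ (a τ))

/-- A test field whose Fourier transform is a smooth compactly supported multiple of a basis
vector. -/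
def bandTest {h : E3 → ℝ} (hh : ContDiff ℝ (⊤ : ℕ∞) h) (hc : HasCompactSupport h) (k : Fin 4) :
    SchwartzMap E3 C4 :=
  𝓕⁻ (HasCompactSupport.toSchwartzMap (f := fun ξ => h ξ • (EuclideanSpace.single k (1 : ℂ) : C4))
    (hc.smul_right) (hh.smul contDiff_const))

theorem testCoef_bandTest (F : ℝ) {h : E3 → ℝ} (hh : ContDiff ℝ (⊤ : ℕ∞) h)
    (hc : HasCompactSupport h) (k : Fin 4) (ξ : E3) :
    testCoef F (bandTest hh hc k) ξ = h ξ * (starRingEnd ℂ) (evec F ξ k) := by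
  rw [testCoef, bandTest, fourier_fourierInv_eq]
  change inner ℂ (evec F ξ) (h ξ • (EuclideanSpace.single k (1 : ℂ) : C4)) = _
  rw [← Complex.coe_smul, inner_smul_right, EuclideanSpace.inner_single_right]
  simp

/-- Test fields with Fourier transform compactly supported in `|D| < N` do not see the truncation,
so the weak identity says that the defect `X` of the level-`N` equation is orthogonal to all of
them. -/
theorem isScalarSol_of_weak_eq {hg : DiffSym ν₀ g} (hF : 0 < F) {a : ℝ → H}
    (hac : ContinuousOn a (Ici 0))
    (h : ∀ φ : SchwartzMap E3 C4, ∀ t, 0 ≤ t →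
      pairL ((memLp_testCoef F φ).toLp _) (a t) = pairL ((memLp_testCoef F φ).toLp _) (a 0) +
        ∫ τ in (0 : ℝ)..t, weakRhs F hg φ (a τ)) : IsScalarSol F hg a := by
  refine ⟨hac, fun N t ht => ?_⟩
  have hfc : ContinuousOn (fun τ => field F hg N (a τ)) (Icc 0 t) :=
    (continuous_field F hg N).comp_continuousOn (hac.mono Icc_subset_Ici_self)
  have hfi := hfc.intervalIntegrable_of_Icc (μ := volume) ht
  set X : H := proj N (a t) - proj N (a 0) - ∫ τ in (0 : ℝ)..t, field F hg N (a τ) with hX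
  have hXp : proj N X = X := by
    rw [hX, map_sub, map_sub, proj_proj le_rfl, proj_proj le_rfl,
      ← (proj N).intervalIntegral_comp_comm hfi]
    simp_rw [proj_field F hg le_rfl]
  have hX0 : X = 0 := by
    have hopen : IsOpen {ξ : E3 | absD ξ < N} := isOpen_lt continuous_absD continuous_const
    have hz : ∀ k, ∀ᵐ ξ, ξ ∈ {ξ : E3 | absD ξ < N} →
        (starRingEnd ℂ) (X ξ) * (starRingEnd ℂ) (evec F ξ k) = 0 := by
      intro k
      refine hopen.ae_eq_zero_of_integral_contDiff_smul_eq_zero ?_ fun η hη hηc hηs => ?_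
      · refine LocallyIntegrable.locallyIntegrableOn ?_ _
        have h1 : MemLp (fun ξ => (starRingEnd ℂ) (X ξ) * (starRingEnd ℂ) (evec F ξ k)) 2
            volume := by
          refine (Lp.memLp X).of_le ((Complex.continuous_conj.measurable.comp
            (measurable_coe X)).mul (Complex.continuous_conj.measurable.comp
            (measurable_evec F k))).aestronglyMeasurable (Eventually.of_forall fun ξ => ?_)
          rw [norm_mul, RCLike.norm_conj, RCLike.norm_conj]
          exact mul_le_of_le_one_right (norm_nonneg _) (norm_evec_apply_le F ξ k)
        exact h1.locallyIntegrable (by norm_num)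
      · set φ := bandTest hη hηc k with hφ
        have hsupp : ∀ ξ, ¬ absD ξ < N → testCoef F φ ξ = 0 := fun ξ hξ => by
          have h1 : η ξ = 0 := by
            by_contra h2
            exact hξ (hηs (subset_tsupport η h2))
          rw [hφ, testCoef_bandTest, h1]; simp
        set P := pairL ((memLp_testCoef F φ).toLp _) with hP
        have hPproj : ∀ x, P (proj N x) = P x := fun x => by
          rw [hP, pairL_toLp, pairL_toLp]
          refine integral_congr_ae ?_
          filter_upwards [proj_coe N x] with ξ h1
          rw [h1]
          split_ifs with h2
          · rfl
          · rw [hsupp ξ h2]; simp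
        have hPf : ∀ x, P (field F hg N x) = weakRhs F hg φ x := fun x => by
          rw [hP, pairL_field, weakRhs]
          congr 1
          · rw [pairL_toLp, pairL_toLp]
            refine integral_congr_ae ?_
            filter_upwards [proj_coe N x] with ξ h1
            rw [h1]
            split_ifs with h2
            · rfl
            · rw [hsupp ξ h2]; simp
          · refine integral_congr_ae (Eventually.of_forall fun ξ => ?_)
            dsimp only
            split_ifs with h2
            · rfl
            · rw [hsupp ξ h2]; simp
        have hPX : P X = 0 := by
          rw [hX, map_sub, map_sub, hPproj, hPproj, ← P.intervalIntegral_comp_comm hfi, h φ t ht]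
          simp_rw [hPf]
          ring
        rw [hP, pairL_toLp] at hPX
        rw [← hPX]
        refine integral_congr_ae (Eventually.of_forall fun ξ => ?_)
        dsimp only
        rw [hφ, testCoef_bandTest, Complex.real_smul]
        ring
    rw [Lp.eq_zero_iff_ae_eq_zero]
    have hb := proj_coe N X
    rw [hXp] at hb
    filter_upwards [ae_all_iff.2 hz, hb, ae_ne_zero] with ξ h1 h2 h3
    by_cases hξ : absD ξ < N
    -- Testing along the four basis vectors kills every component of `X • evec`. Since `evec` is a
    -- unit vector for nonzero `ξ`, `X` itself vanishes.
    · have h4 : X ξ • evec F ξ = 0 := by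
        ext k
        have h5 := congrArg (starRingEnd ℂ) (h1 k hξ)
        simpa using h5
      rcases smul_eq_zero.1 h4 with h5 | h5
      · exact h5
      · have := norm_evec hF h3
        rw [h5] at this
        simp at this
    · rw [h2, if_neg hξ]; rfl
  have := sub_eq_zero.1 hX0
  rw [← this]; abel

end

theorem pair_add_convPair_eq {F ν ν' ν₀ : ℝ} (hg : DiffSym ν₀ (gammaR ν ν' F)) {f : Field}
    (hf : IsQG F f) (φ : SchwartzMap E3 C4) :
    pair f (gammaTest ν ν' F φ) + convPair f (qTest F φ) = weakRhs F hg φ (toScal F f) := by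
  rw [pair_gammaTest hg hf, convPair_qTest hf, weakRhs, pairL_toLp, sub_eq_add_neg, ← integral_neg]
  congr 1
  · refine integral_congr_ae (Eventually.of_forall fun ξ => ?_)
    simp only [map_mul, Complex.conj_ofReal]
    ring
  · refine integral_congr_ae (Eventually.of_forall fun ξ => ?_)
    simp only [map_neg, neg_mul]

theorem pair_eq_pairL {F : ℝ} {f : Field} (hf : IsQG F f) (φ : SchwartzMap E3 C4) :
    pair f φ = pairL ((memLp_testCoef F φ).toLp _) (toScal F f) := by
  rw [pair_schwartz hf, pairL_toLp]

theorem isSolution_of_isScalarSol {F ν ν' ν₀ : ℝ} {hg : DiffSym ν₀ (gammaR ν ν' F)}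
    {U : ℝ → Field} (hQ : ∀ t, 0 ≤ t → IsQG F (U t))
    (ha : IsScalarSol F hg fun t => toScal F (U t)) : IsSolution ν ν' F (U 0) U := by
  refine ⟨rfl, hQ, fun φ t ht => ?_⟩
  rw [pair_eq_pairL (hQ t ht), pair_eq_pairL (hQ 0 le_rfl), ha.weak_eq φ ht]
  congr 1
  refine intervalIntegral.integral_congr fun τ hτ => ?_
  rw [uIcc_of_le ht] at hτ
  exact (pair_add_convPair_eq hg (hQ τ hτ.1) φ).symm

theorem IsSolution.isScalarSol {F ν ν' ν₀ : ℝ} (hF : 0 < F) (hg : DiffSym ν₀ (gammaR ν ν' F))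
    {U₀ : Field} {U : ℝ → Field} (hU : IsSolution ν ν' F U₀ U)
    (hc : ContinuousOn (fun t => toScal F (U t)) (Ici 0)) :
    IsScalarSol F hg fun t => toScal F (U t) := by
  refine isScalarSol_of_weak_eq hF hc fun φ t ht => ?_
  have h := hU.equation φ t ht
  rw [← hU.initial, pair_eq_pairL (hU.isQG t ht), pair_eq_pairL (hU.isQG 0 le_rfl)] at h
  rw [h]
  congr 1
  refine intervalIntegral.integral_congr fun τ hτ => ?_
  rw [uIcc_of_le ht] at hτ
  exact pair_add_convPair_eq hg (hU.isQG τ hτ.1) φ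

end QuasiGeo
end

noncomputable section

namespace QuasiGeo

variable {F ν₀ : ℝ} {g : E3 → ℝ}

/-! ### Norms of quasi-geostrophic fields -/

theorem fhat_injective : Function.Injective fhat := by
  intro f h hfh
  have h1 : ofRealCLM.compLp f = ofRealCLM.compLp h :=
    (Lp.fourierTransformₗᵢ E3 C4).injective hfh
  ext1
  filter_upwards [ofRealCLM.coeFn_compLp f, ofRealCLM.coeFn_compLp h] with x h2 h3
  rw [h1, h3] at h2
  ext k
  have h4 := congrArg (fun v : C4 => v k) h2
  exact (Complex.ofReal_injective h4).symm

theorem IsQG.eq_of_toScal_eq {f h : Field} (hf : IsQG F f) (hh : IsQG F h)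
    (heq : toScal F f = toScal F h) : f = h := by
  apply fhat_injective
  ext1
  filter_upwards [hf.fhat_eq, hh.fhat_eq] with ξ h1 h2
  rw [h1, h2, heq]

theorem rpow_half_of_sq (x : ℝ≥0∞) : (x ^ 2) ^ (1 / 2 : ℝ) = x := by
  rw [← ENNReal.rpow_natCast, ← ENNReal.rpow_mul]
  norm_num

theorem le_rpow_half_of_sq_le {x M : ℝ≥0∞} (h : x ^ 2 ≤ M) : x ≤ M ^ (1 / 2 : ℝ) := by
  rw [← rpow_half_of_sq x]
  exact ENNReal.rpow_le_rpow h (by norm_num)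

theorem rpow_half_sq (x : ℝ≥0∞) : (x ^ (1 / 2 : ℝ)) ^ 2 = x := by
  rw [← ENNReal.rpow_natCast, ← ENNReal.rpow_mul]
  norm_num

theorem absD_rpow_two_mul (r : ℝ) (ξ : E3) : absD ξ ^ (2 * r) = (absD ξ ^ 2) ^ r := by
  rw [← Real.rpow_natCast, ← Real.rpow_mul (absD_nonneg ξ)]
  norm_num

theorem absD_rpow_le_sobW_of_le {r s : ℝ} (hr : 0 ≤ r) (hrs : r ≤ s) (ξ : E3) :
    absD ξ ^ (2 * r) ≤ sobW s ξ := by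
  have h2 := sq_nonneg (absD ξ)
  rw [absD_rpow_two_mul, sobW]
  exact (Real.rpow_le_rpow h2 (by linarith) hr).trans
    (Real.rpow_le_rpow_of_exponent_le (by linarith) hrs)

theorem absD_rpow_le_gradW_of_le {r s : ℝ} (hr : 0 ≤ r) (hrs : r ≤ s) (ξ : E3) :
    absD ξ ^ (2 * (r + 1)) ≤ gradW s ξ := by
  rw [mul_add, Real.rpow_add_of_nonneg (absD_nonneg ξ) (by linarith) (by norm_num), gradW]
  have := absD_rpow_le_sobW_of_le hr hrs ξ
  have h2 := sq_nonneg (absD ξ)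
  norm_num
  gcongr

theorem sobW_le_absD_rpow {p : ℝ} (hp : 0 ≤ p) (ξ : E3) :
    sobW p ξ ≤ 2 ^ p * 1 + 2 ^ p * absD ξ ^ (2 * p) := by
  have h2 := sq_nonneg (absD ξ)
  have h3 : (0 : ℝ) ≤ 2 ^ p := by positivity
  have h4 : 0 ≤ (absD ξ ^ 2) ^ p := by positivity
  rw [absD_rpow_two_mul, sobW]
  rcases le_total (absD ξ ^ 2) 1 with h | h
  · have := Real.rpow_le_rpow (by positivity) (by linarith : 1 + absD ξ ^ 2 ≤ 2) hp
    nlinarith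
  · have := Real.rpow_le_rpow (by positivity) (by linarith : 1 + absD ξ ^ 2 ≤ 2 * absD ξ ^ 2) hp
    rw [Real.mul_rpow (by norm_num) h2] at this
    linarith

theorem homNorm_zero_eq (hF : 0 < F) {f : Field} (hf : IsQG F f) :
    homNorm 0 f = ENNReal.ofReal ‖toScal F f‖ := by
  have h : homNorm 0 f ^ 2 = ENNReal.ofReal ‖toScal F f‖ ^ 2 := by
    rw [homNorm, weightedNorm_sq hF _ hf, ← ENNReal.ofReal_pow (norm_nonneg _), ← qf_one]
    simp
  rw [← rpow_half_of_sq (homNorm 0 f), h, rpow_half_of_sq]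

theorem sobNorm_sq (hF : 0 < F) (s : ℝ) {f : Field} (hf : IsQG F f) :
    sobNorm s f ^ 2 = qf (sobW s) (toScal F f) :=
  weightedNorm_sq hF _ hf

theorem gradSobNorm_sq (hF : 0 < F) (s : ℝ) {f : Field} (hf : IsQG F f) :
    gradSobNorm s f ^ 2 = qf (gradW s) (toScal F f) := by
  rw [gradSobNorm, weightedNorm_sq hF _ hf]
  congr 1
  ext ξ
  rw [gradW, sobW, mul_comm]

/-! ### The spaces `Ė^s` -/

theorem memE_of_qf_le (hF : 0 < F) {r s : ℝ} (hr : 0 ≤ r) (hrs : r ≤ s) {M M' : ℝ≥0∞}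
    (hM : M ≠ ∞) (hM' : M' ≠ ∞) {U : ℝ → Field} (hQ : ∀ t, 0 ≤ t → IsQG F (U t))
    (hc : ∀ t, 0 ≤ t → Tendsto (fun τ => qf (sobW s) (toScal F (U τ) - toScal F (U t) : H))
      (𝓝[Ici 0] t) (𝓝 0))
    (hsup : ∀ t, 0 ≤ t → qf (sobW s) (toScal F (U t)) ≤ M)
    (hint : ∀ t, 0 ≤ t → ∫⁻ τ in Icc 0 t, qf (gradW s) (toScal F (U τ)) ≤ M') : MemE r U := by
  refine ⟨fun t ht => ?_, ?_, ?_⟩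
  · have h1 : Tendsto (fun τ => qf (sobW s) (toScal F (U τ) - toScal F (U t) : H) ^ (1 / 2 : ℝ))
        (𝓝[Ici 0] t) (𝓝 0) := by
      have h := ((ENNReal.continuous_rpow_const (y := 1 / 2)).tendsto 0).comp (hc t ht)
      rwa [ENNReal.zero_rpow_of_pos (by norm_num)] at h
    refine tendsto_of_tendsto_of_tendsto_of_le_of_le' tendsto_const_nhds h1
      (Eventually.of_forall fun _ => zero_le) ?_
    filter_upwards [self_mem_nhdsWithin] with τ hτ
    apply le_rpow_half_of_sq_le
    rw [homNorm, weightedNorm_sq hF _ ((hQ τ hτ).sub (hQ t ht)), toScal_sub]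
    exact qf_mono (absD_rpow_le_sobW_of_le hr hrs) _
  · refine lt_of_le_of_lt (iSup₂_le fun t ht => ?_)
      (ENNReal.rpow_lt_top_of_nonneg (by norm_num : (0 : ℝ) ≤ 1 / 2) hM)
    apply le_rpow_half_of_sq_le
    rw [homNorm, weightedNorm_sq hF _ (hQ t ht)]
    exact (qf_mono (absD_rpow_le_sobW_of_le hr hrs) _).trans (hsup t ht)
  · refine lt_of_le_of_lt ?_ hM'.lt_top
    have hU : Ici (0 : ℝ) = ⋃ n : ℕ, Icc 0 (n : ℝ) := by
      ext x
      simp only [mem_Ici, mem_iUnion, mem_Icc]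
      refine ⟨fun h => ?_, fun ⟨n, h⟩ => h.1⟩
      obtain ⟨n, hn⟩ := exists_nat_ge x
      exact ⟨n, h, hn⟩
    have hmono : Monotone fun n : ℕ => Icc (0 : ℝ) n := fun m n h =>
      Icc_subset_Icc_right (by exact_mod_cast h)
    rw [hU, setLIntegral_iUnion_of_directed _ hmono.directed_le]
    refine iSup_le fun n => le_trans ?_ (hint n n.cast_nonneg)
    refine setLIntegral_mono' measurableSet_Icc fun τ hτ => ?_
    rw [homNorm, weightedNorm_sq hF _ (hQ τ hτ.1)]
    exact qf_mono (absD_rpow_le_gradW_of_le hr hrs) _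

theorem MemE.continuousOn_toScal (hF : 0 < F) {V : ℝ → Field} (hV : MemE 0 V)
    (hQ : ∀ t, 0 ≤ t → IsQG F (V t)) : ContinuousOn (fun t => toScal F (V t)) (Ici 0) := by
  intro t ht
  rw [ContinuousWithinAt, tendsto_iff_norm_sub_tendsto_zero]
  have h := (ENNReal.tendsto_toReal ENNReal.zero_ne_top).comp (hV.continuous t ht)
  refine h.congr' ?_
  filter_upwards [self_mem_nhdsWithin] with τ hτ
  rw [Function.comp_apply, homNorm_zero_eq hF ((hQ τ hτ).sub (hQ t ht)),
    ENNReal.toReal_ofReal (norm_nonneg _), toScal_sub]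

/-- The inhomogeneous norm is bounded by L² plus the homogeneous norm. The L² part is only bounded
in time, so integrability is local; that suffices for uniqueness on each `[0, T]`. -/
theorem MemE.lintegral_qf_ne_top (hF : 0 < F) {s : ℝ} (hs : 0 ≤ s) {V : ℝ → Field} (hV : MemE 0 V)
    (hVs : MemE s V) (hQ : ∀ t, 0 ≤ t → IsQG F (V t)) (T : ℝ) :
    ∫⁻ τ in Icc 0 T, qf (sobW (s + 1)) (toScal F (V τ)) ≠ ∞ := by
  set S := ⨆ t ∈ Ici (0 : ℝ), homNorm 0 (V t)
  set K := ENNReal.ofReal (2 ^ (s + 1))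
  have hbound : ∀ τ ∈ Icc 0 T, qf (sobW (s + 1)) (toScal F (V τ)) ≤
      K * S ^ 2 + K * homNorm (s + 1) (V τ) ^ 2 := fun τ hτ => by
    have h1 := qf_le_add (w := sobW (s + 1)) (w₁ := fun _ => 1)
      (w₂ := fun ξ => absD ξ ^ (2 * (s + 1))) (α := 2 ^ (s + 1)) (β := 2 ^ (s + 1))
      (by positivity) (by positivity) measurable_const (fun _ => zero_le_one)
      (continuous_absD.measurable.pow_const _)
      (fun ξ => Real.rpow_nonneg (absD_nonneg ξ) _) (sobW_le_absD_rpow (by linarith))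
      (measurable_coe (toScal F (V τ)))
    rw [← weightedNorm_sq hF (fun _ => 1) (hQ τ hτ.1),
      ← weightedNorm_sq hF (fun ξ => absD ξ ^ (2 * (s + 1))) (hQ τ hτ.1)] at h1
    refine h1.trans ?_
    gcongr
    · refine le_trans (le_of_eq ?_) (le_iSup₂ (f := fun t (_ : t ∈ Ici (0 : ℝ)) => homNorm 0 (V t))
        τ hτ.1)
      simp [homNorm]
    · exact le_rfl
  refine ((setLIntegral_mono' measurableSet_Icc hbound).trans_lt ?_).ne
  rw [lintegral_add_left measurable_const, lintegral_const,
    lintegral_const_mul' _ _ ENNReal.ofReal_ne_top]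
  refine ENNReal.add_lt_top.2 ⟨?_, ENNReal.mul_lt_top ENNReal.ofReal_lt_top
    ((lintegral_mono_set Icc_subset_Ici_self).trans_lt hVs.integral_lt_top)⟩
  refine ENNReal.mul_lt_top (ENNReal.mul_lt_top ENNReal.ofReal_lt_top
    (ENNReal.pow_lt_top hV.sup_lt_top)) ?_
  simp

theorem IsScalarSol.congr {hg : DiffSym ν₀ g} {a b : ℝ → H} (ha : IsScalarSol F hg a)
    (h : ∀ t, 0 ≤ t → b t = a t) : IsScalarSol F hg b := by
  refine ⟨ha.continuousOn.congr h, fun N t ht => ?_⟩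
  rw [h t ht, h 0 le_rfl, ha.eq N t ht]
  congr 1
  refine intervalIntegral.integral_congr fun τ hτ => ?_
  rw [uIcc_of_le ht] at hτ
  simp only [h τ hτ.1]

/-! ### Existence and uniqueness -/

/-- A bound on the approximate solutions yields a global solution with the same bound, unique in
its class. -/
theorem exists_unique_solution {ν ν' s M : ℝ} (hF : 0 < F) (hν₀ : 0 < ν₀)
    (hg : DiffSym ν₀ (gammaR ν ν' F)) (hs : 1 / 2 < s) {U₀ : Field} (hU₀ : IsQG F U₀)
    (hM : UniformBound F hg s (toScal F U₀) M) :
    ∃ U : ℝ → Field, (IsSolution ν ν' F U₀ U ∧ MemE 0 U ∧ MemE s U) ∧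
      (∀ V : ℝ → Field, IsSolution ν ν' F U₀ V → MemE 0 V → MemE s V → ∀ t, 0 ≤ t → V t = U t) ∧
      ∀ t, 0 ≤ t → (⨆ τ ∈ Icc 0 t, sobNorm s (U τ)) ^ 2 +
        ENNReal.ofReal ν₀ * ∫⁻ τ in Icc 0 t, gradSobNorm s (U τ) ^ 2 ≤ 2 * ENNReal.ofReal M := by
  have hs0 : 0 ≤ s := by linarith
  obtain ⟨a, ha, ha0, hherm, hsup, hint⟩ := exists_isScalarSol hν₀ hs (hermOp_toScal F U₀) hM
  have hex : ∀ t, ∃ f : Field, 0 ≤ t → IsQG F f ∧ toScal F f = a t := fun t => by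
    by_cases ht : 0 ≤ t
    · obtain ⟨f, hf⟩ := exists_toScal_eq hF (hherm t ht)
      exact ⟨f, fun _ => hf⟩
    · exact ⟨0, fun h => absurd h ht⟩
  choose U hU using hex
  have hQ : ∀ t, 0 ≤ t → IsQG F (U t) := fun t ht => (hU t ht).1
  have hUa : ∀ t, 0 ≤ t → toScal F (U t) = a t := fun t ht => (hU t ht).2
  have hsol : IsScalarSol F hg fun t => toScal F (U t) := ha.congr hUa
  have hU0 : U 0 = U₀ :=
    (hQ 0 le_rfl).eq_of_toScal_eq hU₀ ((hUa 0 le_rfl).trans ha0)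
  have hsup' : ∀ t, 0 ≤ t → qf (sobW s) (toScal F (U t)) ≤ ENNReal.ofReal M := fun t ht => by
    rw [hUa t ht]; exact hsup t ht
  have hint' : ∀ t, 0 ≤ t → ENNReal.ofReal ν₀ * ∫⁻ τ in Icc 0 t, qf (gradW s) (toScal F (U τ)) ≤
      ENNReal.ofReal M := fun t ht => by
    rw [setLIntegral_congr_fun (g := fun τ => qf (gradW s) (a τ)) measurableSet_Icc
      fun τ hτ => by simp only [hUa τ hτ.1]]
    exact hint t ht
  have hν : ENNReal.ofReal ν₀ ≠ 0 := (ENNReal.ofReal_pos.2 hν₀).ne'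
  have hint'' : ∀ t, 0 ≤ t → ∫⁻ τ in Icc 0 t, qf (gradW s) (toScal F (U τ)) ≤
      ENNReal.ofReal M / ENNReal.ofReal ν₀ := fun t ht => by
    rw [ENNReal.le_div_iff_mul_le (Or.inl hν) (Or.inl ENNReal.ofReal_ne_top), mul_comm]
    exact hint' t ht
  have htop : ENNReal.ofReal M / ENNReal.ofReal ν₀ ≠ ∞ := ENNReal.div_ne_top ENNReal.ofReal_ne_top hν
  have hai : ∀ T, ∫⁻ τ in Icc 0 T, qf (sobW (s + 1)) (toScal F (U τ)) ≠ ∞ := fun T => by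
    rcases lt_or_ge T 0 with hT | hT
    · simp [Icc_eq_empty hT.not_ge]
    have hb : ∀ τ ∈ Icc 0 T, qf (sobW (s + 1)) (toScal F (U τ)) ≤
        ENNReal.ofReal M + qf (gradW s) (toScal F (U τ)) := fun τ hτ => by
      have h1 := qf_le_add (w := sobW (s + 1)) (w₁ := sobW s) (w₂ := gradW s) zero_le_one
        zero_le_one (measurable_sobW s) (fun ξ => (sobW_pos s ξ).le)
        (continuous_gradW s).measurable (gradW_nonneg s)
        (fun ξ => by rw [sobW_add_one]; linarith) (measurable_coe (toScal F (U τ)))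
      rw [ENNReal.ofReal_one, one_mul, one_mul] at h1
      exact h1.trans (by gcongr; exact hsup' τ hτ.1)
    refine ((setLIntegral_mono' measurableSet_Icc hb).trans_lt ?_).ne
    rw [lintegral_add_left measurable_const]
    refine ENNReal.add_lt_top.2 ⟨?_, (hint'' T hT).trans_lt htop.lt_top⟩
    rw [lintegral_const]
    exact ENNReal.mul_lt_top ENNReal.ofReal_lt_top (by simp)
  have hc : ∀ t, 0 ≤ t → Tendsto (fun τ => qf (sobW s) (toScal F (U τ) - toScal F (U t) : H))
      (𝓝[Ici 0] t) (𝓝 0) := fun t ht =>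
    hsol.tendsto_qf_sub hν₀ hs ENNReal.ofReal_ne_top hsup' hai ht
  refine ⟨U, ⟨hU0 ▸ isSolution_of_isScalarSol hQ hsol,
    memE_of_qf_le hF le_rfl hs0 ENNReal.ofReal_ne_top htop hQ hc hsup' hint'',
    memE_of_qf_le hF hs0 le_rfl ENNReal.ofReal_ne_top htop hQ hc hsup' hint''⟩,
    fun V hV hV0 hVs t ht => ?_, fun t _ => ?_⟩
  · have hVsol := hV.isScalarSol hF hg (hV0.continuousOn_toScal hF hV.isQG)
    refine (hV.isQG t ht).eq_of_toScal_eq (hQ t ht) ?_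
    exact hVsol.unique hν₀ hsol hs (hV0.lintegral_qf_ne_top hF hs0 hVs hV.isQG) hai
      (by simp only [hV.initial, hU0]) ht
  -- The supremum and the time integral survive the limit as separate bounds, each by `M`. This is
  -- the origin of the factor 2.
  · rw [two_mul]
    refine add_le_add ?_ ?_
    · rw [← rpow_half_sq (ENNReal.ofReal M)]
      gcongr
      refine iSup₂_le fun τ hτ => le_rpow_half_of_sq_le ?_
      rw [sobNorm_sq hF s (hQ τ hτ.1)]
      exact hsup' τ hτ.1
    · rename_i ht
      refine le_trans (le_of_eq ?_) (hint' t ht)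
      congr 1
      exact setLIntegral_congr_fun measurableSet_Icc fun τ hτ => gradSobNorm_sq hF s (hQ τ hτ.1)

/-- The a priori bound is in terms of the squared norm `y = x²`, and `max(1, x²)^(1/(2δ)) = max(1,
x^(1/δ))` recovers the exponent of the statement. -/
theorem ofReal_bound_eq {C δ : ℝ} (hC : 0 < C) (hδ : 0 < δ) {x y : ℝ≥0∞} (hx : x < ∞)
    (hy : x ^ 2 = y) :
    2 * ENNReal.ofReal (C * (y.toReal * max 1 y.toReal ^ (1 / (2 * δ)))) =
      ENNReal.ofReal (2 * C) * x ^ 2 * max 1 (x ^ (1 / δ)) := by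
  subst hy
  lift x to NNReal using hx.ne
  have h1 : max 1 ((x : ℝ) ^ 2) ^ (1 / (2 * δ)) = max 1 ((x : ℝ) ^ (1 / δ)) := by
    have hp : (0 : ℝ) ≤ 1 / (2 * δ) := by positivity
    rw [(Real.monotoneOn_rpow_Ici_of_exponent_nonneg hp).map_max (by simp)
      (by simp : (x : ℝ) ^ 2 ∈ Ici (0 : ℝ)), Real.one_rpow, ← Real.rpow_natCast,
      ← Real.rpow_mul x.coe_nonneg]
    congr 2
    push_cast
    field_simp
  have h2 : (x : ℝ≥0∞) ^ (1 / δ) = ENNReal.ofReal ((x : ℝ) ^ (1 / δ)) := by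
    rw [← ENNReal.ofReal_rpow_of_nonneg x.coe_nonneg (by positivity), ENNReal.ofReal_coe_nnreal]
  have h3 : ((x : ℝ≥0∞) ^ 2).toReal = (x : ℝ) ^ 2 := by simp
  rw [h3, h1, h2, ← ENNReal.ofReal_one, ← ENNReal.ofReal_max, ENNReal.ofReal_mul hC.le,
    ENNReal.ofReal_mul (by positivity), ENNReal.ofReal_mul (by norm_num),
    ENNReal.ofReal_pow x.coe_nonneg, ENNReal.ofReal_coe_nnreal]
  rw [ENNReal.ofReal_ofNat]
  ring

end QuasiGeo
end

/-! ### The main theorem -/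

open QuasiGeo in
theorem theorem1p2 (F δ ν₀ : ℝ) (hF : 0 < F) (hδ : 0 < δ) (hν₀ : 0 < ν₀) :
    ∃ C : ℝ, 0 < C ∧ ∀ ν ν' : ℝ, min ν ν' = ν₀ →
      ∀ U₀ : Field, sobNorm (1 / 2 + δ) U₀ < ∞ → IsQG F U₀ →
        ∃ U : ℝ → Field,
          (IsSolution ν ν' F U₀ U ∧ MemE 0 U ∧ MemE (1 / 2 + δ) U) ∧
          (∀ V : ℝ → Field, IsSolution ν ν' F U₀ V → MemE 0 V → MemE (1 / 2 + δ) V →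
            ∀ t, 0 ≤ t → V t = U t) ∧
          (δ ≤ 1 / 2 → ∀ t, 0 ≤ t →
            (⨆ τ ∈ Icc 0 t, sobNorm (1 / 2 + δ) (U τ)) ^ 2 +
                ENNReal.ofReal ν₀ * ∫⁻ τ in Icc 0 t, gradSobNorm (1 / 2 + δ) (U τ) ^ 2 ≤
              ENNReal.ofReal C * sobNorm (1 / 2 + δ) U₀ ^ 2 *
                max 1 (sobNorm (1 / 2 + δ) U₀ ^ (1 / δ))) := by
  have hfin : ∀ {U₀ : Field}, sobNorm (1 / 2 + δ) U₀ < ∞ → IsQG F U₀ →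
      qf (sobW (1 / 2 + δ)) (toScal F U₀) < ∞ := fun hU₀ hQ => by
    rw [← sobNorm_sq hF _ hQ]
    exact ENNReal.pow_lt_top hU₀
  rcases le_or_gt δ (1 / 2) with h | h
  -- `C` is obtained before the diffusion symbol and the data are introduced, so it depends on the
  -- viscosities only through `ν₀`.
  · obtain ⟨C, hC, hb⟩ := exists_uniform_bound_of_le_half hF hν₀ hδ h
    refine ⟨2 * C, by positivity, fun ν ν' hν U₀ hU₀ hQ => ?_⟩
    obtain ⟨U, hU, huniq, hest⟩ := exists_unique_solution (s := 1 / 2 + δ) hF hν₀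
      (diffSym_gammaR hF hν₀ hν) (by linarith) hQ (hb _ (hfin hU₀ hQ))
    refine ⟨U, hU, huniq, fun _ t ht => (hest t ht).trans_eq ?_⟩
    exact ofReal_bound_eq hC hδ hU₀ (sobNorm_sq hF _ hQ)
  -- For `δ > 1/2` no explicit estimate is claimed, so the constant is arbitrary; the bound `M` may
  -- depend on the data.
  · refine ⟨1, one_pos, fun ν ν' hν U₀ hU₀ hQ => ?_⟩
    obtain ⟨M, hM⟩ := exists_uniform_bound_of_one_le (s := 1 / 2 + δ) hF hν₀ (by linarith)
      (diffSym_gammaR hF hν₀ hν) (hfin hU₀ hQ)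
    obtain ⟨U, hU, huniq, -⟩ := exists_unique_solution (s := 1 / 2 + δ) hF hν₀
      (diffSym_gammaR hF hν₀ hν) (by linarith) hQ hM
    exact ⟨U, hU, huniq, fun h' => absurd h' h.not_ge⟩
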